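/- **Setting.** A query $Q[F]=\bigoplus_{x\notin F}\bigotimes_{i=1}^{n}R_i[S_i]$ has finitely many variables, each occurring in some schema $S_i$, and a set $F$ of free variables; the others are bound. Each variable $x$ has a domain $\mathrm{Dom}(x)$. Over a commutative ring $D$, a relation $R_i$ is a map from tuples over $S_i$ to payloads in $D$ that is nonzero at finitely many tuples (its keys). A database $\mathcal D$ is a family $(R_i)_i$, and its size $N$ is the total number of keys. With lifting functions $g_x:\mathrm{Dom}(x)\to D$ for bound $x$, the query result is $$Q[t]=\sum_{s:\ s|_F=t}\ \prod_{i} R_i[s|_{S_i}]\prod_{x\notin F}g_x(s(x)),$$ where $s$ ranges over the valuations of all variables. A tuple $t$ over $F$ has a derivation if some $s$ with $s|_F=t$ satisfies $R_i[s|_{S_i}]\ne 0$ for all $i$. A single-tuple update adds a payload $p\in D$ to $R_i[t]$ for one $i$ and one tuple $t$. **Query classes.** $Q$ is acyclic if it has a join tree: a tree on the relations in which variables shared by two relations occur in every relation on the path between them. $Q$ is free-connex acyclic if it is acyclic and stays acyclic after adding a relation with schema $F$. Let $\mathrm{rels}(x)$ be the set of relations whose schema contains $x$. $Q$ is hierarchical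 if for all $x,y$ the sets $\mathrm{rels}(x),\mathrm{rels}(y)$ are disjoint or one contains the other; it is $q$-hierarchical if moreover $\mathrm{rels}(x)\supsetneq\mathrm{rels}(y)$ and $y\in F$ imply $x\in F$. **F-IVM.** A variable order is a rooted forest on the variables such that the variables of each relation lie on one root-to-leaf path; it is free-top if no bound variable is an ancestor of a free one. Let $\mathrm{dep}(x)$ be the set of ancestors of $x$ that occur together in some schema with some variable of the subtree rooted at $x$. The view tree has as leaves the input relations, each placed under its lowest variable, and for every variable $x$ the view $H^{@x}$ over $\{x\}\cup\mathrm{dep}(x)$, which is the join of the child views of $x$ (the relations under $x$ and the views $V^{@y}$ of the children $y$ of $x$), and the view $V^{@x}=\bigoplus_x H^{@x}$ over $\mathrm{dep}(x)$ (free variables are marginalized with lifting function $1$). F-IVM maintains $Q$ by keeping all these views, for some free-top variable order, materialized in hash maps (possibly with auxiliary index structures) after preprocessing, every update and every enumeration. **Cost.** Time is the number of steps of a random access machine with a fixed finite program, finitely many registers and finitely many hash maps. One step is a copy or an equality test of data values, a ring operation, a test of a payload for $0$, an application of a lifting function, a hash map access, or the input or output of one tuple with its payload. Program and $O$-constants depend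 on $Q$ only, not on the domains, the ring, the lifting functions or the database. **Theorem.** Let $Q$ be a query, and let $N$ denote the size of the current database. 1. If $Q$ is free-connex acyclic, then F-IVM maintains $Q$ with $O(N+1)$ preprocessing time, $O(1)$ enumeration delay, and $O(N+1)$ time per single-tuple update. 2. If $Q$ is $q$-hierarchical, then F-IVM maintains $Q$ with $O(N+1)$ preprocessing time, $O(1)$ enumeration delay, and $O(1)$ time per single-tuple update. Here enumeration outputs, without repetition, pairs $(t,Q[t])$ such that every $t$ with $Q[t]\ne 0$ is output and every output $t$ has a derivation; if $D$ has no zero divisors, exactly the tuples with $Q[t]\neq 0$ are output. The delay bounds the time before the first output, between consecutive outputs, and after the last output. -/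

import Mathlib

open scoped Classical

universe u v

noncomputable section

namespace FIVM

/-! ## Queries -/

/-- A query with natural joins and group-by aggregates
`Q[free] = ⨁_{x ∉ free} ⨂_i R_i[sch i]`
over the variables `Fin m` and the relations `R_i`, `i : Fin n`. The variables of the query are
those that occur in the schemas of its relations. -/
structure Query where
  m : ℕ
  n : ℕ
  sch : Fin n → Finset (Fin m)
  free : Finset (Fin m)
  covered : ∀ x, ∃ i, x ∈ sch i

/-- `T` is a join tree for relations with schemas `sch`: a tree on the relations such that
variables shared by two relations occur in all relations on the path between them.
(A tree is a connected acyclic graph; the empty tree is allowed.) -/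
def IsJoinTree {ι V : Type} [DecidableEq V] (sch : ι → Finset V) (T : SimpleGraph ι) : Prop :=
  T.Preconnected ∧ T.IsAcyclic ∧
    ∀ (i j : ι) (p : T.Walk i j), p.IsPath → ∀ k ∈ p.support, sch i ∩ sch j ⊆ sch k

namespace Query

variable (Q : Query)

/-- The query is (α-)acyclic. -/
def Acyclic : Prop := ∃ T : SimpleGraph (Fin Q.n), IsJoinTree Q.sch T

/-- The query is acyclic and stays acyclic after adding a relation (`none`) whose schema is the
set of free variables. -/
def FreeConnexAcyclic : Prop :=
  Q.Acyclic ∧ ∃ T : SimpleGraph (Option (Fin Q.n)),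
    IsJoinTree (fun o : Option (Fin Q.n) => o.elim Q.free Q.sch) T

/-- The relations whose schema contains the variable `x`. -/
def rels (x : Fin Q.m) : Finset (Fin Q.n) := Finset.univ.filter fun i => x ∈ Q.sch i

def Hierarchical : Prop :=
  ∀ x y, Q.rels x ⊆ Q.rels y ∨ Q.rels y ⊆ Q.rels x ∨ Disjoint (Q.rels x) (Q.rels y)

def QHierarchical : Prop :=
  Q.Hierarchical ∧ ∀ x y, Q.rels y ⊂ Q.rels x → y ∈ Q.free → x ∈ Q.free

end Query

/-! ## Relations over a ring and the query result -/

section Data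

variable (Q : Query) {Dom : Fin Q.m → Type u} {D : Type v}

/-- The tuples over the schema `S`. -/
abbrev Tuple (Dom : Fin Q.m → Type u) (S : Finset (Fin Q.m)) : Type u := (x : S) → Dom x

/-- The valuations of all variables of the query. -/
abbrev Valuation (Dom : Fin Q.m → Type u) : Type u := (x : Fin Q.m) → Dom x

/-- The projection of a valuation on the schema `S`. -/
def proj (S : Finset (Fin Q.m)) (s : Valuation Q Dom) : Tuple Q Dom S := fun x => s x

/-- A database: for every relation of the query a map from tuples to payloads in `D`, nonzero on
finitely many tuples. -/
abbrev Database (Dom : Fin Q.m → Type u) (D : Type v) [Zero D] : Type (max u v) :=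
  (i : Fin Q.n) → Tuple Q Dom (Q.sch i) →₀ D

variable [CommRing D]

/-- The size of a database: the number of its keys with nonzero payload. -/
def Database.size {Q : Query} {Dom : Fin Q.m → Type u} (db : Database Q Dom D) : ℕ :=
  ∑ i, (db i).support.card

/-- The single-tuple update `R_i := R_i ⊎ {t ↦ p}`; inserts and deletes are both of this form. -/
def Database.update {Q : Query} {Dom : Fin Q.m → Type u} (db : Database Q Dom D)
    (i : Fin Q.n) (t : Tuple Q Dom (Q.sch i)) (p : D) : Database Q Dom D :=
  Function.update db i (db i + Finsupp.single t p)

/-- The factor with which a value of `x` enters when `x` is marginalized: the lifting function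
for a bound variable, and `1` for a free variable (which the query does not lift). -/
def weight (g : (x : Fin Q.m) → Dom x → D) (x : Fin Q.m) (a : Dom x) : D :=
  if x ∈ Q.free then 1 else g x a

/-- The payload of the tuple `t` over the free variables in the query result: the sum, over all
valuations extending `t`, of the product of the payloads of the joined tuples and of the lifted
values of the bound variables. Only finitely many summands are nonzero. -/
def result (g : (x : Fin Q.m) → Dom x → D) (db : Database Q Dom D) (t : Tuple Q Dom Q.free) : D :=
  ∑ᶠ (s : Valuation Q Dom) (_ : proj Q Q.free s = t),
    (∏ i, db i (proj Q (Q.sch i) s)) * ∏ x ∈ Q.freeᶜ, g x (s x)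

/-- `t` has a derivation: it extends to a valuation all of whose projections are in the
relations. -/
def Derivable (db : Database Q Dom D) (t : Tuple Q Dom Q.free) : Prop :=
  ∃ s : Valuation Q Dom, proj Q Q.free s = t ∧ ∀ i, db i (proj Q (Q.sch i) s) ≠ 0

end Data

/-! ## Variable orders and view trees -/

/-- A variable order: a rooted forest on the variables, given by its parent function, in which the
variables of each relation lie along a root-to-leaf path, i.e. are pairwise comparable. -/
structure VarOrder (Q : Query) where
  parent : Fin Q.m → Option (Fin Q.m)
  wf : WellFounded fun y x => parent y = some x
  path : ∀ i, ∀ x ∈ Q.sch i, ∀ y ∈ Q.sch i,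
    x = y ∨ Relation.TransGen (fun p q => parent q = some p) x y ∨
      Relation.TransGen (fun p q => parent q = some p) y x

namespace VarOrder

variable {Q : Query} (ω : VarOrder Q)

/-- `x` is a proper ancestor of `y`. -/
def Anc (x y : Fin Q.m) : Prop := Relation.TransGen (fun p q => ω.parent q = some p) x y

/-- No bound variable is an ancestor of a free variable. -/
def FreeTop : Prop := ∀ x y, ω.Anc x y → y ∈ Q.free → x ∈ Q.free

/-- The ancestors of `x` on which the variables in the subtree rooted at `x` depend, where two
variables depend on each other if they occur together in the schema of a relation. -/
def dep (x : Fin Q.m) : Finset (Fin Q.m) :=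
  Finset.univ.filter fun y => ω.Anc y x ∧
    ∃ z, (z = x ∨ ω.Anc x z) ∧ ∃ i, y ∈ Q.sch i ∧ z ∈ Q.sch i

/-- The relations that hang under `x`: those whose lowest variable is `x`. -/
def relsAt (x : Fin Q.m) : Finset (Fin Q.n) :=
  Finset.univ.filter fun i => x ∈ Q.sch i ∧ ∀ y ∈ Q.sch i, y = x ∨ ω.Anc y x

variable {Dom : Fin Q.m → Type u} {D : Type v} [CommRing D]
  (g : (x : Fin Q.m) → Dom x → D) (db : Database Q Dom D)

/-- The view `V@x` with schema `dep x`: the view `H@x` (see `viewH`, `viewV_eq`) with `x`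
marginalized. The content of a view is written as a function of valuations of all variables that
only looks at the variables in the schema of the view. -/
def viewV : Fin Q.m → Valuation Q Dom → D :=
  ω.wf.fix fun x V s => ∑ᶠ a : Dom x,
    ((∏ i ∈ ω.relsAt x, db i (proj Q (Q.sch i) (Function.update s x a))) *
      ∏ y : {y // ω.parent y = some x}, V y.1 y.2 (Function.update s x a)) * weight Q g x a

/-- The view `H@x` with schema `{x} ∪ dep x`: the join of the child views of `x`, which are the
relations under `x` and the views `V@y` of the children `y` of `x`. -/
def viewH (x : Fin Q.m) (s : Valuation Q Dom) : D :=
  (∏ i ∈ ω.relsAt x, db i (proj Q (Q.sch i) s)) *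
    ∏ y : {y // ω.parent y = some x}, ω.viewV g db y.1 s

theorem viewV_eq (x : Fin Q.m) (s : Valuation Q Dom) :
    ω.viewV g db x s =
      ∑ᶠ a : Dom x, ω.viewH g db x (Function.update s x a) * weight Q g x a := by
  unfold viewH
  conv_lhs => unfold viewV
  rw [WellFounded.fix_eq]
  rfl

end VarOrder

/-- The views of the view tree over a variable order: the input relations at the leaves, and two
views `H@x` and `V@x` for each variable `x`. -/
inductive View (Q : Query)
  | rel (i : Fin Q.n)
  | H (x : Fin Q.m)
  | V (x : Fin Q.m)

/-! ## The machine

A random access machine with a fixed number of registers and hash maps, addressed by the finite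
program text. There are registers for data words and registers for payloads, hash maps from
tuples of data words to data words, and hash maps from tuples of data words to payloads. Every
instruction takes one step: copying, testing data words for equality, one ring operation, the
test of a payload for zero, one application of a lifting function, one access to a hash map,
reading one record of the input, emitting one record of the output. Data words can only be
copied, compared and hashed, payloads can only be used through the ring operations. -/

/-- A data word: one of the constants `sym k` or a data value. -/
inductive Word (A : Type u)
  | sym (k : ℕ)
  | val (a : A)

/-- An input or output record: some data words and a payload. -/
abbrev Record (A : Type u) (D : Type v) : Type (max u v) := List (Word A) × D

structure State (A : Type u) (D : Type v) where
  reg : ℕ → Word A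
  acc : ℕ → D
  /-- hash maps for data words; absent entries read as `sym 0` -/
  dict : ℕ → List (Word A) → Word A
  /-- hash maps for payloads; absent entries read as `0` -/
  pdict : ℕ → List (Word A) → D
  input : List (Record A D)

/-- The instructions; `V` indexes the available lifting functions. -/
inductive Instr (V : Type)
  | const (r k : ℕ)
  | move (r s : ℕ)
  | pzero (p : ℕ)
  | pone (p : ℕ)
  | padd (p q r : ℕ)
  | pmul (p q r : ℕ)
  | pneg (p q : ℕ)
  | lift (p : ℕ) (x : V) (r : ℕ)
  | load (r d : ℕ) (key : List ℕ)
  | store (d : ℕ) (key : List ℕ) (r : ℕ)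
  | pload (p d : ℕ) (key : List ℕ)
  | pstore (d : ℕ) (key : List ℕ) (p : ℕ)
  | read (rs : List ℕ) (p : ℕ)
  | emit (rs : List ℕ) (p : ℕ)

inductive Cond
  | eq (r s : ℕ)
  | isZero (p : ℕ)

inductive Prog (V : Type)
  | skip
  | instr (o : Instr V)
  | seq (P P' : Prog V)
  | ite (c : Cond) (P P' : Prog V)
  | loop (c : Cond) (P : Prog V)

section Machine

variable {V : Type} {A : Type u} {D : Type v} [CommRing D] (g : V → A → D)

/-- Write the words `ws` into the registers `rs`, padding with `sym 0`. -/
def assign (f : ℕ → Word A) : List ℕ → List (Word A) → ℕ → Word A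
  | [], _ => f
  | r :: rs, ws => assign (Function.update f r (ws.headD (Word.sym 0))) rs ws.tail

/-- The lifting function `x` applied to a word (`0` if the word is not a data value). -/
def liftWord (x : V) : Word A → D
  | Word.sym _ => 0
  | Word.val a => g x a

/-- The effect of one instruction. -/
def Instr.step : Instr V → State A D → State A D
  | const r k, σ => { σ with reg := Function.update σ.reg r (Word.sym k) }
  | move r s, σ => { σ with reg := Function.update σ.reg r (σ.reg s) }
  | pzero p, σ => { σ with acc := Function.update σ.acc p 0 }
  | pone p, σ => { σ with acc := Function.update σ.acc p 1 }
  | padd p q r, σ => { σ with acc := Function.update σ.acc p (σ.acc q + σ.acc r) }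
  | pmul p q r, σ => { σ with acc := Function.update σ.acc p (σ.acc q * σ.acc r) }
  | pneg p q, σ => { σ with acc := Function.update σ.acc p (-σ.acc q) }
  | lift p x r, σ => { σ with acc := Function.update σ.acc p (liftWord g x (σ.reg r)) }
  | load r d key, σ =>
      { σ with reg := Function.update σ.reg r (σ.dict d (key.map σ.reg)) }
  | store d key r, σ =>
      { σ with dict := Function.update σ.dict d
                (Function.update (σ.dict d) (key.map σ.reg) (σ.reg r)) }
  | pload p d key, σ =>
      { σ with acc := Function.update σ.acc p (σ.pdict d (key.map σ.reg)) }
  | pstore d key p, σ =>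
      { σ with pdict := Function.update σ.pdict d
                (Function.update (σ.pdict d) (key.map σ.reg) (σ.acc p)) }
  | read rs p, σ =>
      match σ.input with
      | [] => { σ with reg := assign σ.reg rs [], acc := Function.update σ.acc p 0 }
      | (ws, d) :: rest =>
          { σ with reg := assign σ.reg rs ws, acc := Function.update σ.acc p d, input := rest }
  | emit _ _, σ => σ

/-- The event observed when an instruction is executed: the emitted record, or `none`. -/
def Instr.event : Instr V → State A D → Option (Record A D)
  | emit rs p, σ => some (rs.map σ.reg, σ.acc p)
  | _, _ => none

def Cond.holds : Cond → State A D → Prop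
  | eq r s, σ => σ.reg r = σ.reg s
  | isZero p, σ => σ.acc p = 0

/-- `Exec g P σ tr σ'`: started in state `σ`, the program `P` halts in state `σ'`, and `tr` is the
list of events of its steps, one per instruction or evaluation of a condition. -/
inductive Exec : Prog V → State A D → List (Option (Record A D)) → State A D → Prop
  | skip (σ) : Exec Prog.skip σ [] σ
  | instr (o σ) : Exec (Prog.instr o) σ [o.event σ] (o.step g σ)
  | seq {P P' σ σ' σ'' l l'} : Exec P σ l σ' → Exec P' σ' l' σ'' →
      Exec (Prog.seq P P') σ (l ++ l') σ''
  | ite_true {c P P' σ σ' l} : c.holds σ → Exec P σ l σ' →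
      Exec (Prog.ite c P P') σ (none :: l) σ'
  | ite_false {c P P' σ σ' l} : ¬ c.holds σ → Exec P' σ l σ' →
      Exec (Prog.ite c P P') σ (none :: l) σ'
  | loop_step {c P σ σ' σ'' l l'} : c.holds σ → Exec P σ l σ' →
      Exec (Prog.loop c P) σ' l' σ'' → Exec (Prog.loop c P) σ (none :: (l ++ l')) σ''
  | loop_done {c P σ} : ¬ c.holds σ → Exec (Prog.loop c P) σ [none] σ

/-- The initial state with the given input: all registers and hash maps are empty. -/
def State.start (inp : List (Record A D)) : State A D where
  reg _ := Word.sym 0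
  acc _ := 0
  dict _ _ := Word.sym 0
  pdict _ _ := 0
  input := inp

/-- The time before the first output, between consecutive outputs, and after the last output is at
most `c`: any block of consecutive steps without output has length at most `c`. -/
def DelayAtMost (c : ℕ) (tr : List (Option (Record A D))) : Prop :=
  ∀ l₁ l₂ l₃, tr = l₁ ++ l₂ ++ l₃ → (∀ e ∈ l₂, e = none) → l₂.length ≤ c

end Machine

/-! ## Maintenance -/

section Maintenance

variable (Q : Query) {Dom : Fin Q.m → Type u} {D : Type v}

/-- The data values handled by the machine: values tagged by their variable. -/
abbrev Value (Dom : Fin Q.m → Type u) : Type u := (x : Fin Q.m) × Dom x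

/-- A tuple over `S` as a list of words, one per variable, with `sym 0` at variables not in `S`. -/
def key (S : Finset (Fin Q.m)) (t : Tuple Q Dom S) : List (Word (Value Q Dom)) :=
  List.ofFn fun x : Fin Q.m =>
    if h : x ∈ S then Word.val ⟨x, t ⟨x, h⟩⟩ else Word.sym 0

/-- The lifting functions on tagged values. -/
def liftValue [Zero D] (g : (x : Fin Q.m) → Dom x → D) (x : Fin Q.m) (a : Value Q Dom) : D :=
  if h : a.1 = x then g x (h ▸ a.2) else 0

/-- The input record for the entry `t ↦ p` of the relation `i`. -/
def entry (i : Fin Q.n) (t : Tuple Q Dom (Q.sch i)) (p : D) : Record (Value Q Dom) D :=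
  (Word.sym (i + 1) :: key Q (Q.sch i) t, p)

/-- Programs for the three phases, and the hash map in which each view is materialized. -/
structure Engine (Q : Query) where
  preprocess : Prog (Fin Q.m)
  update : Prog (Fin Q.m)
  enumerate : Prog (Fin Q.m)
  table : View Q → ℕ

variable {Q} [CommRing D]

/-- In state `σ`, every view of the view tree over `ω` is materialized in its hash map. -/
def Materialized (ω : VarOrder Q) (table : View Q → ℕ) (g : (x : Fin Q.m) → Dom x → D)
    (db : Database Q Dom D) (σ : State (Value Q Dom) D) : Prop :=
  (∀ i t, σ.pdict (table (View.rel i)) (key Q (Q.sch i) t) = db i t) ∧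
  (∀ x s, σ.pdict (table (View.H x))
    (key Q (insert x (ω.dep x)) (proj Q (insert x (ω.dep x)) s)) = ω.viewH g db x s) ∧
  (∀ x s, σ.pdict (table (View.V x))
    (key Q (ω.dep x) (proj Q (ω.dep x) s)) = ω.viewV g db x s)

/-- `out` lists the query result: distinct tuples together with their payloads, among them all
tuples of nonzero payload; all listed tuples have a derivation, and if the ring has no zero
divisors, then all listed tuples have nonzero payload. -/
def ListsResult (g : (x : Fin Q.m) → Dom x → D) (db : Database Q Dom D)
    (out : List (Record (Value Q Dom) D)) : Prop :=
  ∃ l : List (Tuple Q Dom Q.free), l.Nodup ∧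
    out = l.map (fun t => (key Q Q.free t, result Q g db t)) ∧
    (∀ t, result Q g db t ≠ 0 → t ∈ l) ∧
    (∀ t ∈ l, Derivable Q db t) ∧
    (NoZeroDivisors D → ∀ t ∈ l, result Q g db t ≠ 0)

/-- `E` maintains the query by the view tree over `ω`, with preprocessing time `c * (N + 1)`,
enumeration delay `c` and time `c * upd N` for a single-tuple update to a database of size `N`.
`Inv db σ` is the invariant that the state `σ` stores the database `db`: it is established by
preprocessing and kept by all updates and enumerations. -/
def Engine.MaintainsOver (E : Engine Q) (ω : VarOrder Q) (c : ℕ) (upd : ℕ → ℕ)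
    (g : (x : Fin Q.m) → Dom x → D) : Prop :=
  ∃ Inv : Database Q Dom D → State (Value Q Dom) D → Prop,
    (∀ (db : Database Q Dom D) (L : List ((i : Fin Q.n) × Tuple Q Dom (Q.sch i))), L.Nodup →
      (∀ e, e ∈ L ↔ db e.1 e.2 ≠ 0) →
      ∃ tr σ, Exec (liftValue Q g) E.preprocess
          (State.start (L.map fun e => entry Q e.1 e.2 (db e.1 e.2))) tr σ ∧
        tr.length ≤ c * (db.size + 1) ∧ Inv db σ) ∧
    (∀ db σ, Inv db σ → Materialized ω E.table g db σ) ∧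
    (∀ db σ, Inv db σ → ∀ (i : Fin Q.n) (t : Tuple Q Dom (Q.sch i)) (p : D),
      ∃ tr σ', Exec (liftValue Q g) E.update { σ with input := [entry Q i t p] } tr σ' ∧
        tr.length ≤ c * upd db.size ∧ Inv (db.update i t p) σ') ∧
    (∀ db σ, Inv db σ →
      ∃ tr σ', Exec (liftValue Q g) E.enumerate { σ with input := [] } tr σ' ∧
        ListsResult g db (tr.filterMap id) ∧ DelayAtMost c tr ∧ Inv db σ')

/-- F-IVM maintains the query with linear preprocessing time, constant enumeration delay and
single-tuple update time `O(upd N)`: this is achieved over some free-top variable order by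
programs and a constant that depend on the query only, for all domains, commutative rings and
lifting functions. -/
def Maintainable (Q : Query) (upd : ℕ → ℕ) : Prop :=
  ∃ (ω : VarOrder Q) (E : Engine Q) (c : ℕ), ω.FreeTop ∧
    ∀ (Dom : Fin Q.m → Type u) (D : Type v) [CommRing D] (g : (x : Fin Q.m) → Dom x → D),
      E.MaintainsOver ω c upd g

end Maintenance

end FIVM

end

/-!
Both parts use the same data structure and the same enumeration; they differ in the variable order
and in how the data structure is repaired after an update.

**Variable orders.** A linear order of the variables in which the earlier variables that co-occur
with `x` all lie, together with `x`, in one schema yields a variable order without fill-in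
(`exists_varOrder_of_elimination`). For a free-connex acyclic query such an order, with the free
variables first, is obtained by comparing heights in two rooted join trees: the one with the
additional relation over the free variables, and, to break ties, the one of the query. Every view
then has a schema that is contained in the schema of a relation (`VarOrder.Anchored`). For a
`q`-hierarchical query one orders the variables by decreasing sets of relations, and every schema
is closed under ancestors (`VarOrder.PathClosed`).

**Data structure.** Besides the payloads of all views, the machine keeps for each variable `x` and
each tuple over `dep x` a doubly linked list, stored in hash maps (`Lst`), of the values of `x` that
extend the tuple to an active one. Over a ring, the payload of a view can vanish by cancellation
although the join below it is nonempty, and enumeration would then miss tuples or run into dead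
ends. So activity (`VarOrder.Active`) asks for nonzero payloads only of the relations and of the
views of bound variables; for free variables it asks for nonempty lists. Below an active node every
child has an active value (`VarOrder.exists_active_child`). Therefore active tuples extend to
derivations, and enumeration never meets an empty list.

**Updates.** Each view and each list satisfies a local equation, `VarOrder.Fresh`, that involves
only the child views. Refreshing one entry (`VarOrder.refresh_spec`) takes constant time,
establishes the equation at this entry, and can violate it only at the parent. If schemas are closed
under ancestors, then a single-tuple update affects one entry for each variable of the relation, and
refreshing these bottom-up repairs everything in constant time (`VarOrder.refresh_chain`). In the
free-connex case, the keys of all relations are kept in one more linked list, the log. An update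
refreshes, for one variable after the other, the entries at all logged keys, which takes linear time.
This suffices (`VarOrder.pass_exec`): a nonzero or active entry of a view is the projection of a key
of the relation that covers the view, so away from the log both sides of the local equations vanish.

**Enumeration.** Nested traversals of the lists of the free variables, ancestors first, have constant
delay, because no list met on the way is empty (`VarOrder.nest_exec`, `Seg.paced`). Eliminating the
bound variables from the bottom up shows that the payload of an output tuple is the product of
constantly many stored entries (`VarOrder.result_eq_partialProd`). These are exactly the entries that
are tested for activity. So tuples of nonzero payload are listed, and without zero divisors no
others.
-/

noncomputable section

namespace FIVM

/-! ### Variable orders from elimination orders -/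

/-- Root a join tree at `r` and send every variable to its highest relation `top x`, at height
`h x`. If two variables share a relation, then the one with the higher top relation also occurs in
the top relation of the other one: both top relations lie on the path from `r` to the shared
relation. -/
theorem IsJoinTree.exists_height {ι V : Type} [DecidableEq V] {sch : ι → Finset V}
    {T : SimpleGraph ι} (hT : IsJoinTree sch T) (r : ι) (cov : ∀ x, ∃ i, x ∈ sch i) :
    ∃ (h : V → ℕ) (top : V → ι), (∀ x, x ∈ sch (top x)) ∧ (∀ x, h x = 0 ↔ x ∈ sch r) ∧
      (∀ x, x ∉ sch r → top x ≠ r) ∧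
      ∀ x y k, x ∈ sch k → y ∈ sch k → h y ≤ h x → y ∈ sch (top x) := by
  have hmin : ∀ x, ∃ i, x ∈ sch i ∧ ∀ j, x ∈ sch j → T.dist r i ≤ T.dist r j := by
    intro x
    obtain ⟨i, hi, hi'⟩ := (measure (T.dist r)).wf.has_min {i | x ∈ sch i} (cov x)
    exact ⟨i, hi, fun j hj => not_lt.1 (hi' j hj)⟩
  choose top htop hle using hmin
  obtain ⟨hpre, hac, hjoin⟩ := hT
  have key : ∀ x k, x ∈ sch k → ∃ (q : T.Walk r (top x)) (w : T.Walk (top x) k),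
      (q.append w).IsPath ∧ q.length = T.dist r (top x) := by
    intro x k hk
    obtain ⟨q, hq, hql⟩ := (hpre r (top x)).exists_path_of_dist
    obtain ⟨w, hw, -⟩ := (hpre (top x) k).exists_path_of_dist
    refine ⟨q, w, ?_, hql⟩
    rw [SimpleGraph.Walk.isPath_def, SimpleGraph.Walk.support_append, List.nodup_append]
    have hwn := hw.support_nodup
    refine ⟨hq.support_nodup, hwn.tail, ?_⟩
    rintro a ha b hb rfl
    have hxa : x ∈ sch a :=
      hjoin _ _ w hw a (List.mem_of_mem_tail hb) (Finset.mem_inter.2 ⟨htop x, hk⟩)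
    have hd := hle x a hxa
    have hne : a ≠ top x := by
      rintro rfl
      rw [← SimpleGraph.Walk.cons_tail_support, List.nodup_cons] at hwn
      exact hwn.1 hb
    have h1 := q.length_takeUntil_lt_length ha hne
    have h2 := SimpleGraph.dist_le (q.takeUntil a ha)
    omega
  refine ⟨fun x => T.dist r (top x), top, htop, fun x => ⟨fun h => ?_, fun h => ?_⟩,
    fun x hx h => hx (h ▸ htop x), ?_⟩
  · have := (hpre r (top x)).dist_eq_zero_iff.1 h
    rw [this]; exact htop x
  · have := hle x r h
    simpa using this
  · intro x y k hx hy hyx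
    obtain ⟨q, w, hp, hq⟩ := key x k hx
    obtain ⟨q', w', hp', hq'⟩ := key y k hy
    have heq : q'.append w' = q.append w :=
      congrArg Subtype.val ((hac.subsingleton_path _ _).elim ⟨_, hp'⟩ ⟨_, hp⟩)
    have hmem : top x ∈ (q'.append w').support := by
      rw [heq, SimpleGraph.Walk.mem_support_append_iff]
      exact Or.inl q.end_mem_support
    have hw' : w'.IsPath := hp'.of_append_right
    have hin : top x ∈ w'.support := by
      rw [SimpleGraph.Walk.mem_support_append_iff] at hmem
      rcases hmem with hm | hm
      · by_cases he : top x = top y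
        · rw [he]; exact w'.start_mem_support
        · have h1 := q'.length_takeUntil_lt_length hm he
          have h2 := SimpleGraph.dist_le (q'.takeUntil _ hm)
          simp only at hyx
          omega
      · exact hm
    exact hjoin _ _ w' hw' _ hin (Finset.mem_inter.2 ⟨htop y, hy⟩)

namespace VarOrder

variable {Q : Query} (ω : VarOrder Q)

theorem Anc.trans {x y z : Fin Q.m} (h : ω.Anc x y) (h' : ω.Anc y z) : ω.Anc x z :=
  Relation.TransGen.trans h h'

theorem anc_irrefl (x : Fin Q.m) : ¬ ω.Anc x x := fun h => by
  have h' : Relation.TransGen (fun y x => ω.parent y = some x) x x :=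
    Relation.transGen_swap.1 h
  exact ω.wf.transGen.irrefl.irrefl x h'

theorem anc_of_parent {x p : Fin Q.m} (h : ω.parent x = some p) : ω.Anc p x :=
  Relation.TransGen.single h

theorem anc_iff {x p : Fin Q.m} (h : ω.parent x = some p) (y : Fin Q.m) :
    ω.Anc y x ↔ y = p ∨ ω.Anc y p := by
  constructor
  · intro hy
    rcases (Relation.TransGen.tail'_iff.1 hy) with ⟨b, hb, hbx⟩
    have : b = p := by simpa [h] using hbx.symm
    subst this
    rcases Relation.reflTransGen_iff_eq_or_transGen.1 hb with e | e
    · exact Or.inl e.symm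
    · exact Or.inr e
  · rintro (rfl | hy)
    · exact ω.anc_of_parent h
    · exact hy.tail h

theorem not_anc_of_root {x : Fin Q.m} (h : ω.parent x = none) (y : Fin Q.m) : ¬ ω.Anc y x := by
  intro hy
  rcases (Relation.TransGen.tail'_iff.1 hy) with ⟨b, -, hbx⟩
  simp [h] at hbx

end VarOrder

variable {Q : Query}

/-- Let the variables be linearly ordered by `f` so that the earlier variables co-occurring with
`x` all lie, together with `x`, in one schema (a perfect elimination order all of whose cliques are
covered by relations). Making the last of these the parent of `x` defines a variable order without
fill-in: the views over `x` depend only on earlier variables co-occurring with `x`. -/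
theorem exists_varOrder_of_elimination {β : Type} [LinearOrder β] (f : Fin Q.m → β)
    (hf : Function.Injective f)
    (hC : ∀ x, ∃ i, x ∈ Q.sch i ∧ ∀ y k, f y < f x → x ∈ Q.sch k → y ∈ Q.sch k → y ∈ Q.sch i)
    (hfree : ∀ x y k, f y < f x → x ∈ Q.sch k → y ∈ Q.sch k → x ∈ Q.free → y ∈ Q.free) :
    ∃ ω : VarOrder Q, ω.FreeTop ∧ (∀ x, ∃ i, insert x (ω.dep x) ⊆ Q.sch i) ∧
      ∀ x p, ω.parent x = some p → f p < f x ∧ ∃ i, x ∈ Q.sch i ∧ p ∈ Q.sch i := by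
  let N : Fin Q.m → Finset (Fin Q.m) := fun x =>
    Finset.univ.filter fun y => f y < f x ∧ ∃ k, x ∈ Q.sch k ∧ y ∈ Q.sch k
  have hN : ∀ x y, y ∈ N x ↔ f y < f x ∧ ∃ k, x ∈ Q.sch k ∧ y ∈ Q.sch k := by
    intro x y; simp [N]
  have hclique : ∀ x y z, y ∈ N x → z ∈ N x → f y < f z → y ∈ N z := by
    intro x y z hy hz hyz
    obtain ⟨i, -, hi⟩ := hC x
    obtain ⟨hy1, k, hk1, hk2⟩ := (hN x y).1 hy
    obtain ⟨hz1, l, hl1, hl2⟩ := (hN x z).1 hz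
    exact (hN z y).2 ⟨hyz, i, hi z l hz1 hl1 hl2, hi y k hy1 hk1 hk2⟩
  have hpar : ∀ x, ∃ p : Option (Fin Q.m), (p = none → N x = ∅) ∧
      ∀ q, p = some q → q ∈ N x ∧ ∀ y ∈ N x, y = q ∨ f y < f q := by
    intro x
    rcases (N x).eq_empty_or_nonempty with h | h
    · exact ⟨none, fun _ => h, by simp⟩
    · obtain ⟨q, hq, hmax⟩ := Finset.exists_max_image (N x) f h
      refine ⟨some q, by simp, ?_⟩
      rintro _ ⟨⟩
      exact ⟨hq, fun y hy => (hmax y hy).eq_or_lt.imp (fun h => hf h) id⟩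
  choose par hpn hps using hpar
  have hlt : ∀ x p, par x = some p → f p < f x := fun x p h => ((hN x p).1 (hps x p h).1).1
  have hanc_lt : ∀ x y, Relation.TransGen (fun p q => par q = some p) x y → f x < f y := by
    intro x y h
    induction h with
    | single h => exact hlt _ _ h
    | tail _ h ih => exact ih.trans (hlt _ _ h)
  have hNanc : ∀ x, ∀ y ∈ N x,
      Relation.TransGen (fun p q => par q = some p) y x := by
    have hwf : WellFounded fun x y : Fin Q.m => f x < f y := by
      have : IsTrans (Fin Q.m) (fun x y : Fin Q.m => f x < f y) :=
        ⟨fun _ _ _ h h' => lt_trans h h'⟩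
      have : Std.Irrefl (fun x y : Fin Q.m => f x < f y) := ⟨fun _ => lt_irrefl _⟩
      exact Finite.wellFounded_of_trans_of_irrefl _
    intro x
    induction x using hwf.induction with
    | _ x ih =>
      intro y hy
      rcases hp : par x with _ | p
      · simp [hpn x hp] at hy
      · obtain ⟨hpN, hmax⟩ := hps x p hp
        rcases hmax y hy with rfl | hyp
        · exact Relation.TransGen.single hp
        · exact (ih p (hlt x p hp) y (hclique x y p hy hpN hyp)).tail hp
  let ω : VarOrder Q :=
    { parent := par
      wf := by
        have : IsTrans (Fin Q.m) (fun x y : Fin Q.m => f y < f x) :=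
          ⟨fun _ _ _ h h' => lt_trans h' h⟩
        have : Std.Irrefl (fun x y : Fin Q.m => f y < f x) := ⟨fun _ => lt_irrefl _⟩
        have : WellFounded (fun x y : Fin Q.m => f y < f x) :=
          Finite.wellFounded_of_trans_of_irrefl _
        exact Subrelation.wf (fun {y x} h => hlt y x h) this
      path := by
        intro i x hx y hy
        rcases lt_trichotomy (f x) (f y) with h | h | h
        · exact Or.inr (Or.inl (hNanc y x ((hN y x).2 ⟨h, i, hy, hx⟩)))
        · exact Or.inl (hf h)
        · exact Or.inr (Or.inr (hNanc x y ((hN x y).2 ⟨h, i, hx, hy⟩))) }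
  have hdep : ∀ x, ω.dep x ⊆ N x := by
    intro x y hy
    simp only [VarOrder.dep, Finset.mem_filter, Finset.mem_univ, true_and] at hy
    obtain ⟨hyx, z, hz, i, hyi, hzi⟩ := hy
    have hyxlt : f y < f x := hanc_lt _ _ hyx
    -- co-occurrence with a variable of the subtree of `x` is inherited along parents up to `x`
    have up : ∀ z, ω.Anc x z → y ∈ N z → y ∈ N x := by
      intro z hz
      induction hz with
      | single h =>
        intro hyz
        exact hclique _ _ _ hyz (hps _ _ h).1 hyxlt
      | tail hxb h ih =>
        intro hyz
        exact ih (hclique _ _ _ hyz (hps _ _ h).1 (hyxlt.trans (hanc_lt _ _ hxb)))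
    rcases hz with rfl | hz
    · exact (hN _ _).2 ⟨hyxlt, i, hzi, hyi⟩
    · exact up z hz ((hN _ _).2 ⟨hyxlt.trans (hanc_lt _ _ hz), i, hzi, hyi⟩)
  refine ⟨ω, ?_, ?_, ?_⟩
  · intro x y hxy hy
    induction hxy with
    | single h =>
      obtain ⟨h1, k, hk, hk'⟩ := (hN _ _).1 (hps _ _ h).1
      exact hfree _ _ k h1 hk hk' hy
    | tail _ h ih =>
      obtain ⟨h1, k, hk, hk'⟩ := (hN _ _).1 (hps _ _ h).1
      exact ih (hfree _ _ k h1 hk hk' hy)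
  · intro x
    obtain ⟨i, hxi, hi⟩ := hC x
    refine ⟨i, Finset.insert_subset hxi fun y hy => ?_⟩
    obtain ⟨h1, k, hk, hk'⟩ := (hN _ _).1 (hdep x hy)
    exact hi y k h1 hk hk'
  · intro x p hp
    obtain ⟨h1, k, hk, hk'⟩ := (hN _ _).1 (hps x p hp).1
    exact ⟨h1, k, hk, hk'⟩

/-- A free-connex acyclic query has a free-top variable order in which the schema of every view is
covered by a relation. Eliminate the bound variables by decreasing height in a join tree rooted at
the relation over the free variables, and then the free variables by decreasing height in a join
tree of the query. -/
theorem Query.FreeConnexAcyclic.exists_varOrder (h : Q.FreeConnexAcyclic) :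
    ∃ ω : VarOrder Q, ω.FreeTop ∧ ∀ x, ∃ i, insert x (ω.dep x) ⊆ Q.sch i := by
  obtain ⟨⟨T, hT⟩, T', hT'⟩ := h
  obtain ⟨h', top', hmem', hzero', hne', hprop'⟩ :=
    hT'.exists_height none (fun x => by obtain ⟨i, hi⟩ := Q.covered x; exact ⟨some i, hi⟩)
  have h2 : ∃ (h : Fin Q.m → ℕ) (top : Fin Q.m → Fin Q.n), (∀ x, x ∈ Q.sch (top x)) ∧
      ∀ x y k, x ∈ Q.sch k → y ∈ Q.sch k → h y ≤ h x → y ∈ Q.sch (top x) := by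
    rcases isEmpty_or_nonempty (Fin Q.n) with he | ⟨⟨r⟩⟩
    · have hm : IsEmpty (Fin Q.m) := ⟨fun x => he.elim (Q.covered x).choose⟩
      exact ⟨fun _ => 0, fun x => hm.elim x, fun x => hm.elim x, fun x => hm.elim x⟩
    · obtain ⟨h, top, h1, -, -, h4⟩ := hT.exists_height r Q.covered
      exact ⟨h, top, h1, h4⟩
  obtain ⟨h, top, hmem, hprop⟩ := h2
  let f : Fin Q.m → ℕ ×ₗ (ℕ ×ₗ Fin Q.m) := fun x => toLex (h' x, toLex (h x, x))
  have hf : Function.Injective f := by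
    intro x y hxy
    simp [f] at hxy
    exact hxy.2.2
  have hlt : ∀ x y, f y < f x → h' y < h' x ∨ (h' y = h' x ∧ h y ≤ h x) := by
    intro x y hxy
    simp only [f, Prod.Lex.toLex_lt_toLex] at hxy
    rcases hxy with h1 | ⟨h1, h2 | ⟨h2, -⟩⟩
    · exact Or.inl h1
    · exact Or.inr ⟨h1, h2.le⟩
    · exact Or.inr ⟨h1, h2.le⟩
  have hfree : ∀ x, x ∈ Q.free ↔ h' x = 0 := fun x => by rw [hzero']; rfl
  have hC : ∀ x, ∃ i, x ∈ Q.sch i ∧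
      ∀ y k, f y < f x → x ∈ Q.sch k → y ∈ Q.sch k → y ∈ Q.sch i := by
    intro x
    by_cases hx : x ∈ Q.free
    · refine ⟨top x, hmem x, fun y k hyx hxk hyk => hprop x y k hxk hyk ?_⟩
      have := (hfree x).1 hx
      rcases hlt _ _ hyx with h | h
      · omega
      · exact h.2
    · rcases hti : top' x with _ | i
      · exact absurd hti (hne' x hx)
      · refine ⟨i, by simpa [hti] using hmem' x, fun y k hyx hxk hyk => ?_⟩
        have := hprop' x y (some k) hxk hyk (by rcases hlt _ _ hyx with h | h <;> omega)
        simpa [hti] using this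
  obtain ⟨ω, h1, h2, -⟩ := exists_varOrder_of_elimination f hf hC fun x y k hyx _ _ hx => by
    rw [hfree] at hx ⊢
    rcases hlt _ _ hyx with h | h <;> omega
  exact ⟨ω, h1, h2⟩

/-- A `q`-hierarchical query has a free-top variable order in which every schema contains, with a
variable, its parent. -/
theorem Query.QHierarchical.exists_varOrder (h : Q.QHierarchical) :
    ∃ ω : VarOrder Q, ω.FreeTop ∧ ∀ i, ∀ x ∈ Q.sch i, ∀ p, ω.parent x = some p → p ∈ Q.sch i := by
  obtain ⟨hh, hq⟩ := h
  let f : Fin Q.m → ℕ ×ₗ (ℕ ×ₗ Fin Q.m) := fun x =>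
    toLex (Q.n - (Q.rels x).card, toLex (if x ∈ Q.free then 0 else 1, x))
  have hf : Function.Injective f := by
    intro x y hxy
    simp [f] at hxy
    exact hxy.2.2
  have hr : ∀ x i, i ∈ Q.rels x ↔ x ∈ Q.sch i := fun x i => by simp [Query.rels]
  have hcard : ∀ x, (Q.rels x).card ≤ Q.n := fun x => by
    simpa using Finset.card_le_univ (Q.rels x)
  have hlt : ∀ x y k, f y < f x → x ∈ Q.sch k → y ∈ Q.sch k →
      Q.rels x ⊆ Q.rels y ∧ (x ∈ Q.free → y ∈ Q.free) := by
    intro x y k hyx hx hy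
    have hx' := hcard x
    have hy' := hcard y
    have hc : (Q.rels x).card ≤ (Q.rels y).card ∧
        ((Q.rels x).card = (Q.rels y).card → x ∈ Q.free → y ∈ Q.free) := by
      simp only [f, Prod.Lex.toLex_lt_toLex] at hyx
      rcases hyx with h | ⟨h, h⟩
      · exact ⟨by omega, fun _ => by omega⟩
      · refine ⟨by omega, fun _ hxf => ?_⟩
        by_contra hyf
        simp [hxf, hyf] at h
    have hsub : Q.rels x ⊆ Q.rels y := by
      rcases hh x y with h | h | h
      · exact h
      · exact (Finset.eq_of_subset_of_card_le h hc.1).ge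
      · exact absurd ((hr y k).2 hy) (Finset.disjoint_left.1 h ((hr x k).2 hx))
    refine ⟨hsub, fun hxf => ?_⟩
    by_cases he : (Q.rels x).card = (Q.rels y).card
    · exact hc.2 he hxf
    · refine hq y x (hsub.ssubset_of_ne fun e => he (by rw [e])) hxf
  obtain ⟨ω, h1, -, h3⟩ := exists_varOrder_of_elimination f hf
    (fun x => by
      obtain ⟨i, hi⟩ := Q.covered x
      exact ⟨i, hi, fun y k hyx hxk hyk => (hr y i).1 ((hlt x y k hyx hxk hyk).1 ((hr x i).2 hi))⟩)
    (fun x y k hyx hxk hyk => (hlt x y k hyx hxk hyk).2)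
  refine ⟨ω, h1, fun i x hx p hp => ?_⟩
  obtain ⟨hpx, k, hk, hk'⟩ := h3 x p hp
  exact (hr p i).1 ((hlt x p k hpx hk hk').1 ((hr x i).2 hx))

/-! ### Straight-line programs -/

/-- A trace without output. -/
def Quiet {A : Type u} {D : Type v} (tr : List (Option (Record A D))) : Prop :=
  ∀ e ∈ tr, e = none

theorem Quiet.append {A : Type u} {D : Type v} {tr tr' : List (Option (Record A D))}
    (h : Quiet tr) (h' : Quiet tr') : Quiet (tr ++ tr') :=
  fun e he => (List.mem_append.1 he).elim (h e) (h' e)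

theorem Quiet.cons {A : Type u} {D : Type v} {tr : List (Option (Record A D))} (h : Quiet tr) :
    Quiet (none :: tr) :=
  fun e he => (List.mem_cons.1 he).elim id (h e)

section Straight

variable {V : Type} {A : Type u} {D : Type v} [CommRing D] (g : V → A → D)

/-- A program without loops and without output. -/
def Prog.Straight : Prog V → Prop
  | .skip => True
  | .instr (.emit _ _) => False
  | .instr _ => True
  | .seq P P' => P.Straight ∧ P'.Straight
  | .ite _ P P' => P.Straight ∧ P'.Straight
  | .loop _ _ => False

/-- The final state of a straight-line program (loops are ignored). -/
def Prog.eval : Prog V → State A D → State A D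
  | .skip, σ => σ
  | .instr o, σ => o.step g σ
  | .seq P P', σ => P'.eval (P.eval σ)
  | .ite c P P', σ => if c.holds σ then P.eval σ else P'.eval σ
  | .loop _ _, σ => σ

/-- A bound on the running time of a straight-line program. -/
def Prog.cost : Prog V → ℕ
  | .skip => 0
  | .instr _ => 1
  | .seq P P' => P.cost + P'.cost
  | .ite _ P P' => P.cost + P'.cost + 1
  | .loop _ _ => 0

theorem Prog.Straight.exec {P : Prog V} (h : P.Straight) (σ : State A D) :
    ∃ tr, Exec g P σ tr (P.eval g σ) ∧ tr.length ≤ P.cost ∧ Quiet tr := by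
  induction P generalizing σ with
  | skip => exact ⟨[], Exec.skip σ, le_rfl, by simp [Quiet]⟩
  | instr o =>
    refine ⟨_, Exec.instr o σ, by simp [Prog.cost], ?_⟩
    cases o <;> simp_all [Prog.Straight, Quiet, Instr.event]
  | seq P P' ih ih' =>
    obtain ⟨tr, h1, h2, h3⟩ := ih h.1 σ
    obtain ⟨tr', h1', h2', h3'⟩ := ih' h.2 (P.eval g σ)
    exact ⟨_, Exec.seq h1 h1', by simp [Prog.cost]; omega, h3.append h3'⟩
  | ite c P P' ih ih' =>
    by_cases hc : c.holds σ
    · obtain ⟨tr, h1, h2, h3⟩ := ih h.1 σ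
      refine ⟨none :: tr, ?_, by simp [Prog.cost]; omega, h3.cons⟩
      simpa [Prog.eval, hc] using Exec.ite_true (P' := P') hc h1
    · obtain ⟨tr, h1, h2, h3⟩ := ih' h.2 σ
      refine ⟨none :: tr, ?_, by simp [Prog.cost]; omega, h3.cons⟩
      simpa [Prog.eval, hc] using Exec.ite_false (P := P) hc h1
  | loop c P => exact h.elim

/-- Sequential composition of a list of programs. -/
def seqs : List (Prog V) → Prog V
  | [] => .skip
  | P :: l => .seq P (seqs l)

theorem straight_seqs {l : List (Prog V)} : (seqs l).Straight ↔ ∀ P ∈ l, P.Straight := by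
  induction l with
  | nil => simp [seqs, Prog.Straight]
  | cons P l ih => simp [seqs, Prog.Straight, ih]

/-- Load the words at `key` in the hash maps `ds` into the registers `ts`. -/
def loadVec (ts ds key : List ℕ) : Prog V :=
  seqs (List.zipWith (fun t d => .instr (.load t d key)) ts ds)

/-- Store the registers `rs` at `key` in the hash maps `ds`. -/
def storeVec (ds key rs : List ℕ) : Prog V :=
  seqs (List.zipWith (fun d r => .instr (.store d key r)) ds rs)

/-- Copy the registers `rs` into the registers `ts`. -/
def moveVec (ts rs : List ℕ) : Prog V :=
  seqs (List.zipWith (fun t r => .instr (.move t r)) ts rs)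

theorem straight_loadVec (ts ds key : List ℕ) : (loadVec ts ds key : Prog V).Straight := by
  rw [loadVec, straight_seqs]
  intro P hP
  rw [← List.map_uncurry_zip_eq_zipWith] at hP
  obtain ⟨a, -, rfl⟩ := List.mem_map.1 hP
  trivial

theorem straight_storeVec (ds key rs : List ℕ) : (storeVec ds key rs : Prog V).Straight := by
  rw [storeVec, straight_seqs]
  intro P hP
  rw [← List.map_uncurry_zip_eq_zipWith] at hP
  obtain ⟨a, -, rfl⟩ := List.mem_map.1 hP
  trivial

theorem straight_moveVec (ts rs : List ℕ) : (moveVec ts rs : Prog V).Straight := by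
  rw [moveVec, straight_seqs]
  intro P hP
  rw [← List.map_uncurry_zip_eq_zipWith] at hP
  obtain ⟨a, -, rfl⟩ := List.mem_map.1 hP
  trivial

theorem eval_loadVec (ts ds key : List ℕ) (hl : ts.length = ds.length) (hn : ts.Nodup)
    (hk : ∀ r ∈ key, r ∉ ts) (σ : State A D) :
    ∃ f, (loadVec ts ds key : Prog V).eval g σ = { σ with reg := f } ∧
      ts.map f = ds.map (fun d => σ.dict d (key.map σ.reg)) ∧ ∀ r, r ∉ ts → f r = σ.reg r := by
  induction ts generalizing ds σ with
  | nil => exact ⟨σ.reg, rfl, by cases ds <;> simp_all, fun _ _ => rfl⟩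
  | cons t ts ih =>
    rcases ds with _ | ⟨d, ds⟩
    · simp at hl
    · obtain ⟨f, h1, h2, h3⟩ := ih ds (by simpa using hl) (List.nodup_cons.1 hn).2
        (fun r hr h => hk r hr (List.mem_cons_of_mem _ h))
        ((Instr.load t d key).step g σ)
      have hkey : key.map (Function.update σ.reg t (σ.dict d (key.map σ.reg))) =
          key.map σ.reg := List.map_congr_left fun r hr =>
        Function.update_of_ne (fun e => hk r hr (by simp [e])) _ _
      refine ⟨f, h1, ?_, fun r hr => ?_⟩
      · simp only [List.map_cons, h2, Instr.step, hkey]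
        congr 1
        rw [h3 t (List.nodup_cons.1 hn).1]
        simp [Instr.step]
      · rw [List.mem_cons, not_or] at hr
        rw [h3 r hr.2]
        simp [Instr.step, hr.1]

theorem eval_moveVec (ts rs : List ℕ) (hl : ts.length = rs.length) (hn : ts.Nodup)
    (hk : ∀ r ∈ rs, r ∉ ts) (σ : State A D) :
    ∃ f, (moveVec ts rs : Prog V).eval g σ = { σ with reg := f } ∧
      ts.map f = rs.map σ.reg ∧ ∀ r, r ∉ ts → f r = σ.reg r := by
  induction ts generalizing rs σ with
  | nil => exact ⟨σ.reg, rfl, by cases rs <;> simp_all, fun _ _ => rfl⟩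
  | cons t ts ih =>
    rcases rs with _ | ⟨s, rs⟩
    · simp at hl
    · obtain ⟨f, h1, h2, h3⟩ := ih rs (by simpa using hl) (List.nodup_cons.1 hn).2
        (fun r hr h => hk r (List.mem_cons_of_mem _ hr) (List.mem_cons_of_mem _ h))
        ((Instr.move t s).step g σ)
      have hkey : rs.map (Function.update σ.reg t (σ.reg s)) =
          rs.map σ.reg := List.map_congr_left fun r hr =>
        Function.update_of_ne
          (fun e => hk r (List.mem_cons_of_mem _ hr) (by simp [e])) _ _
      refine ⟨f, h1, ?_, fun r hr => ?_⟩
      · simp only [List.map_cons, h2, Instr.step, hkey]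
        congr 1
        rw [h3 t (List.nodup_cons.1 hn).1]
        simp [Instr.step]
      · rw [List.mem_cons, not_or] at hr
        rw [h3 r hr.2]
        simp [Instr.step, hr.1]

theorem eval_storeVec (ds key rs : List ℕ) (hl : ds.length = rs.length) (hn : ds.Nodup)
    (σ : State A D) :
    ∃ F, (storeVec ds key rs : Prog V).eval g σ = { σ with dict := F } ∧
      (∀ d, d ∉ ds → F d = σ.dict d) ∧ (∀ d K, K ≠ key.map σ.reg → F d K = σ.dict d K) ∧
      ds.map (fun d => F d (key.map σ.reg)) = rs.map σ.reg := by
  induction ds generalizing rs σ with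
  | nil => exact ⟨σ.dict, rfl, fun _ _ => rfl, fun _ _ _ => rfl, by cases rs <;> simp_all⟩
  | cons d ds ih =>
    rcases rs with _ | ⟨s, rs⟩
    · simp at hl
    · obtain ⟨F, h1, h2, h3, h4⟩ := ih rs (by simpa using hl) (List.nodup_cons.1 hn).2
        ((Instr.store d key s).step g σ)
      refine ⟨F, h1, fun d' hd' => ?_, fun d' K hK => ?_, ?_⟩
      · rw [List.mem_cons, not_or] at hd'
        rw [h2 d' hd'.2]
        simp [Instr.step, hd'.1]
      · rw [h3 d' K hK]
        by_cases hd' : d' = d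
        · subst hd'; simp [Instr.step, hK]
        · simp [Instr.step, hd']
      · simp only [List.map_cons]
        congr 1
        rw [h2 d (List.nodup_cons.1 hn).1]
        simp [Instr.step]

end Straight

/-! ### Doubly linked lists in hash maps -/

section Trail

variable {α : Type*}

/-- Following the pointers `f` from `a` one visits the elements of `l` and arrives at `b`. -/
def Trail (f : α → α) (a : α) : List α → α → Prop
  | [], b => f a = b
  | x :: l, b => f a = x ∧ Trail f x l b

theorem Trail.congr {f f' : α → α} {a b : α} {l : List α} (h : Trail f a l b)
    (he : ∀ x ∈ a :: l, f' x = f x) : Trail f' a l b := by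
  induction l generalizing a with
  | nil => exact (he a (by simp)).trans h
  | cons x l ih =>
    exact ⟨(he a (by simp)).trans h.1, ih h.2 fun y hy => he y (List.mem_cons_of_mem _ hy)⟩

theorem Trail.succ {f : α → α} {a b e : α} {l₁ l₂ : List α} (h : Trail f a (l₁ ++ e :: l₂) b) :
    f e = l₂.headD b := by
  induction l₁ generalizing a with
  | nil =>
    cases l₂ with
    | nil => exact h.2
    | cons y l₂ => exact h.2.1
  | cons x l₁ ih => exact ih h.2

theorem Trail.first {f : α → α} {a b : α} {l : List α} (h : Trail f a l b) : f a = l.headD b := by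
  cases l with
  | nil => exact h
  | cons x l => exact h.1

theorem Trail.last {f : α → α} {a b : α} {l : List α} (h : Trail f a l b) :
    f ((a :: l).getLast (by simp)) = b := by
  induction l generalizing a with
  | nil => exact h
  | cons x l ih => simpa using ih h.2

/-- Redirecting `p` to `e` and `e` to the old successor of `p` inserts `e` after `p`. -/
theorem Trail.insert [DecidableEq α] {f : α → α} {a b e : α} {l₁ l₂ : List α}
    (h : Trail f a (l₁ ++ l₂) b)
    (hn : (a :: (l₁ ++ l₂)).Nodup) (he : e ∉ a :: (l₁ ++ l₂)) {p : α}
    (hp : p = (a :: l₁).getLast (by simp)) :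
    Trail (Function.update (Function.update f e (f p)) p e) a (l₁ ++ e :: l₂) b := by
  induction l₁ generalizing a with
  | nil =>
    simp only [List.getLast_singleton] at hp
    subst hp
    simp only [List.nil_append, List.mem_cons, not_or] at he hn h ⊢
    refine ⟨by simp, ?_⟩
    have hc : ∀ x ∈ l₂, Function.update (Function.update f e (f p)) p e x = f x := by
      intro x hx
      have h1 : x ≠ p := by rintro rfl; exact (List.nodup_cons.1 hn).1 hx
      have h2 : x ≠ e := by rintro rfl; exact he.2 hx
      simp [h1, h2]
    cases l₂ with
    | nil => simpa [Trail, he.1] using h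
    | cons y l₂ => exact ⟨by simpa [he.1] using h.1, h.2.congr hc⟩
  | cons x l₁ ih =>
    have hp' : p = (x :: l₁).getLast (by simp) := by simpa using hp
    have hpm : p ∈ x :: l₁ := hp' ▸ List.getLast_mem _
    have hn' := List.nodup_cons.1 hn
    have hap : a ≠ p := by
      rintro rfl
      exact hn'.1 (List.mem_append_left l₂ hpm)
    have hae : a ≠ e := by rintro rfl; simp at he
    exact ⟨by simpa [hap, hae] using h.1,
      ih h.2 hn'.2 (fun h' => he (List.mem_cons_of_mem _ h')) hp'⟩

/-- Redirecting the predecessor `p` of `e` to the successor of `e` removes `e`. -/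
theorem Trail.remove [DecidableEq α] {f : α → α} {a b e : α} {l₁ l₂ : List α}
    (h : Trail f a (l₁ ++ e :: l₂) b)
    (hn : (a :: (l₁ ++ e :: l₂)).Nodup) {p : α} (hp : p = (a :: l₁).getLast (by simp)) :
    Trail (Function.update f p (f e)) a (l₁ ++ l₂) b := by
  induction l₁ generalizing a with
  | nil =>
    simp only [List.getLast_singleton] at hp
    subst hp
    have hc : ∀ x ∈ l₂, Function.update f p (f e) x = f x := by
      intro x hx
      have h1 : x ≠ p := by
        rintro rfl
        exact (List.nodup_cons.1 hn).1 (by simp [hx])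
      simp [h1]
    cases l₂ with
    | nil => simpa [Trail] using h.2
    | cons y l₂ => exact ⟨by simpa using h.2.1, h.2.2.congr hc⟩
  | cons x l₁ ih =>
    have hp' : p = (x :: l₁).getLast (by simp) := by simpa using hp
    have hpm : p ∈ x :: l₁ := hp' ▸ List.getLast_mem _
    have hn' := List.nodup_cons.1 hn
    have hap : a ≠ p := by
      rintro rfl
      exact hn'.1 (List.mem_append_left (e :: l₂) hpm)
    exact ⟨by simpa [hap] using h.1, ih h.2 hn'.2 hp'⟩

end Trail

/-- A family of circular doubly linked lists in hash maps. There is one list for every content of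
the registers `kc`, its elements are vectors of words held in the registers `es`, and the all-blank
vector is the sentinel; so empty hash maps store empty lists. The hash maps are numbered by pairs
whose first component is `id`.

For a query with `m` variables, the registers below `m` hold a valuation, `m` holds `sym 0`, `m + 1`
holds `sym 1`, `m + 2` the tag of an input record, `m + 3, …, 2 * m + 3` a copy of a record, and the
registers from `2 * m + 4` on are temporary. -/
structure Lst where
  m : ℕ
  id : ℕ
  kc : List ℕ
  es : List ℕ

namespace Lst

variable (L : Lst) {V : Type} {A : Type u} {D : Type v}

/-- The hash maps for the successor pointers. -/
def dn : List ℕ := (List.range L.es.length).map fun j => Nat.pair L.id (2 * j + 1)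

/-- The hash maps for the predecessor pointers. -/
def dp : List ℕ := (List.range L.es.length).map fun j => Nat.pair L.id (2 * j + 2)

/-- The hash map that marks the elements. -/
def dm : ℕ := Nat.pair L.id 0

/-- Temporary registers for the element before the current one. -/
def ps : List ℕ := (List.range L.es.length).map fun j => 2 * L.m + 7 + 2 * j

/-- Temporary registers for the element after another one. -/
def qs : List ℕ := (List.range L.es.length).map fun j => 2 * L.m + 8 + 2 * j

/-- Registers that hold the sentinel. -/
def zs : List ℕ := List.replicate L.es.length L.m

/-- The registers used by the list lie below the temporary registers, and the elements are not held
in the register `m`, which holds the blank `sym 0`. -/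
structure WF : Prop where
  kc_lt : ∀ r ∈ L.kc, r < 2 * L.m + 4
  es_lt : ∀ r ∈ L.es, r < 2 * L.m + 4
  nodup : L.es.Nodup
  zero : L.m ∉ L.es

/-- Add the element in the registers `es` at the front. -/
def insert : Prog V := seqs [
  loadVec L.qs L.dn (L.kc ++ L.zs),
  storeVec L.dn (L.kc ++ L.es) L.qs,
  storeVec L.dp (L.kc ++ L.es) L.zs,
  storeVec L.dn (L.kc ++ L.zs) L.es,
  storeVec L.dp (L.kc ++ L.qs) L.es,
  .instr (.store L.dm (L.kc ++ L.es) (L.m + 1))]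

/-- Delete the element in the registers `es`. -/
def remove : Prog V := seqs [
  loadVec L.ps L.dp (L.kc ++ L.es),
  loadVec L.qs L.dn (L.kc ++ L.es),
  storeVec L.dn (L.kc ++ L.ps) L.qs,
  storeVec L.dp (L.kc ++ L.qs) L.ps,
  .instr (.store L.dm (L.kc ++ L.es) L.m)]

/-- Make the element in the registers `es` a member iff register `2 * m + 4` holds `sym 1`. -/
def set : Prog V := seqs [
  .instr (.load (2 * L.m + 5) L.dm (L.kc ++ L.es)),
  .ite (.eq (2 * L.m + 5) (2 * L.m + 4)) .skip
    (.ite (.eq (2 * L.m + 4) (L.m + 1)) L.insert L.remove)]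

theorem straight_insert : (L.insert : Prog V).Straight := by
  simp [insert, straight_seqs, straight_loadVec, straight_storeVec, Prog.Straight]

theorem straight_remove : (L.remove : Prog V).Straight := by
  simp [remove, straight_seqs, straight_loadVec, straight_storeVec, Prog.Straight]

theorem straight_set : (L.set : Prog V).Straight := by
  simp [set, straight_seqs, straight_insert, straight_remove, Prog.Straight]

/-- The sentinel. -/
def blank : List (Word A) := List.replicate L.es.length (Word.sym 0)

/-- The successor of `w` in the list for the content `c`. -/
def nx (F : ℕ → List (Word A) → Word A) (c w : List (Word A)) : List (Word A) :=
  L.dn.map fun d => F d (c ++ w)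

/-- The predecessor of `w` in the list for the content `c`. -/
def pv (F : ℕ → List (Word A) → Word A) (c w : List (Word A)) : List (Word A) :=
  L.dp.map fun d => F d (c ++ w)

/-- The hash maps `F` store the list `l` for the content `c` of the registers `kc`. Elements do not
start with a blank, which tells them apart from the sentinel. -/
structure IsCycle (F : ℕ → List (Word A) → Word A) (c : List (Word A))
    (l : List (List (Word A))) : Prop where
  nodup : l.Nodup
  len : ∀ w ∈ l, w.length = L.es.length
  head : ∀ w ∈ l, w.headD (Word.sym 0) ≠ Word.sym 0
  next : Trail (L.nx F c) L.blank l L.blank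
  prev : Trail (L.pv F c) L.blank l.reverse L.blank
  mark : ∀ w, w.length = L.es.length →
    F L.dm (c ++ w) = if w ∈ l then Word.sym 1 else Word.sym 0

/-- `F'` differs from `F` only in the list of `L` for the content `c`. -/
def Frame (F F' : ℕ → List (Word A) → Word A) (c : List (Word A)) : Prop :=
  (∀ d, d.unpair.1 ≠ L.id → F' d = F d) ∧
    ∀ c', c'.length = c.length → c' ≠ c → ∀ d w, F' d (c' ++ w) = F d (c' ++ w)

variable {L}

theorem Frame.refl (F : ℕ → List (Word A) → Word A) (c : List (Word A)) : L.Frame F F c :=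
  ⟨fun _ _ => rfl, fun _ _ _ _ _ => rfl⟩

theorem Frame.trans {F F' F'' : ℕ → List (Word A) → Word A} {c : List (Word A)}
    (h : L.Frame F F' c) (h' : L.Frame F' F'' c) : L.Frame F F'' c :=
  ⟨fun d hd => (h'.1 d hd).trans (h.1 d hd),
    fun c' hl hc d w => (h'.2 c' hl hc d w).trans (h.2 c' hl hc d w)⟩

theorem IsCycle.congr {F F' : ℕ → List (Word A) → Word A} {c : List (Word A)}
    {l : List (List (Word A))} (h : L.IsCycle F c l)
    (he : ∀ d, d.unpair.1 = L.id → ∀ w, F' d (c ++ w) = F d (c ++ w)) : L.IsCycle F' c l where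
  nodup := h.nodup
  len := h.len
  head := h.head
  next := h.next.congr fun x _ => List.map_congr_left fun d hd => he d (by
    obtain ⟨j, -, rfl⟩ := List.mem_map.1 hd; simp) x
  prev := h.prev.congr fun x _ => List.map_congr_left fun d hd => he d (by
    obtain ⟨j, -, rfl⟩ := List.mem_map.1 hd; simp) x
  mark w hw := (he _ (by simp [dm]) w).trans (h.mark w hw)

theorem isCycle_nil (c : List (Word A)) : L.IsCycle (fun _ _ => Word.sym 0) c [] where
  nodup := List.nodup_nil
  len := by simp
  head := by simp
  next := by simp [Trail, nx, dn, blank, Function.comp_def]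
  prev := by simp [Trail, pv, dp, blank, Function.comp_def]
  mark := by simp

theorem headD_blank : (L.blank : List (Word A)).headD (Word.sym 0) = Word.sym 0 := by
  unfold blank
  cases L.es.length <;> simp [List.replicate_succ]

theorem blank_notMem {F : ℕ → List (Word A) → Word A} {c : List (Word A)}
    {l : List (List (Word A))} (h : L.IsCycle F c l) : L.blank ∉ l := fun hm =>
  h.head _ hm headD_blank

theorem dn_nodup : L.dn.Nodup :=
  List.nodup_range.map fun a b h => by simpa [Nat.pair_eq_pair] using h

theorem dp_nodup : L.dp.Nodup :=
  List.nodup_range.map fun a b h => by simpa [Nat.pair_eq_pair] using h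

theorem dn_length : L.dn.length = L.es.length := by simp [dn]

theorem dp_length : L.dp.length = L.es.length := by simp [dp]

theorem ps_length : L.ps.length = L.es.length := by simp [ps]

theorem qs_length : L.qs.length = L.es.length := by simp [qs]

theorem zs_length : L.zs.length = L.es.length := by simp [zs]

theorem ps_nodup : L.ps.Nodup := List.nodup_range.map fun a b h => by simp at h; omega

theorem qs_nodup : L.qs.Nodup := List.nodup_range.map fun a b h => by simp at h; omega

theorem le_of_mem_ps {r : ℕ} (h : r ∈ L.ps) : 2 * L.m + 7 ≤ r ∧ r ∉ L.qs := by
  simp only [ps, qs, List.mem_map, not_exists, not_and] at h ⊢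
  obtain ⟨j, -, rfl⟩ := h
  exact ⟨by omega, fun i _ => by omega⟩

theorem le_of_mem_qs {r : ℕ} (h : r ∈ L.qs) : 2 * L.m + 7 ≤ r := by
  simp only [qs, List.mem_map] at h
  obtain ⟨j, -, rfl⟩ := h
  omega

theorem dp_notMem_dn {d : ℕ} (h : d ∈ L.dp) : d ∉ L.dn := by
  simp only [dp, dn, List.mem_map, not_exists, not_and] at h ⊢
  obtain ⟨j, -, rfl⟩ := h
  intro i _ h
  rw [Nat.pair_eq_pair] at h
  omega

theorem dm_notMem_dn : L.dm ∉ L.dn := by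
  simp [dm, dn, Nat.pair_eq_pair]

theorem dm_notMem_dp : L.dm ∉ L.dp := by
  simp [dm, dp, Nat.pair_eq_pair]

theorem id_of_mem_dn {d : ℕ} (h : d ∈ L.dn) : d.unpair.1 = L.id := by
  obtain ⟨j, -, rfl⟩ := List.mem_map.1 h; simp

theorem id_of_mem_dp {d : ℕ} (h : d ∈ L.dp) : d.unpair.1 = L.id := by
  obtain ⟨j, -, rfl⟩ := List.mem_map.1 h; simp

variable [CommRing D] (g : V → A → D)

/-- Storing into hash maps of `L` at a key of the list for `c` affects that list only, and redirects
the pointers at one element. -/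
theorem store_frame (ds key rs : List ℕ) (hl : ds.length = rs.length) (hn : ds.Nodup)
    (hid : ∀ d ∈ ds, d.unpair.1 = L.id) (σ : State A D) {c w : List (Word A)}
    (hkey : key.map σ.reg = c ++ w) :
    ∃ F, (storeVec ds key rs : Prog V).eval g σ = { σ with dict := F } ∧
      (∀ d, d ∉ ds → F d = σ.dict d) ∧ L.Frame σ.dict F c ∧
      (fun w' => ds.map fun d => F d (c ++ w')) =
        Function.update (fun w' => ds.map fun d => σ.dict d (c ++ w')) w (rs.map σ.reg) := by
  obtain ⟨F, h1, h2, h3, h4⟩ := eval_storeVec g ds key rs hl hn σ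
  rw [hkey] at h3 h4
  refine ⟨F, h1, h2, ⟨fun d hd => h2 d fun h => hd (hid d h), fun c' hl hc d w' => h3 d _ ?_⟩, ?_⟩
  · exact fun h => hc (List.append_inj h hl).1
  · funext w'
    by_cases hw : w' = w
    · subst hw; simpa using h4
    · rw [Function.update_of_ne hw]
      exact List.map_congr_left fun d _ => h3 d _ fun h => hw (List.append_cancel_left h)

theorem store_next (key rs : List ℕ) (hl : rs.length = L.es.length) (σ : State A D)
    {c w : List (Word A)} (hkey : key.map σ.reg = c ++ w) :
    ∃ F, (storeVec L.dn key rs : Prog V).eval g σ = { σ with dict := F } ∧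
      L.nx F c = Function.update (L.nx σ.dict c) w (rs.map σ.reg) ∧ L.pv F c = L.pv σ.dict c ∧
      F L.dm = σ.dict L.dm ∧ L.Frame σ.dict F c := by
  obtain ⟨F, h1, h2, h3, h4⟩ := store_frame g L.dn key rs (dn_length.trans hl.symm) dn_nodup
    (fun d hd => id_of_mem_dn hd) σ hkey
  refine ⟨F, h1, h4, ?_, h2 _ dm_notMem_dn, h3⟩
  funext w'
  exact List.map_congr_left fun d hd => by rw [h2 d (dp_notMem_dn hd)]

theorem store_prev (key rs : List ℕ) (hl : rs.length = L.es.length) (σ : State A D)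
    {c w : List (Word A)} (hkey : key.map σ.reg = c ++ w) :
    ∃ F, (storeVec L.dp key rs : Prog V).eval g σ = { σ with dict := F } ∧
      L.nx F c = L.nx σ.dict c ∧ L.pv F c = Function.update (L.pv σ.dict c) w (rs.map σ.reg) ∧
      F L.dm = σ.dict L.dm ∧ L.Frame σ.dict F c := by
  obtain ⟨F, h1, h2, h3, h4⟩ := store_frame g L.dp key rs (dp_length.trans hl.symm) dp_nodup
    (fun d hd => id_of_mem_dp hd) σ hkey
  refine ⟨F, h1, ?_, h4, h2 _ dm_notMem_dp, h3⟩
  funext w'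
  exact List.map_congr_left fun d hd => by rw [h2 d fun h => dp_notMem_dn h hd]

theorem store_mark (key : List ℕ) (r : ℕ) (σ : State A D) {c w : List (Word A)}
    (hkey : key.map σ.reg = c ++ w) :
    ∃ F, (Prog.instr (.store L.dm key r) : Prog V).eval g σ = { σ with dict := F } ∧
      L.nx F c = L.nx σ.dict c ∧ L.pv F c = L.pv σ.dict c ∧
      F L.dm = Function.update (σ.dict L.dm) (c ++ w) (σ.reg r) ∧ L.Frame σ.dict F c := by
  refine ⟨_, rfl, ?_, ?_, ?_, ?_, ?_⟩
  · funext w'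
    exact List.map_congr_left fun d hd => by
      rw [Function.update_of_ne (fun e => dm_notMem_dn (e ▸ hd))]
  · funext w'
    exact List.map_congr_left fun d hd => by
      rw [Function.update_of_ne (fun e => dm_notMem_dp (e ▸ hd))]
  · rw [hkey]; simp
  · exact fun d hd => Function.update_of_ne (fun e => hd (by simp [e, dm])) _ _
  · intro c' hl hc d w'
    by_cases hd : d = L.dm
    · subst hd
      rw [hkey, Function.update_self, Function.update_of_ne]
      exact fun h => hc (List.append_inj h hl).1
    · rw [Function.update_of_ne hd]

theorem insert_spec (hL : L.WF) (σ : State A D) (hz : σ.reg L.m = Word.sym 0)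
    (ho : σ.reg (L.m + 1) = Word.sym 1) {l : List (List (Word A))}
    (hl : L.IsCycle σ.dict (L.kc.map σ.reg) l)
    (hh : (L.es.map σ.reg).headD (Word.sym 0) ≠ Word.sym 0) (hw : L.es.map σ.reg ∉ l) :
    ∃ f F, (L.insert : Prog V).eval g σ = { σ with reg := f, dict := F } ∧
      (∀ r < 2 * L.m + 7, f r = σ.reg r) ∧ L.Frame σ.dict F (L.kc.map σ.reg) ∧
      L.IsCycle F (L.kc.map σ.reg) (L.es.map σ.reg :: l) := by
  obtain ⟨f, e1, hq, hf⟩ := eval_loadVec g L.qs L.dn (L.kc ++ L.zs)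
    (qs_length.trans dn_length.symm) qs_nodup (by
      intro r hr h
      have := le_of_mem_qs h
      rcases List.mem_append.1 hr with h | h
      · have := hL.kc_lt r h; omega
      · have := List.eq_of_mem_replicate h; omega) σ
  have hf' : ∀ r < 2 * L.m + 7, f r = σ.reg r := fun r hr => hf r fun h => by
    have := le_of_mem_qs h; omega
  have hkc : L.kc.map f = L.kc.map σ.reg := List.map_congr_left fun r hr =>
    hf' r (by have := hL.kc_lt r hr; omega)
  have hes : L.es.map f = L.es.map σ.reg := List.map_congr_left fun r hr =>
    hf' r (by have := hL.es_lt r hr; omega)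
  have hzs : L.zs.map f = L.blank := by simp [zs, blank, hf' L.m (by omega), hz]
  have hzs' : L.zs.map σ.reg = L.blank := by simp [zs, blank, hz]
  set c := L.kc.map σ.reg with hc
  set w := L.es.map σ.reg with hw'
  have hq' : L.qs.map f = L.nx σ.dict c L.blank := by
    rw [hq, List.map_append, hzs']; rfl
  obtain ⟨F₁, e2, n1, p1, m1, r1⟩ := store_next (L := L) g (L.kc ++ L.es) L.qs qs_length
    { σ with reg := f } (c := c) (w := w) (by simp [hkc, hes])
  obtain ⟨F₂, e3, n2, p2, m2, r2⟩ := store_prev (L := L) g (L.kc ++ L.es) L.zs zs_length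
    { σ with reg := f, dict := F₁ } (c := c) (w := w) (by simp [hkc, hes])
  obtain ⟨F₃, e4, n3, p3, m3, r3⟩ := store_next (L := L) g (L.kc ++ L.zs) L.es rfl
    { σ with reg := f, dict := F₂ } (c := c) (w := L.blank) (by simp [hkc, hzs])
  obtain ⟨F₄, e5, n4, p4, m4, r4⟩ := store_prev (L := L) g (L.kc ++ L.qs) L.es rfl
    { σ with reg := f, dict := F₃ } (c := c) (w := L.nx σ.dict c L.blank) (by simp [hkc, hq'])
  obtain ⟨F₅, e6, n5, p5, m5, r5⟩ := store_mark (L := L) g (L.kc ++ L.es) (L.m + 1)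
    { σ with reg := f, dict := F₄ } (c := c) (w := w) (by simp [hkc, hes])
  simp only [hq', hes, hzs, hf' (L.m + 1) (by omega), ho] at n1 p2 n3 p4 m5
  have hbl : L.blank ∉ l := blank_notMem hl
  have hwb : w ≠ L.blank := fun e => hh (e ▸ headD_blank)
  refine ⟨f, F₅, ?_, hf', ((((r1.trans r2).trans r3).trans r4).trans r5), ?_⟩
  · simp only [insert, seqs, Prog.eval] at *
    rw [e1, e2, e3, e4, e5, e6]
  have hfirst : L.nx σ.dict c L.blank = l.headD L.blank := hl.next.first
  have hlast : (L.blank :: l.reverse).getLast (by simp) = L.nx σ.dict c L.blank := by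
    rw [hfirst]
    cases l with
    | nil => simp
    | cons x l => simp
  have hnd : (L.blank :: l).Nodup := List.nodup_cons.2 ⟨hbl, hl.nodup⟩
  refine ⟨List.nodup_cons.2 ⟨hw, hl.nodup⟩, ?_, ?_, ?_, ?_, ?_⟩
  · intro w' hw''
    rcases List.mem_cons.1 hw'' with rfl | h
    · simp [w]
    · exact hl.len _ h
  · intro w' hw''
    rcases List.mem_cons.1 hw'' with rfl | h
    · exact hh
    · exact hl.head _ h
  · rw [n5, n4, n3, n2, n1]
    exact Trail.insert (l₁ := []) (e := w) hl.next hnd (by simp [hwb, hw]) rfl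
  · rw [p5, p4, p3, p2, p1]
    have h0 : Trail (L.pv σ.dict c) L.blank (l.reverse ++ []) L.blank := by simpa using hl.prev
    have := h0.insert (e := w) (by simpa using hnd) (by simp [hwb, hw]) hlast.symm
    rw [List.reverse_cons]
    have hpl : L.pv σ.dict c (L.nx σ.dict c L.blank) = L.blank := by
      rw [← hlast]; exact hl.prev.last
    rwa [hpl] at this
  · intro w' hl'
    rw [m5]
    simp only [m4, m3, m2, m1]
    by_cases he : w' = w
    · subst he; simp
    · rw [Function.update_of_ne (fun h => he (List.append_cancel_left h))]
      simpa [he] using hl.mark w' hl'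

theorem remove_spec (hL : L.WF) (σ : State A D) (hz : σ.reg L.m = Word.sym 0)
    {l : List (List (Word A))} (hl : L.IsCycle σ.dict (L.kc.map σ.reg) l)
    (hw : L.es.map σ.reg ∈ l) :
    ∃ f F l', (L.remove : Prog V).eval g σ = { σ with reg := f, dict := F } ∧
      (∀ r < 2 * L.m + 7, f r = σ.reg r) ∧ L.Frame σ.dict F (L.kc.map σ.reg) ∧
      L.IsCycle F (L.kc.map σ.reg) l' ∧ ∀ w, w ∈ l' ↔ w ≠ L.es.map σ.reg ∧ w ∈ l := by
  have hlow : ∀ r ∈ L.kc ++ L.es, r < 2 * L.m + 4 := by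
    intro r hr
    rcases List.mem_append.1 hr with h | h
    exacts [hL.kc_lt r h, hL.es_lt r h]
  obtain ⟨f₁, e1, hp, hf1⟩ := eval_loadVec g L.ps L.dp (L.kc ++ L.es)
    (ps_length.trans dp_length.symm) ps_nodup
    (fun r hr h => by have := hlow r hr; have := (le_of_mem_ps h).1; omega) σ
  obtain ⟨f, e2, hq, hf2⟩ := eval_loadVec g L.qs L.dn (L.kc ++ L.es)
    (qs_length.trans dn_length.symm) qs_nodup
    (fun r hr h => by have := hlow r hr; have := le_of_mem_qs h; omega) { σ with reg := f₁ }
  have hf1' : ∀ r < 2 * L.m + 7, f₁ r = σ.reg r := fun r hr =>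
    hf1 r fun h => by have := (le_of_mem_ps h).1; omega
  have hf' : ∀ r < 2 * L.m + 7, f r = σ.reg r := fun r hr =>
    (hf2 r fun h => by have := le_of_mem_qs h; omega).trans (hf1' r hr)
  have hkc : L.kc.map f = L.kc.map σ.reg := List.map_congr_left fun r hr =>
    hf' r (by have := hL.kc_lt r hr; omega)
  have hes : L.es.map f = L.es.map σ.reg := List.map_congr_left fun r hr =>
    hf' r (by have := hL.es_lt r hr; omega)
  have hkc1 : L.kc.map f₁ = L.kc.map σ.reg := List.map_congr_left fun r hr =>
    hf1' r (by have := hL.kc_lt r hr; omega)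
  have hes1 : L.es.map f₁ = L.es.map σ.reg := List.map_congr_left fun r hr =>
    hf1' r (by have := hL.es_lt r hr; omega)
  set c := L.kc.map σ.reg with hc
  set w := L.es.map σ.reg with hw'
  have hp' : L.ps.map f = L.pv σ.dict c w := by
    rw [List.map_congr_left fun r hr => hf2 r (le_of_mem_ps hr).2, hp, List.map_append]; rfl
  have hq' : L.qs.map f = L.nx σ.dict c w := by
    rw [hq, List.map_append]
    simp only [hkc1, hes1]
    rfl
  obtain ⟨F₁, e3, n1, p1, m1, r1⟩ := store_next (L := L) g (L.kc ++ L.ps) L.qs qs_length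
    { σ with reg := f } (c := c) (w := L.pv σ.dict c w) (by simp [hkc, hp'])
  obtain ⟨F₂, e4, n2, p2, m2, r2⟩ := store_prev (L := L) g (L.kc ++ L.qs) L.ps ps_length
    { σ with reg := f, dict := F₁ } (c := c) (w := L.nx σ.dict c w) (by simp [hkc, hq'])
  obtain ⟨F₃, e5, n3, p3, m3, r3⟩ := store_mark (L := L) g (L.kc ++ L.es) L.m
    { σ with reg := f, dict := F₂ } (c := c) (w := w) (by simp [hkc, hes])
  simp only [hq', hp', hf' L.m (by omega), hz] at n1 p2 m3
  have hbl : L.blank ∉ l := blank_notMem hl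
  obtain ⟨l₁, l₂, rfl⟩ := List.append_of_mem hw
  have hnd : (L.blank :: (l₁ ++ w :: l₂)).Nodup := List.nodup_cons.2 ⟨hbl, hl.nodup⟩
  have hrev : (l₁ ++ w :: l₂).reverse = l₂.reverse ++ w :: l₁.reverse := by simp
  have hprev := hl.prev
  rw [hrev] at hprev
  have hnd' : (L.blank :: (l₂.reverse ++ w :: l₁.reverse)).Nodup := by
    rw [← hrev]
    exact List.nodup_cons.2 ⟨by rwa [List.mem_reverse], List.nodup_reverse.2 hl.nodup⟩
  have hpv : L.pv σ.dict c w = (L.blank :: l₁).getLast (by simp) := by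
    rw [hprev.succ]
    rcases List.eq_nil_or_concat l₁ with rfl | ⟨l', x, rfl⟩ <;> simp
  have hnx : L.nx σ.dict c w = (L.blank :: l₂.reverse).getLast (by simp) := by
    rw [hl.next.succ]
    cases l₂ <;> simp
  have hwn : w ∉ l₁ ++ l₂ := by
    have := (List.nodup_middle.1 hl.nodup)
    exact (List.nodup_cons.1 this).1
  have hmem : ∀ w', w' ∈ l₁ ++ l₂ ↔ w' ≠ w ∧ w' ∈ l₁ ++ w :: l₂ := by
    intro w'
    constructor
    · intro h
      refine ⟨fun e => hwn (e ▸ h), ?_⟩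
      rcases List.mem_append.1 h with h | h <;> simp [h]
    · rintro ⟨h1, h2⟩
      simpa [h1] using h2
  refine ⟨f, F₃, l₁ ++ l₂, ?_, hf', (r1.trans r2).trans r3, ?_, hmem⟩
  · simp only [remove, seqs, Prog.eval] at *
    rw [e1, e2, e3, e4, e5]
  refine ⟨(List.nodup_cons.1 (List.nodup_middle.1 hl.nodup)).2,
    fun w' h => hl.len w' ((hmem w').1 h).2, fun w' h => hl.head w' ((hmem w').1 h).2, ?_, ?_, ?_⟩
  · rw [n3, n2, n1]
    exact hl.next.remove hnd hpv
  · rw [p3, p2, p1, List.reverse_append]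
    exact hprev.remove hnd' hnx
  · intro w' hl'
    rw [m3]
    simp only [m2, m1]
    by_cases he : w' = w
    · subst he; simp [hwn]
    · rw [Function.update_of_ne (fun h => he (List.append_cancel_left h))]
      simp only [hl.mark w' hl', hmem w', ne_eq, he, not_false_eq_true, true_and]

theorem set_spec (hL : L.WF) (σ : State A D) (hz : σ.reg L.m = Word.sym 0)
    (ho : σ.reg (L.m + 1) = Word.sym 1) {l : List (List (Word A))}
    (hl : L.IsCycle σ.dict (L.kc.map σ.reg) l) (b : Prop)
    (hb : σ.reg (2 * L.m + 4) = if b then Word.sym 1 else Word.sym 0)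
    (hh : b → (L.es.map σ.reg).headD (Word.sym 0) ≠ Word.sym 0) :
    ∃ f F l', (L.set : Prog V).eval g σ = { σ with reg := f, dict := F } ∧
      (∀ r < 2 * L.m + 5, f r = σ.reg r) ∧ L.Frame σ.dict F (L.kc.map σ.reg) ∧
      L.IsCycle F (L.kc.map σ.reg) l' ∧
      ∀ w, w ∈ l' ↔ if w = L.es.map σ.reg then b else w ∈ l := by
  set σ₁ : State A D :=
    { σ with reg := Function.update σ.reg (2 * L.m + 5) (σ.dict L.dm ((L.kc ++ L.es).map σ.reg)) }
    with hσ₁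
  have hreg : ∀ r < 2 * L.m + 5, σ₁.reg r = σ.reg r := fun r hr =>
    Function.update_of_ne (by omega) _ _
  have hkc : L.kc.map σ₁.reg = L.kc.map σ.reg := List.map_congr_left fun r hr =>
    hreg r (by have := hL.kc_lt r hr; omega)
  have hes : L.es.map σ₁.reg = L.es.map σ.reg := List.map_congr_left fun r hr =>
    hreg r (by have := hL.es_lt r hr; omega)
  have hmk : σ₁.reg (2 * L.m + 5) =
      if L.es.map σ.reg ∈ l then Word.sym 1 else Word.sym 0 := by
    rw [← hl.mark _ (by simp)]
    simp [σ₁]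
  have hst : σ₁.reg (2 * L.m + 4) = if b then Word.sym 1 else Word.sym 0 := by
    rw [hreg _ (by omega), hb]
  have ho₁ : σ₁.reg (L.m + 1) = Word.sym 1 := (hreg _ (by omega)).trans ho
  have hz₁ : σ₁.reg L.m = Word.sym 0 := (hreg _ (by omega)).trans hz
  have hl₁ : L.IsCycle σ₁.dict (L.kc.map σ₁.reg) l := by rw [hkc]; exact hl
  have hE : (L.set : Prog V).eval g σ =
      if σ₁.reg (2 * L.m + 5) = σ₁.reg (2 * L.m + 4) then σ₁ else
        if σ₁.reg (2 * L.m + 4) = σ₁.reg (L.m + 1) then L.insert.eval g σ₁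
        else L.remove.eval g σ₁ := rfl
  rw [hE, hmk, hst, ho₁]
  by_cases hb' : b <;> by_cases hm : L.es.map σ.reg ∈ l
  · refine ⟨σ₁.reg, σ.dict, l, by simp [hb', hm, σ₁], hreg, .refl _ _, hl, fun w => ?_⟩
    split_ifs with h
    · simp [h, hm, hb']
    · rfl
  · obtain ⟨f, F, h1, h2, h3, h4⟩ := insert_spec g hL σ₁ hz₁ ho₁ hl₁ (by rw [hes]; exact hh hb')
      (by rw [hes]; exact hm)
    rw [hkc] at h3 h4
    rw [hes] at h4
    refine ⟨f, F, _, by simp only [hb', hm, if_true, if_false]; simpa using h1,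
      fun r hr => (h2 r (by omega)).trans (hreg r hr), h3, h4, fun w => ?_⟩
    split_ifs with h
    · simp [h, hb']
    · simp [h]
  · obtain ⟨f, F, l', h1, h2, h3, h4, h5⟩ := remove_spec g hL σ₁ hz₁ hl₁ (by rw [hes]; exact hm)
    rw [hkc] at h3 h4
    rw [hes] at h5
    refine ⟨f, F, l', by simp only [hb', hm, if_true, if_false]; simpa using h1,
      fun r hr => (h2 r (by omega)).trans (hreg r hr), h3, h4, fun w => ?_⟩
    rw [h5]
    split_ifs with h
    · simp [h, hb']
    · simp [h]
  · refine ⟨σ₁.reg, σ.dict, l, by simp [hb', hm, σ₁], hreg, .refl _ _, hl, fun w => ?_⟩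
    split_ifs with h
    · simp [h, hm, hb']
    · rfl

end Lst

/-! ### Traversing a list -/

/-- The trace of a traversal of the list `l`: traces with property `T w` for the elements `w` of
`l`, before, between and after which there are at most `b` steps without output. -/
inductive Seg {A : Type u} {D : Type v} {E : Type*} (b : ℕ)
    (T : E → List (Option (Record A D)) → Prop) : List E → List (Option (Record A D)) → Prop
  | nil {t} : Quiet t → t.length ≤ b → Seg b T [] t
  | cons {t w t' l tr} : Quiet t → t.length ≤ b → T w t' → Seg b T l tr →
      Seg b T (w :: l) (t ++ t' ++ tr)

theorem Seg.length_le {A : Type u} {D : Type v} {E : Type*} {b k : ℕ}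
    {T : E → List (Option (Record A D)) → Prop} {l : List E} {tr : List (Option (Record A D))}
    (h : Seg b T l tr) (hT : ∀ w t, T w t → t.length ≤ k) :
    tr.length ≤ (b + k) * l.length + b := by
  induction h with
  | nil _ h => simpa using h
  | cons _ h1 h2 _ ih =>
    have := hT _ _ h2
    simp only [List.length_append, List.length_cons]
    nlinarith

namespace Lst

variable (L : Lst) {V : Type} {A : Type u} {D : Type v}

/-- Move to the element after the one in the registers `rs`, and set the flag `2 * m + 6` to
`sym 1` unless the end of the list has been reached. -/
def advance (rs : List ℕ) : Prog V := seqs [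
  loadVec L.qs L.dn (L.kc ++ rs),
  moveVec L.es L.qs,
  .ite (.eq (L.es.headD L.m) L.m) (.instr (.const (2 * L.m + 6) 0))
    (.instr (.const (2 * L.m + 6) 1))]

/-- Run `P` for every element of the list, held in the registers `es`. -/
def forEach (P : Prog V) : Prog V :=
  .seq (L.advance L.zs) (.loop (.eq (2 * L.m + 6) (L.m + 1)) (.seq P (L.advance L.es)))

/-- The time that a traversal spends between two elements. -/
def gap : ℕ := (L.advance L.zs : Prog Empty).cost + (L.advance L.es : Prog Empty).cost + 1

theorem straight_advance (rs : List ℕ) : (L.advance rs : Prog V).Straight := by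
  simp [advance, straight_seqs, straight_loadVec, straight_moveVec, Prog.Straight]

theorem cost_advance (rs : List ℕ) :
    (L.advance rs : Prog V).cost = (L.advance rs : Prog Empty).cost := by
  have h1 : ∀ ts ds key : List ℕ,
      (loadVec ts ds key : Prog V).cost = (loadVec ts ds key : Prog Empty).cost := by
    intro ts ds key
    induction ts generalizing ds with
    | nil => rfl
    | cons t ts ih =>
      cases ds with
      | nil => rfl
      | cons d ds => exact congrArg (1 + ·) (ih ds)
  have h2 : ∀ ts rs : List ℕ, (moveVec ts rs : Prog V).cost = (moveVec ts rs : Prog Empty).cost := by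
    intro ts rs
    induction ts generalizing rs with
    | nil => rfl
    | cons t ts ih =>
      cases rs with
      | nil => rfl
      | cons d rs => exact congrArg (1 + ·) (ih rs)
  simp only [advance, seqs, Prog.cost, h1, h2]

variable {L} [CommRing D] (g : V → A → D)

theorem eval_advance (hL : L.WF) (rs : List ℕ) (hrs : ∀ r ∈ rs, r < 2 * L.m + 4) (σ : State A D)
    (hz : σ.reg L.m = Word.sym 0) :
    ∃ f, (L.advance rs : Prog V).eval g σ = { σ with reg := f } ∧
      L.es.map f = L.nx σ.dict (L.kc.map σ.reg) (rs.map σ.reg) ∧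
      (∀ r < 2 * L.m + 4, r ∉ L.es → f r = σ.reg r) ∧
      f (2 * L.m + 6) =
        if (L.es.map f).headD (Word.sym 0) = Word.sym 0 then Word.sym 0 else Word.sym 1 := by
  obtain ⟨f₁, e1, h1, h1'⟩ := eval_loadVec g L.qs L.dn (L.kc ++ rs)
    (qs_length.trans dn_length.symm) qs_nodup (fun r hr h => by
      have := le_of_mem_qs h
      rcases List.mem_append.1 hr with h | h
      · have := hL.kc_lt r h; omega
      · have := hrs r h; omega) σ
  obtain ⟨f₂, e2, h2, h2'⟩ := eval_moveVec g L.es L.qs qs_length.symm hL.nodup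
    (fun r hr h => by have := le_of_mem_qs hr; have := hL.es_lt r h; omega) { σ with reg := f₁ }
  have hf₂ : ∀ r < 2 * L.m + 4, r ∉ L.es → f₂ r = σ.reg r := fun r hr hr' =>
    (h2' r hr').trans (h1' r fun h => by have := le_of_mem_qs h; omega)
  have hm : f₂ L.m = Word.sym 0 := (hf₂ _ (by omega) hL.zero).trans hz
  set b : Word A :=
    if (L.es.map f₂).headD (Word.sym 0) = Word.sym 0 then Word.sym 0 else Word.sym 1 with hb
  have hmap : L.es.map (Function.update f₂ (2 * L.m + 6) b) = L.es.map f₂ :=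
    List.map_congr_left fun r hr => Function.update_of_ne
      (by have := hL.es_lt r hr; omega) _ _
  have hhd : f₂ (L.es.headD L.m) = (L.es.map f₂).headD (Word.sym 0) := by
    cases L.es <;> simp [hm]
  refine ⟨Function.update f₂ (2 * L.m + 6) b, ?_, ?_, fun r hr hr' => ?_, ?_⟩
  · simp only [advance, seqs, Prog.eval, e1, e2, Cond.holds, hm, hhd]
    by_cases h : (L.es.map f₂).headD (Word.sym 0) = Word.sym 0 <;>
      simp only [h, if_true, if_false, Instr.step, b]
  · rw [hmap, h2]
    simp only [h1]
    rw [List.map_append]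
    rfl
  · rw [Function.update_of_ne (by omega), hf₂ r hr hr']
  · rw [hmap, Function.update_self]

/-- A traversal runs its body once for every element. `J ws` is the invariant after the elements
`ws` have been processed; it must not depend on the registers `es` and the temporary registers. -/
theorem forEach_exec (hL : L.WF) {P : Prog V} {c : List (Word A)} {l : List (List (Word A))}
    (J : List (List (Word A)) → State A D → Prop)
    (T : List (Word A) → List (Option (Record A D)) → Prop)
    (hJ : ∀ ws σ, J ws σ → L.IsCycle σ.dict c l ∧ L.kc.map σ.reg = c ∧
      σ.reg L.m = Word.sym 0 ∧ σ.reg (L.m + 1) = Word.sym 1)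
    (hreg : ∀ ws σ f, J ws σ → (∀ r < 2 * L.m + 4, r ∉ L.es → f r = σ.reg r) →
      J ws { σ with reg := f })
    (hbody : ∀ ws w rest, l = ws ++ w :: rest → ∀ σ, J ws σ → L.es.map σ.reg = w →
      ∃ tr σ', Exec g P σ tr σ' ∧ T w tr ∧ J (ws ++ [w]) σ' ∧ L.es.map σ'.reg = w)
    (σ : State A D) (h : J [] σ) :
    ∃ tr σ', Exec g (L.forEach P) σ tr σ' ∧ Seg L.gap T l tr ∧ J l σ' := by
  -- advancing from the element `w` of the cycle, the sentinel included, leads to the next one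
  have hadv : ∀ ws w rest, L.blank :: l = ws ++ w :: rest → ∀ rs : List ℕ,
      (∀ r ∈ rs, r < 2 * L.m + 4) → ∀ σ ws', J ws' σ → rs.map σ.reg = w →
      ∃ f, (L.advance rs : Prog V).eval g σ = { σ with reg := f } ∧ J ws' { σ with reg := f } ∧
        L.es.map f = rest.headD L.blank ∧
        f (2 * L.m + 6) = if rest = [] then Word.sym 0 else Word.sym 1 := by
    intro ws w rest hl rs hrs σ ws' hσ hw
    obtain ⟨hcyc, hkc, hz, -⟩ := hJ _ _ hσ
    obtain ⟨f, e1, e2, e3, e4⟩ := eval_advance (V := V) g hL rs hrs σ hz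
    have hnx : L.es.map f = rest.headD L.blank := by
      rw [e2, hkc, hw]
      rcases ws with _ | ⟨a, ws⟩
      · obtain ⟨rfl, rfl⟩ : L.blank = w ∧ l = rest := by simpa using hl
        exact hcyc.next.first
      · obtain ⟨-, rfl⟩ : L.blank = a ∧ l = ws ++ w :: rest := by simpa using hl
        exact hcyc.next.succ
    refine ⟨f, e1, hreg _ _ _ hσ e3, hnx, ?_⟩
    rw [e4, hnx]
    rcases rest with _ | ⟨a, rest⟩
    · exact (if_pos headD_blank).trans (if_pos rfl).symm
    · have ha : a ∈ l := by
        have : a ∈ L.blank :: l := by rw [hl]; simp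
        rcases List.mem_cons.1 this with rfl | h
        · have hnd : (L.blank :: l).Nodup := List.nodup_cons.2 ⟨blank_notMem hcyc, hcyc.nodup⟩
          rcases ws with _ | ⟨b, ws⟩
          · obtain ⟨-, rfl⟩ : L.blank = w ∧ l = L.blank :: rest := by simpa using hl
            simp
          · obtain ⟨-, rfl⟩ : L.blank = b ∧ l = ws ++ w :: L.blank :: rest := by simpa using hl
            simp
        · exact h
      simpa using hcyc.head a ha
  -- `t` collects the silent steps since the last run of the body
  have hloop : ∀ rest ws σ t, l = ws ++ rest → J ws σ → L.es.map σ.reg = rest.headD L.blank →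
      σ.reg (2 * L.m + 6) = (if rest = [] then Word.sym 0 else Word.sym 1) →
      Quiet t → t.length + 1 ≤ L.gap →
      ∃ tr σ', Exec g (.loop (.eq (2 * L.m + 6) (L.m + 1)) (.seq P (L.advance L.es))) σ tr σ' ∧
        Seg L.gap T rest (t ++ tr) ∧ J l σ' := by
    intro rest
    induction rest with
    | nil =>
      intro ws σ t hl hσ hes hfl ht htl
      obtain ⟨-, -, -, ho⟩ := hJ _ _ hσ
      refine ⟨[none], σ, Exec.loop_done ?_, Seg.nil (ht.append (by simp [Quiet])) (by simpa), ?_⟩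
      · simp [Cond.holds, hfl, ho]
      · rw [hl]; simpa using hσ
    | cons w rest ih =>
      intro ws σ t hl hσ hes hfl ht htl
      obtain ⟨-, -, -, ho⟩ := hJ _ _ hσ
      obtain ⟨tr₁, σ₁, x1, hT, hσ₁, hes₁⟩ := hbody ws w rest hl σ hσ (by simpa using hes)
      obtain ⟨f, e1, e2, e3, e4⟩ := hadv (L.blank :: ws) w rest (by simp [hl]) L.es hL.es_lt σ₁
        _ hσ₁ hes₁
      obtain ⟨tr₂, x2, hlen, hq⟩ := (L.straight_advance (V := V) L.es).exec g σ₁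
      rw [e1] at x2
      obtain ⟨tr₃, σ', x3, hseg, hσ'⟩ := ih (ws ++ [w]) _ tr₂ (by simp [hl]) e2 e3 e4 hq (by
        rw [cost_advance] at hlen
        unfold gap; omega)
      refine ⟨none :: ((tr₁ ++ tr₂) ++ tr₃), σ', Exec.loop_step ?_ (Exec.seq x1 x2) x3, ?_, hσ'⟩
      · simp [Cond.holds, hfl, ho]
      · have := Seg.cons (ht.append (tr' := [none]) (by simp [Quiet])) (by simpa) hT hseg
        simpa using this
  obtain ⟨-, -, hz, -⟩ := hJ _ _ h
  obtain ⟨f, e1, e2, e3, e4⟩ := hadv [] L.blank l rfl L.zs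
    (fun r hr => by have := List.eq_of_mem_replicate hr; omega) σ [] h
    (by simp [zs, blank, hz])
  obtain ⟨tr₂, x2, hlen, hq⟩ := (L.straight_advance (V := V) L.zs).exec g σ
  rw [e1] at x2
  obtain ⟨tr₃, σ', x3, hseg, hσ'⟩ := hloop l [] _ tr₂ rfl e2 e3 e4 hq (by
    rw [cost_advance] at hlen
    unfold gap; omega)
  exact ⟨_, σ', Exec.seq x2 x3, hseg, hσ'⟩

end Lst

/-! ### The tables of the view tree -/

section Keys

variable {Q : Query} {A : Type u}

/-- The key of a valuation by words on the schema `S`, with blanks outside of `S`. -/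
def kw (S : Finset (Fin Q.m)) (v : Fin Q.m → Word A) : List (Word A) :=
  List.ofFn fun x => if x ∈ S then v x else Word.sym 0

/-- The registers that hold the key on `S` of the current valuation. -/
def keyRegs (S : Finset (Fin Q.m)) : List ℕ :=
  List.ofFn fun x : Fin Q.m => if x ∈ S then (x : ℕ) else Q.m

/-- `v` and `v'` have the same restriction to `S`. -/
def Agree (S : Finset (Fin Q.m)) (v v' : Fin Q.m → Word A) : Prop := ∀ x ∈ S, v x = v' x

theorem Agree.symm {S : Finset (Fin Q.m)} {v v' : Fin Q.m → Word A} (h : Agree S v v') :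
    Agree S v' v := fun x hx => (h x hx).symm

theorem Agree.trans {S : Finset (Fin Q.m)} {v v' v'' : Fin Q.m → Word A} (h : Agree S v v')
    (h' : Agree S v' v'') : Agree S v v'' := fun x hx => (h x hx).trans (h' x hx)

theorem Agree.mono {S T : Finset (Fin Q.m)} {v v' : Fin Q.m → Word A} (h : Agree S v v')
    (hT : T ⊆ S) : Agree T v v' := fun x hx => h x (hT hx)

theorem agree_refl (S : Finset (Fin Q.m)) (v : Fin Q.m → Word A) : Agree S v v := fun _ _ => rfl

theorem agree_update {S : Finset (Fin Q.m)} {x : Fin Q.m} (hx : x ∉ S) (v : Fin Q.m → Word A)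
    (a : Word A) : Agree S (Function.update v x a) v := fun y hy =>
  Function.update_of_ne (by rintro rfl; exact hx hy) _ _

theorem kw_eq_iff {S : Finset (Fin Q.m)} {v v' : Fin Q.m → Word A} :
    kw S v = kw S v' ↔ Agree S v v' := by
  rw [kw, kw, List.ofFn_inj, funext_iff]
  refine forall_congr' fun x => ?_
  by_cases hx : x ∈ S <;> simp [hx]

theorem kw_length (S : Finset (Fin Q.m)) (v : Fin Q.m → Word A) : (kw S v).length = Q.m := by
  simp [kw]

/-- The valuation held in the registers. -/
def valOf (f : ℕ → Word A) (x : Fin Q.m) : Word A := f x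

theorem keyRegs_map (S : Finset (Fin Q.m)) (f : ℕ → Word A) (hz : f Q.m = Word.sym 0) :
    (keyRegs S).map f = kw S (valOf f) := by
  rw [keyRegs, kw, List.map_ofFn]
  congr 1
  funext x
  by_cases hx : x ∈ S <;> simp [hx, hz, valOf]

theorem keyRegs_le {S : Finset (Fin Q.m)} {r : ℕ} (h : r ∈ keyRegs S) : r ≤ Q.m := by
  rw [keyRegs, List.mem_ofFn] at h
  obtain ⟨x, rfl⟩ := h
  split_ifs <;> omega

end Keys

/-- The hash map of a view. -/
def table {Q : Query} : View Q → ℕ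
  | .rel i => 3 * i
  | .H x => 3 * x + 1
  | .V x => 3 * x + 2

theorem table_injective {Q : Query} : Function.Injective (table (Q := Q)) := by
  rintro (i | x | x) (j | y | y) h <;> simp only [table] at h <;> first
    | omega
    | (congr 1; exact Fin.ext (by omega))

namespace VarOrder

variable {Q : Query} (ω : VarOrder Q)

/-- The schema of the view `H@x`. -/
def scope (x : Fin Q.m) : Finset (Fin Q.m) := insert x (ω.dep x)

/-- The schema of a view. -/
def schema : View Q → Finset (Fin Q.m)
  | .rel i => Q.sch i
  | .H x => ω.scope x
  | .V x => ω.dep x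

/-- The children of a variable; the roots are the children of the virtual node `none`. -/
def children (o : Option (Fin Q.m)) : Finset (Fin Q.m) :=
  Finset.univ.filter fun y => ω.parent y = o

/-- The relations that hang under a variable; those with empty schema hang under `none`. -/
def relsUnder : Option (Fin Q.m) → Finset (Fin Q.n)
  | none => Finset.univ.filter fun i => Q.sch i = ∅
  | some x => ω.relsAt x

/-- The views whose join is `H@x`. -/
def childViews (x : Fin Q.m) : List (View Q) :=
  (ω.relsAt x).toList.map View.rel ++ (ω.children (some x)).toList.map View.V

/-- The child views of a node without the views of its free children. -/
def boundViews (o : Option (Fin Q.m)) : List (View Q) :=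
  (ω.relsUnder o).toList.map View.rel ++
    ((ω.children o).filter (· ∉ Q.free)).toList.map View.V

/-- The free children of a node. -/
def freeChildren (o : Option (Fin Q.m)) : List (Fin Q.m) :=
  ((ω.children o).filter (· ∈ Q.free)).toList

/-- The index of `x`: for every tuple over `dep x`, the list of the values of `x` that extend it to
an active tuple, see `Active`. -/
def idx (x : Fin Q.m) : Lst := ⟨Q.m, x, keyRegs (ω.dep x), [x]⟩

theorem mem_dep {x y : Fin Q.m} : y ∈ ω.dep x ↔ ω.Anc y x ∧
    ∃ z, (z = x ∨ ω.Anc x z) ∧ ∃ i, y ∈ Q.sch i ∧ z ∈ Q.sch i := by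
  simp [dep]

theorem self_notMem_dep (x : Fin Q.m) : x ∉ ω.dep x := fun h =>
  ω.anc_irrefl x (ω.mem_dep.1 h).1

theorem dep_subset_scope (x : Fin Q.m) : ω.dep x ⊆ ω.scope x := Finset.subset_insert _ _

theorem self_mem_scope (x : Fin Q.m) : x ∈ ω.scope x := Finset.mem_insert_self _ _

theorem mem_relsAt {x : Fin Q.m} {i : Fin Q.n} :
    i ∈ ω.relsAt x ↔ x ∈ Q.sch i ∧ ∀ y ∈ Q.sch i, y = x ∨ ω.Anc y x := by
  simp [relsAt]

theorem sch_subset_scope {x : Fin Q.m} {i : Fin Q.n} (h : i ∈ ω.relsAt x) :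
    Q.sch i ⊆ ω.scope x := by
  obtain ⟨hx, h⟩ := ω.mem_relsAt.1 h
  intro y hy
  rcases h y hy with rfl | h
  · exact ω.self_mem_scope y
  · exact Finset.mem_insert_of_mem (ω.mem_dep.2 ⟨h, x, Or.inl rfl, i, hy, hx⟩)

theorem dep_subset_scope_parent {x p : Fin Q.m} (h : ω.parent x = some p) :
    ω.dep x ⊆ ω.scope p := by
  intro z hz
  obtain ⟨hzx, y, hy, i, hi⟩ := ω.mem_dep.1 hz
  rcases (ω.anc_iff h z).1 hzx with rfl | hzp
  · exact ω.self_mem_scope z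
  · refine Finset.mem_insert_of_mem (ω.mem_dep.2 ⟨hzp, y, Or.inr ?_, i, hi⟩)
    rcases hy with rfl | hy
    · exact ω.anc_of_parent h
    · exact Anc.trans ω (ω.anc_of_parent h) hy

theorem dep_eq_empty {x : Fin Q.m} (h : ω.parent x = none) : ω.dep x = ∅ :=
  Finset.eq_empty_of_forall_notMem fun y hy => ω.not_anc_of_root h y (ω.mem_dep.1 hy).1

theorem mem_scope {x y : Fin Q.m} (h : y ∈ ω.scope x) : y = x ∨ ω.Anc y x :=
  (Finset.mem_insert.1 h).imp id fun h => (ω.mem_dep.1 h).1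

/-- A nonempty schema is a chain, so it has a lowest variable. -/
theorem exists_mem_relsUnder (i : Fin Q.n) : ∃ o, i ∈ ω.relsUnder o := by
  rcases (Q.sch i).eq_empty_or_nonempty with h | h
  · exact ⟨none, by simp [relsUnder, h]⟩
  · have hwf : WellFounded fun y x => ω.Anc x y := by
      have : IsTrans (Fin Q.m) fun y x => ω.Anc x y :=
        ⟨fun _ _ _ h h' => Relation.TransGen.trans h' h⟩
      have : Std.Irrefl fun y x => ω.Anc x y := ⟨ω.anc_irrefl⟩
      exact Finite.wellFounded_of_trans_of_irrefl _
    obtain ⟨x, hx, hmin⟩ := hwf.has_min {x | x ∈ Q.sch i} h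
    refine ⟨some x, ω.mem_relsAt.2 ⟨hx, fun y hy => ?_⟩⟩
    rcases ω.path i x hx y hy with h | h | h
    · exact Or.inl h.symm
    · exact absurd h (hmin y hy)
    · exact Or.inr h

theorem mem_children {o : Option (Fin Q.m)} {y : Fin Q.m} : y ∈ ω.children o ↔ ω.parent y = o := by
  simp [children]

theorem schema_subset_scope {x : Fin Q.m} {w : View Q} (h : w ∈ ω.childViews x) :
    ω.schema w ⊆ ω.scope x := by
  simp only [childViews, List.mem_append, List.mem_map, Finset.mem_toList] at h
  rcases h with ⟨i, hi, rfl⟩ | ⟨y, hy, rfl⟩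
  · exact ω.sch_subset_scope hi
  · exact ω.dep_subset_scope_parent (ω.mem_children.1 hy)

theorem mem_boundViews {o : Option (Fin Q.m)} {w : View Q} : w ∈ ω.boundViews o ↔
    (∃ i ∈ ω.relsUnder o, View.rel i = w) ∨ ∃ y, ω.parent y = o ∧ y ∉ Q.free ∧ View.V y = w := by
  simp [boundViews, mem_children, and_assoc]

theorem mem_freeChildren {o : Option (Fin Q.m)} {y : Fin Q.m} :
    y ∈ ω.freeChildren o ↔ ω.parent y = o ∧ y ∈ Q.free := by
  simp [freeChildren, mem_children]

theorem mem_childViews {x : Fin Q.m} {w : View Q} : w ∈ ω.childViews x ↔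
    (∃ i ∈ ω.relsAt x, View.rel i = w) ∨ ∃ y, ω.parent y = some x ∧ View.V y = w := by
  simp [childViews, mem_children]

theorem boundViews_subset {x : Fin Q.m} {w : View Q} (h : w ∈ ω.boundViews (some x)) :
    w ∈ ω.childViews x := by
  rw [mem_boundViews] at h
  rw [mem_childViews]
  exact h.imp id fun ⟨y, h1, _, h2⟩ => ⟨y, h1, h2⟩

theorem idx_wf (x : Fin Q.m) : (ω.idx x).WF where
  kc_lt r hr := by have := keyRegs_le hr; simp only [idx]; omega
  es_lt r hr := by simp only [idx, List.mem_singleton] at hr ⊢; omega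
  nodup := by simp [idx]
  zero := by simp only [idx, List.mem_singleton]; omega

variable {A : Type u} {D : Type v} [CommRing D] (g : Fin Q.m → A → D)

/-- The entry of the view `w` for the valuation `v` in the hash maps `P`. -/
def tbl (P : ℕ → List (Word A) → D) (w : View Q) (v : Fin Q.m → Word A) : D :=
  P (table w) (kw (ω.schema w) v)

/-- The value `v x` is in the index of `x`. -/
def Listed (F : ℕ → List (Word A) → Word A) (x : Fin Q.m) (v : Fin Q.m → Word A) : Prop :=
  F (ω.idx x).dm (kw (ω.dep x) v ++ [v x]) = Word.sym 1

/-- The relations and the views of bound variables below the node `o` are nonzero at `v`, and the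
indexes of its free children are nonempty. Unlike the payload of `H@x`, this is not affected by
cancellations among the values of free variables. The zero ring is excluded, so that over it nothing
is active even if there are no views to test. -/
def Active (P : ℕ → List (Word A) → D) (F : ℕ → List (Word A) → Word A) (o : Option (Fin Q.m))
    (v : Fin Q.m → Word A) : Prop :=
  (1 : D) ≠ 0 ∧ (∀ w ∈ ω.boundViews o, ω.tbl P w v ≠ 0) ∧
    ∀ y ∈ ω.freeChildren o, ∃ a, ω.Listed F y (Function.update v y a)

/-- The factor of the value `a` of `x` in the marginalization of `x`. -/
def wordWeight (Q : Query) (g : Fin Q.m → A → D) (x : Fin Q.m) (a : Word A) : D :=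
  if x ∈ Q.free then 1 else liftWord g x a

/-- The entries of `H@x` and of the index of `x` at `v` are up to date with the views below. -/
def Fresh (P : ℕ → List (Word A) → D) (F : ℕ → List (Word A) → Word A) (x : Fin Q.m)
    (v : Fin Q.m → Word A) : Prop :=
  ω.tbl P (.H x) v = ((ω.childViews x).map fun w => ω.tbl P w v).prod ∧
    (ω.Listed F x v ↔ v x ≠ Word.sym 0 ∧ ω.Active P F (some x) v)

/-- The indexes are well-formed, and `V@x` is `H@x` with `x` marginalized. The machine keeps this
true at all times, whereas `Fresh` may fail for a while at the entries still to be refreshed. -/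
structure Sound (P : ℕ → List (Word A) → D) (F : ℕ → List (Word A) → Word A) : Prop where
  cycle : ∀ x, ∀ c : List (Word A), c.length = Q.m → ∃ l, (ω.idx x).IsCycle F c l
  finite : ∀ x v, {a | ω.tbl P (.H x) (Function.update v x a) ≠ 0}.Finite
  sum : ∀ x v, ω.tbl P (.V x) v =
    ∑ᶠ a, ω.tbl P (.H x) (Function.update v x a) * wordWeight Q g x a

/-- The tables after a change that affects, of the views and indexes of variables, only those of
`x` at `v`. -/
structure Change (x : Fin Q.m) (v : Fin Q.m → Word A) (P : ℕ → List (Word A) → D)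
    (F : ℕ → List (Word A) → Word A) (P' : ℕ → List (Word A) → D)
    (F' : ℕ → List (Word A) → Word A) : Prop where
  rel : ∀ i v', ω.tbl P' (.rel i) v' = ω.tbl P (.rel i) v'
  H : ∀ y v', (y = x → ¬ Agree (ω.scope x) v' v) → ω.tbl P' (.H y) v' = ω.tbl P (.H y) v'
  V : ∀ y v', (y = x → ¬ Agree (ω.dep x) v' v) → ω.tbl P' (.V y) v' = ω.tbl P (.V y) v'
  listed : ∀ y v', (y = x → ¬ Agree (ω.scope x) v' v) → (ω.Listed F' y v' ↔ ω.Listed F y v')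
  other : ∀ d, Q.m ≤ d.unpair.1 → F' d = F d

variable {ω} {P P' : ℕ → List (Word A) → D} {F F' : ℕ → List (Word A) → Word A}

omit [CommRing D] in
theorem tbl_congr {w : View Q} {v v' : Fin Q.m → Word A} (h : Agree (ω.schema w) v v') :
    ω.tbl P w v = ω.tbl P w v' := by
  rw [tbl, tbl, kw_eq_iff.2 h]

theorem listed_congr {x : Fin Q.m} {v v' : Fin Q.m → Word A} (h : Agree (ω.scope x) v v') :
    ω.Listed F x v ↔ ω.Listed F x v' := by
  rw [Listed, Listed, kw_eq_iff.2 (h.mono (ω.dep_subset_scope x)), h x (ω.self_mem_scope x)]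

theorem agree_scope_update {x : Fin Q.m} {v v' : Fin Q.m → Word A} (h : Agree (ω.dep x) v v')
    (a : Word A) : Agree (ω.scope x) (Function.update v x a) (Function.update v' x a) := by
  intro y hy
  by_cases hyx : y = x
  · subst hyx; simp
  · simp only [Function.update_of_ne hyx]
    exact h y ((Finset.mem_insert.1 hy).resolve_left hyx)

theorem agree_scope_update_iff {x : Fin Q.m} {v v' : Fin Q.m → Word A} {a : Word A} :
    Agree (ω.scope x) (Function.update v' x a) v ↔ Agree (ω.dep x) v' v ∧ a = v x := by
  constructor
  · intro h
    refine ⟨fun y hy => ?_, by simpa using h x (ω.self_mem_scope x)⟩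
    have := h y (ω.dep_subset_scope x hy)
    rwa [Function.update_of_ne] at this
    exact fun e => ω.self_notMem_dep x (e ▸ hy)
  · rintro ⟨h, rfl⟩
    have := agree_scope_update h (v x)
    rwa [Function.update_eq_self] at this

theorem active_congr {x : Fin Q.m} {v v' : Fin Q.m → Word A} (h : Agree (ω.scope x) v v') :
    ω.Active P F (some x) v → ω.Active P F (some x) v' := by
  rintro ⟨h0, h1, h2⟩
  refine ⟨h0, fun w hw => ?_, fun y hy => ?_⟩
  · rw [← tbl_congr (h.mono (ω.schema_subset_scope (ω.boundViews_subset hw)))]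
    exact h1 w hw
  · obtain ⟨a, ha⟩ := h2 y hy
    have := ω.dep_subset_scope_parent (ω.mem_freeChildren.1 hy).1
    exact ⟨a, (listed_congr (agree_scope_update (h.mono this) a)).1 ha⟩

theorem Fresh.congr {x : Fin Q.m} {v v' : Fin Q.m → Word A} (hf : ω.Fresh P F x v)
    (h : Agree (ω.scope x) v v') : ω.Fresh P F x v' := by
  refine ⟨?_, ?_⟩
  · rw [← tbl_congr (w := .H x) h, hf.1]
    exact congrArg List.prod (List.map_congr_left fun w hw =>
      tbl_congr (h.mono (ω.schema_subset_scope hw)))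
  · rw [← listed_congr h, hf.2, h x (ω.self_mem_scope x)]
    exact and_congr_right fun _ => ⟨active_congr h, active_congr h.symm⟩

theorem ne_of_parent {x y : Fin Q.m} (h : ω.parent y = some x) : y ≠ x := by
  rintro rfl
  exact ω.anc_irrefl y (ω.anc_of_parent h)

omit [CommRing D] in
theorem Change.tbl_childViews {x : Fin Q.m} {v : Fin Q.m → Word A} (hc : ω.Change x v P F P' F')
    {y : Fin Q.m} {v' : Fin Q.m → Word A} (hp : ω.parent x = some y → ¬ Agree (ω.dep x) v' v)
    {w : View Q} (hw : w ∈ ω.childViews y) : ω.tbl P' w v' = ω.tbl P w v' := by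
  rcases ω.mem_childViews.1 hw with ⟨i, -, rfl⟩ | ⟨z, hz, rfl⟩
  · exact hc.rel i v'
  · exact hc.V z v' fun e => hp (e ▸ hz)

theorem Change.active_iff {x : Fin Q.m} {v : Fin Q.m → Word A} (hc : ω.Change x v P F P' F')
    {y : Fin Q.m} {v' : Fin Q.m → Word A} (hp : ω.parent x = some y → ¬ Agree (ω.dep x) v' v) :
    ω.Active P' F' (some y) v' ↔ ω.Active P F (some y) v' := by
  refine and_congr_right fun _ => and_congr (forall₂_congr fun w hw => ?_)
    (forall₂_congr fun z hz => exists_congr fun a => ?_)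
  · rw [hc.tbl_childViews hp (ω.boundViews_subset hw)]
  · refine hc.listed z _ ?_
    rintro rfl h
    exact hp (ω.mem_freeChildren.1 hz).1 (agree_scope_update_iff.1 h).1

/-- Freshness can get lost only at `x` itself and at the parent of `x`. -/
theorem Change.fresh {x : Fin Q.m} {v : Fin Q.m → Word A} (hc : ω.Change x v P F P' F')
    {y : Fin Q.m} {v' : Fin Q.m → Word A} (hf : ω.Fresh P F y v')
    (hx : y = x → ¬ Agree (ω.scope x) v' v)
    (hp : ω.parent x = some y → ¬ Agree (ω.dep x) v' v) : ω.Fresh P' F' y v' := by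
  refine ⟨?_, ?_⟩
  · rw [hc.H y v' hx, hf.1]
    exact congrArg List.prod (List.map_congr_left fun w hw => (hc.tbl_childViews hp hw).symm)
  · rw [hc.listed y v' hx, hf.2, hc.active_iff hp]

theorem finsum_update {α R : Type*} [Ring R] (f : α → R) (a : α) (b : R)
    (hf : (Function.support f).Finite) :
    ∑ᶠ x, Function.update f a b x = ∑ᶠ x, f x + (b - f a) := by
  have h : ∀ x, Function.update f a b x = f x + (Pi.single a (b - f a) : α → R) x := by
    intro x
    by_cases hx : x = a
    · subst hx; simp
    · simp [hx]
  rw [finsum_congr h, finsum_add_distrib hf, finsum_eq_single (Pi.single a (b - f a)) a]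
  · rw [Pi.single_eq_same]
  · intro x hx; simp [hx]
  · exact (Set.finite_singleton a).subset (Pi.support_single_subset)

/-- Adding to `V@x` the weighted change of one entry of `H@x` keeps `V@x` the marginalization of
`H@x`. -/
theorem Change.sound {x : Fin Q.m} {v : Fin Q.m → Word A} (hc : ω.Change x v P F P' F')
    (hs : ω.Sound g P F)
    (hcyc : ∀ y, ∀ c : List (Word A), c.length = Q.m → ∃ l, (ω.idx y).IsCycle F' c l)
    (hV : ω.tbl P' (.V x) v = ω.tbl P (.V x) v +
      (ω.tbl P' (.H x) v - ω.tbl P (.H x) v) * wordWeight Q g x (v x)) : ω.Sound g P' F' := by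
  have hu : ∀ v', Agree (ω.dep x) v' v →
      (fun a => ω.tbl P' (.H x) (Function.update v' x a)) =
        Function.update (fun a => ω.tbl P (.H x) (Function.update v' x a)) (v x)
          (ω.tbl P' (.H x) v) := by
    intro v' h
    funext a
    by_cases ha : a = v x
    · subst ha
      rw [Function.update_self]
      exact tbl_congr (agree_scope_update_iff.2 ⟨h, rfl⟩)
    · rw [Function.update_of_ne ha]
      exact hc.H x _ fun _ h => ha (agree_scope_update_iff.1 h).2
  have hn : ∀ y v', (y = x → ¬ Agree (ω.dep x) v' v) → ∀ a,
      ω.tbl P' (.H y) (Function.update v' y a) = ω.tbl P (.H y) (Function.update v' y a) := by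
    intro y v' h a
    refine hc.H y _ ?_
    rintro rfl h'
    exact h rfl (agree_scope_update_iff.1 h').1
  refine ⟨hcyc, fun y v' => ?_, fun y v' => ?_⟩
  · by_cases h : y = x → ¬ Agree (ω.dep x) v' v
    · simpa only [hn y v' h] using hs.finite y v'
    · obtain ⟨rfl, h⟩ := Classical.not_imp.1 h
      have h' := not_not.1 h
      refine ((hs.finite y v').insert (v y)).subset fun a ha => ?_
      by_cases e : a = v y
      · exact Or.inl e
      · refine Or.inr ?_
        have := congrFun (hu v' h') a
        simp only [Set.mem_ofPred_eq] at ha ⊢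
        rw [this, Function.update_of_ne e] at ha
        exact ha
  · by_cases h : y = x → ¬ Agree (ω.dep x) v' v
    · rw [hc.V y v' h, hs.sum y v']
      simp only [hn y v' h]
    · obtain ⟨rfl, h⟩ := Classical.not_imp.1 h
      have h' := not_not.1 h
      rw [tbl_congr (w := .V y) (v' := v) h', hV, tbl_congr (w := .V y) (v' := v') h'.symm,
        hs.sum y v']
      have he : ∀ a, ω.tbl P' (.H y) (Function.update v' y a) * wordWeight Q g y a =
          Function.update (fun a => ω.tbl P (.H y) (Function.update v' y a) * wordWeight Q g y a)
            (v y) (ω.tbl P' (.H y) v * wordWeight Q g y (v y)) a := by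
        intro a
        rw [congrFun (hu v' h') a]
        by_cases e : a = v y
        · subst e; simp
        · simp [e]
      rw [finsum_congr he, finsum_update]
      · rw [tbl_congr (w := .H y) (agree_scope_update_iff.2 ⟨h', rfl⟩), sub_mul]
      · exact (hs.finite y v').subset fun a ha h => ha (by
          simp only [h, zero_mul])

end VarOrder

namespace VarOrder

variable {Q : Query} (ω : VarOrder Q)

/-! ### Refreshing one entry of a view -/

/-- Load the entry of the view `w` for the current valuation. -/
def loadView (p : ℕ) (w : View Q) : Prog (Fin Q.m) :=
  .instr (.pload p (table w) (keyRegs (ω.schema w)))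

/-- Compute the product of the entries of the views `l` for the current valuation. -/
def mulViews (l : List (View Q)) : Prog (Fin Q.m) :=
  .seq (.instr (.pone 0)) (seqs (l.map fun w => .seq (ω.loadView 1 w) (.instr (.pmul 0 0 1))))

/-- Set register `2 * m + 4` to `sym 0` if the condition holds. -/
def failIf (c : Cond) : Prog (Fin Q.m) := .ite c (.instr (.const (2 * Q.m + 4) 0)) .skip

/-- Set register `2 * m + 4` to `sym 1` if the node `o` is active, and to `sym 0` otherwise. -/
def testActive (o : Option (Fin Q.m)) : Prog (Fin Q.m) :=
  .seq (.instr (.const (2 * Q.m + 4) 1)) (seqs (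
    .seq (.instr (.pone 1)) (failIf (.isZero 1)) ::
    ((ω.boundViews o).map fun w => .seq (ω.loadView 1 w) (failIf (.isZero 1))) ++
    (ω.freeChildren o).map fun y : Fin Q.m =>
      .seq (.instr (.load (2 * Q.m + 5) (Nat.pair y 1) (keyRegs (ω.dep y) ++ [Q.m])))
        (failIf (.eq (2 * Q.m + 5) Q.m))))

/-- Recompute the entry of `H@x` for the current valuation, and adjust `V@x` by the weighted
difference to the old entry, and the index of `x` by the activity of the tuple. -/
def refresh (x : Fin Q.m) : Prog (Fin Q.m) := seqs [
  ω.mulViews (ω.childViews x),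
  ω.loadView 1 (.H x),
  .instr (.pneg 1 1),
  .instr (.padd 1 0 1),
  .instr (.pstore (table (.H x)) (keyRegs (ω.scope x)) 0),
  if x ∈ Q.free then .skip else .seq (.instr (.lift 2 x x)) (.instr (.pmul 1 1 2)),
  ω.loadView 2 (.V x),
  .instr (.padd 2 2 1),
  .instr (.pstore (table (.V x)) (keyRegs (ω.dep x)) 2),
  ω.testActive (some x),
  failIf (.eq x Q.m),
  (ω.idx x).set]

theorem straight_mulViews (l : List (View Q)) : (ω.mulViews l).Straight := by
  simp [mulViews, straight_seqs, Prog.Straight, loadView]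

theorem straight_failIf (c : Cond) : (failIf c : Prog (Fin Q.m)).Straight := by
  simp [failIf, Prog.Straight]

theorem straight_testActive (o : Option (Fin Q.m)) : (ω.testActive o).Straight := by
  refine ⟨trivial, straight_seqs.2 ?_⟩
  intro P hP
  simp only [List.cons_append, List.mem_cons, List.mem_append, List.mem_map] at hP
  rcases hP with rfl | ⟨w, -, rfl⟩ | ⟨y, -, rfl⟩ <;> exact ⟨trivial, straight_failIf _⟩

theorem straight_refresh (x : Fin Q.m) : (ω.refresh x).Straight := by
  rw [refresh, straight_seqs]
  have h : (if x ∈ Q.free then .skip else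
      .seq (.instr (.lift 2 x x)) (.instr (.pmul 1 1 2)) : Prog (Fin Q.m)).Straight := by
    split_ifs <;> simp [Prog.Straight]
  simp [straight_mulViews, straight_testActive, straight_failIf, Lst.straight_set, h, loadView,
    Prog.Straight]

variable {A : Type u} {D : Type v} [CommRing D] (g : Fin Q.m → A → D)

theorem eval_mulViews (l : List (View Q)) (σ : State A D) (hz : σ.reg Q.m = Word.sym 0) :
    ∃ a, (ω.mulViews l).eval g σ = { σ with acc := a } ∧
      a 0 = (l.map fun w => ω.tbl σ.pdict w (valOf σ.reg)).prod ∧ ∀ p, 2 ≤ p → a p = σ.acc p := by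
  have key : ∀ (l : List (View Q)) (b : ℕ → D), ∃ a,
      (seqs (l.map fun w => Prog.seq (ω.loadView 1 w) (.instr (.pmul 0 0 1)))).eval g
        { σ with acc := b } = { σ with acc := a } ∧
      a 0 = b 0 * (l.map fun w => ω.tbl σ.pdict w (valOf σ.reg)).prod ∧
      ∀ p, 2 ≤ p → a p = b p := by
    intro l
    induction l with
    | nil => exact fun b => ⟨b, rfl, by simp, fun _ _ => rfl⟩
    | cons w l ih =>
      intro b
      set b₁ : ℕ → D := Function.update b 1 (ω.tbl σ.pdict w (valOf σ.reg)) with hb₁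
      obtain ⟨a, h1, h2, h3⟩ := ih (Function.update b₁ 0 (b₁ 0 * b₁ 1))
      refine ⟨a, ?_, ?_, fun p hp => ?_⟩
      · rw [← h1]
        simp only [List.map_cons, seqs, Prog.eval, loadView, Instr.step, keyRegs_map _ _ hz]
        rfl
      · rw [h2, List.map_cons, List.prod_cons, ← mul_assoc]
        simp [b₁]
      · rw [h3 p hp]
        simp [b₁, Function.update_of_ne (show p ≠ 0 by omega),
          Function.update_of_ne (show p ≠ 1 by omega)]
  obtain ⟨a, h1, h2, h3⟩ := key l (Function.update σ.acc 0 1)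
  refine ⟨a, ?_, ?_, fun p hp => ?_⟩
  · rw [← h1]; rfl
  · rw [h2]; simp
  · rw [h3 p hp, Function.update_of_ne (by omega)]

theorem exists_listed_iff {F : ℕ → List (Word A) → Word A} {y : Fin Q.m} {v : Fin Q.m → Word A}
    {l : List (List (Word A))} (h : (ω.idx y).IsCycle F (kw (ω.dep y) v) l) (a : Word A) :
    ω.Listed F y (Function.update v y a) ↔ [a] ∈ l := by
  have h1 : kw (ω.dep y) (Function.update v y a) = kw (ω.dep y) v :=
    kw_eq_iff.2 (agree_update (ω.self_notMem_dep y) v a)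
  rw [Listed, h1, Function.update_self, h.mark [a] rfl]
  split_ifs with h <;> simp [h]

/-- The successor of the sentinel is the sentinel iff the list is empty. -/
theorem head_eq_zero_iff {F : ℕ → List (Word A) → Word A} {y : Fin Q.m} {v : Fin Q.m → Word A}
    {l : List (List (Word A))} (h : (ω.idx y).IsCycle F (kw (ω.dep y) v) l) :
    F (Nat.pair y 1) (kw (ω.dep y) v ++ [Word.sym 0]) = Word.sym 0 ↔
      ¬ ∃ a, ω.Listed F y (Function.update v y a) := by
  simp only [ω.exists_listed_iff h]
  have hf : [F (Nat.pair y 1) (kw (ω.dep y) v ++ [Word.sym 0])] = l.headD [Word.sym 0] :=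
    h.next.first
  rcases l with _ | ⟨w, l⟩
  · simp only [List.headD_nil, List.cons.injEq, and_true] at hf
    simp [hf]
  · have hw := h.head w (by simp)
    simp only [List.headD_cons] at hf
    subst hf
    refine ⟨fun e => absurd e (by simpa using hw), fun e => absurd ⟨_, List.mem_cons_self⟩ e⟩

theorem eval_testActive (o : Option (Fin Q.m)) (σ : State A D) (hz : σ.reg Q.m = Word.sym 0)
    (hs : ω.Sound g σ.pdict σ.dict) :
    ∃ f a, (ω.testActive o).eval g σ = { σ with reg := f, acc := a } ∧
      f (2 * Q.m + 4) = (if ω.Active σ.pdict σ.dict o (valOf σ.reg) then Word.sym 1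
        else Word.sym 0) ∧ ∀ r < 2 * Q.m + 4, f r = σ.reg r := by
  -- a sequence of tests, each paired with the condition that it tests
  have key : ∀ (l : List (Prog (Fin Q.m) × Prop)),
      (∀ c ∈ l, ∀ f a, (∀ r < 2 * Q.m + 4, f r = σ.reg r) → ∃ f' a',
        c.1.eval g { σ with reg := f, acc := a } = { σ with reg := f', acc := a' } ∧
        (∀ r < 2 * Q.m + 4, f' r = σ.reg r) ∧
        f' (2 * Q.m + 4) = if c.2 then f (2 * Q.m + 4) else Word.sym 0) →
      ∀ f a, (∀ r < 2 * Q.m + 4, f r = σ.reg r) → ∃ f' a',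
        (seqs (l.map Prod.fst)).eval g { σ with reg := f, acc := a } =
          { σ with reg := f', acc := a' } ∧
        (∀ r < 2 * Q.m + 4, f' r = σ.reg r) ∧
        f' (2 * Q.m + 4) = if ∀ c ∈ l, c.2 then f (2 * Q.m + 4) else Word.sym 0 := by
    intro l
    induction l with
    | nil => exact fun _ f a hf => ⟨f, a, rfl, hf, by simp⟩
    | cons c l ih =>
      intro hl f a hf
      obtain ⟨f₁, a₁, e1, h1, h1'⟩ := hl c (by simp) f a hf
      obtain ⟨f₂, a₂, e2, h2, h2'⟩ := ih (fun c hc => hl c (by simp [hc])) f₁ a₁ h1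
      refine ⟨f₂, a₂, ?_, h2, ?_⟩
      · rw [← e2, ← e1]; rfl
      · rw [h2', h1']
        by_cases hc : c.2 <;> simp [hc]
  have hfail : ∀ (c : Cond) (f : ℕ → Word A) (a : ℕ → D) (φ : Prop),
      (∀ r < 2 * Q.m + 4, f r = σ.reg r) →
      (c.holds { σ with reg := f, acc := a } ↔ ¬ φ) → ∃ f',
      (failIf c : Prog (Fin Q.m)).eval g { σ with reg := f, acc := a } =
        { σ with reg := f', acc := a } ∧
      (∀ r < 2 * Q.m + 4, f' r = σ.reg r) ∧
        f' (2 * Q.m + 4) = if φ then f (2 * Q.m + 4) else Word.sym 0 := by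
    intro c f a φ hf hφ
    by_cases h : φ
    · exact ⟨f, by simp [failIf, Prog.eval, hφ, h], hf, by simp [h]⟩
    · exact ⟨Function.update f (2 * Q.m + 4) (Word.sym 0),
        by simp [failIf, Prog.eval, hφ, h, Instr.step],
        fun r hr => by rw [Function.update_of_ne (by omega), hf r hr], by simp [h]⟩
  have hval : ∀ f : ℕ → Word A, (∀ r < 2 * Q.m + 4, f r = σ.reg r) →
      (valOf f : Fin Q.m → Word A) = valOf σ.reg := fun f hf => funext fun x => hf x (by omega)
  let l : List (Prog (Fin Q.m) × Prop) :=
    (.seq (.instr (.pone 1)) (failIf (.isZero 1)), (1 : D) ≠ 0) ::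
    ((ω.boundViews o).map fun w => (Prog.seq (ω.loadView 1 w) (failIf (.isZero 1)),
      ω.tbl σ.pdict w (valOf σ.reg) ≠ 0)) ++
    (ω.freeChildren o).map fun y : Fin Q.m =>
      (Prog.seq (.instr (.load (2 * Q.m + 5) (Nat.pair y 1) (keyRegs (ω.dep y) ++ [Q.m])))
        (failIf (.eq (2 * Q.m + 5) Q.m)),
        ∃ a, ω.Listed σ.dict y (Function.update (valOf σ.reg) y a))
  have hl : ω.testActive o = .seq (.instr (.const (2 * Q.m + 4) 1)) (seqs (l.map Prod.fst)) := by
    simp [testActive, l, Function.comp_def]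
  have hφ : (∀ c ∈ l, c.2) ↔ ω.Active σ.pdict σ.dict o (valOf σ.reg) := by
    simp [l, Active, or_imp, forall_and]
  obtain ⟨f, a, h1, h2, h3⟩ := key l (by
    intro c hc f a hf
    have hfz : f Q.m = Word.sym 0 := (hf _ (by omega)).trans hz
    simp only [l, List.cons_append, List.mem_cons, List.mem_append, List.mem_map] at hc
    rcases hc with rfl | ⟨w, hw, rfl⟩ | ⟨y, hy, rfl⟩
    · obtain ⟨f', e, h⟩ := hfail (.isZero 1) f (Function.update a 1 1) ((1 : D) ≠ 0) hf
        (by simp [Cond.holds])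
      exact ⟨f', _, e, h⟩
    · obtain ⟨f', e, h⟩ := hfail (.isZero 1) f
        (Function.update a 1 (σ.pdict (table w) ((keyRegs (ω.schema w)).map f)))
        (ω.tbl σ.pdict w (valOf σ.reg) ≠ 0) hf
        (by simp [Cond.holds, keyRegs_map _ _ hfz, hval f hf, tbl])
      exact ⟨f', _, e, h⟩
    · obtain ⟨l', hl'⟩ := hs.cycle y (kw (ω.dep y) (valOf σ.reg)) (kw_length _ _)
      set b := σ.dict (Nat.pair y 1) ((keyRegs (ω.dep y) ++ [Q.m]).map f) with hb
      have hb' : b = σ.dict (Nat.pair y 1) (kw (ω.dep y) (valOf σ.reg) ++ [Word.sym 0]) := by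
        rw [hb, List.map_append, keyRegs_map _ _ hfz, hval f hf]
        simp [hfz]
      obtain ⟨f', e, h, h'⟩ := hfail (.eq (2 * Q.m + 5) Q.m) (Function.update f (2 * Q.m + 5) b) a
        (∃ a, ω.Listed σ.dict y (Function.update (valOf σ.reg) y a))
        (fun r hr => by rw [Function.update_of_ne (by omega), hf r hr])
        (by
          rw [← ω.head_eq_zero_iff hl', ← hb']
          simp only [Cond.holds, Function.update_self]
          rw [Function.update_of_ne (by omega), hfz])
      refine ⟨f', a, e, h, ?_⟩
      rw [h', Function.update_of_ne (by omega)])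
    (Function.update σ.reg (2 * Q.m + 4) (Word.sym 1)) σ.acc
    (fun r hr => by rw [Function.update_of_ne (by omega)])
  refine ⟨f, a, ?_, ?_, h2⟩
  · rw [hl, ← h1]; rfl
  · rw [h3, Function.update_self]
    simp only [hφ]

variable {ω}

omit [CommRing D] in
/-- The frame conditions on payloads and on the index of `x` add up to a `Change`. -/
theorem change_of_frame {x : Fin Q.m} {v : Fin Q.m → Word A}
    {P P' : ℕ → List (Word A) → D} {F F' : ℕ → List (Word A) → Word A}
    (hrel : ∀ i v', ω.tbl P' (.rel i) v' = ω.tbl P (.rel i) v')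
    (hH : ∀ y v', (y = x → ¬ Agree (ω.scope x) v' v) → ω.tbl P' (.H y) v' = ω.tbl P (.H y) v')
    (hV : ∀ y v', (y = x → ¬ Agree (ω.dep x) v' v) → ω.tbl P' (.V y) v' = ω.tbl P (.V y) v')
    (hF : (ω.idx x).Frame F F' (kw (ω.dep x) v)) {l l' : List (List (Word A))}
    (hl : (ω.idx x).IsCycle F (kw (ω.dep x) v) l)
    (hl' : (ω.idx x).IsCycle F' (kw (ω.dep x) v) l')
    (hll : ∀ w, w ≠ [v x] → (w ∈ l' ↔ w ∈ l)) : ω.Change x v P F P' F' where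
  rel := hrel
  H := hH
  V := hV
  listed y v' h := by
    by_cases hy : y = x
    · subst hy
      by_cases hd : Agree (ω.dep y) v' v
      · have hne : v' y ≠ v y := fun e => h rfl fun z hz => by
          rcases Finset.mem_insert.1 hz with rfl | hz
          exacts [e, hd z hz]
        rw [Listed, Listed, kw_eq_iff.2 hd, hl.mark _ rfl, hl'.mark _ rfl]
        simp only [hll [v' y] (by simpa using hne)]
      · rw [Listed, Listed, hF.2 _ (by simp [kw_length]) fun e => hd (kw_eq_iff.1 e)]
    · rw [Listed, Listed, hF.1]
      simp only [idx, Lst.dm, Nat.unpair_pair]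
      exact fun e => hy (Fin.ext e)
  other d hd := hF.1 d (by simp only [idx]; omega)

/-- Refreshing an entry makes it fresh and changes only the views and the index of `x` at that
entry. -/
theorem refresh_spec (x : Fin Q.m) (σ : State A D) (hz : σ.reg Q.m = Word.sym 0)
    (ho : σ.reg (Q.m + 1) = Word.sym 1) (hs : ω.Sound g σ.pdict σ.dict) :
    ∃ f a P F, (ω.refresh x).eval g σ =
        { σ with reg := f, acc := a, pdict := P, dict := F } ∧
      (∀ r < 2 * Q.m + 4, f r = σ.reg r) ∧
      ω.Change x (valOf σ.reg) σ.pdict σ.dict P F ∧ ω.Sound g P F ∧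
      ω.Fresh P F x (valOf σ.reg) := by
  set v : Fin Q.m → Word A := valOf σ.reg with hv
  obtain ⟨a₁, e1, ha0, -⟩ := ω.eval_mulViews g (ω.childViews x) σ hz
  set h : D := ((ω.childViews x).map fun w => ω.tbl σ.pdict w v).prod with hh
  set nv : D := ω.tbl σ.pdict (.V x) v + (h - ω.tbl σ.pdict (.H x) v) * wordWeight Q g x (v x)
    with hnv
  set P : ℕ → List (Word A) → D := Function.update (Function.update σ.pdict (table (.H x))
    (Function.update (σ.pdict (table (.H x))) (kw (ω.scope x) v) h)) (table (.V x))
    (Function.update (σ.pdict (table (.V x))) (kw (ω.dep x) v) nv) with hP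
  have hHV : table (.V x : View Q) ≠ table (.H x) := fun e => by
    have := table_injective e; simp at this
  have htbl : ∀ w v', (w = .H x → ¬ Agree (ω.scope x) v' v) →
      (w = .V x → ¬ Agree (ω.dep x) v' v) → ω.tbl P w v' = ω.tbl σ.pdict w v' := by
    intro w v' h1 h2
    rw [tbl, tbl, hP]
    by_cases hw : w = .V x
    · subst hw
      rw [Function.update_self, Function.update_of_ne]
      exact fun e => h2 rfl (kw_eq_iff.1 e)
    · rw [Function.update_of_ne fun e => hw (table_injective e)]
      by_cases hw' : w = .H x
      · subst hw'
        rw [Function.update_self, Function.update_of_ne]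
        exact fun e => h1 rfl (kw_eq_iff.1 e)
      · rw [Function.update_of_ne fun e => hw' (table_injective e)]
  have htH : ω.tbl P (.H x) v = h := by
    rw [tbl, hP, Function.update_of_ne hHV.symm, Function.update_self]
    exact Function.update_self _ _ _
  have htV : ω.tbl P (.V x) v = nv := by
    rw [tbl, hP, Function.update_self]
    exact Function.update_self _ _ _
  have hrel : ∀ i v', ω.tbl P (.rel i) v' = ω.tbl σ.pdict (.rel i) v' := fun i v' =>
    htbl _ _ (by simp) (by simp)
  have hH : ∀ y v', (y = x → ¬ Agree (ω.scope x) v' v) →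
      ω.tbl P (.H y) v' = ω.tbl σ.pdict (.H y) v' := fun y v' h =>
    htbl _ _ (by simpa using h) (by simp)
  have hV : ∀ y v', (y = x → ¬ Agree (ω.dep x) v' v) →
      ω.tbl P (.V y) v' = ω.tbl σ.pdict (.V y) v' := fun y v' h =>
    htbl _ _ (by simp) (by simpa using h)
  obtain ⟨l, hl⟩ := hs.cycle x (kw (ω.dep x) v) (kw_length _ _)
  have hc₁ : ω.Change x v σ.pdict σ.dict P σ.dict :=
    change_of_frame hrel hH hV (.refl _ _) hl hl fun _ _ => Iff.rfl
  have hs₁ : ω.Sound g P σ.dict := hc₁.sound g hs hs.cycle (by rw [htV, htH])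
  have hpp : ∀ v', ω.parent x = some x → ¬ Agree (ω.dep x) v' v := fun _ e =>
    absurd rfl (ne_of_parent e)
  -- the payload computations
  obtain ⟨R, hR⟩ : ∃ R : Prog (Fin Q.m), R = seqs [
      ω.mulViews (ω.childViews x), ω.loadView 1 (.H x),
      .instr (.pneg 1 1), .instr (.padd 1 0 1),
      .instr (.pstore (table (.H x)) (keyRegs (ω.scope x)) 0),
      if x ∈ Q.free then .skip else .seq (.instr (.lift 2 x x)) (.instr (.pmul 1 1 2)),
      ω.loadView 2 (.V x), .instr (.padd 2 2 1),
      .instr (.pstore (table (.V x)) (keyRegs (ω.dep x)) 2)] := ⟨_, rfl⟩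
  obtain ⟨a₂, e2⟩ : ∃ a₂, R.eval g σ = { σ with acc := a₂, pdict := P } := by
    refine ⟨(R.eval g σ).acc, ?_⟩
    by_cases hx : x ∈ Q.free
    · simp only [hR, seqs, Prog.eval, e1, hx, if_true, loadView, Instr.step, keyRegs_map _ _ hz]
      congr 1
      rw [hP, hnv]
      simp [ha0, wordWeight, hx, tbl, hHV, schema, ← sub_eq_add_neg, ← hv]
    · simp only [hR, seqs, Prog.eval, e1, hx, if_false, loadView, Instr.step, keyRegs_map _ _ hz]
      congr 1
      rw [hP, hnv]
      simp [ha0, wordWeight, hx, tbl, hHV, schema, ← sub_eq_add_neg, ← hv]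
      rfl
  obtain ⟨f₃, a₃, e3, hst, hf₃⟩ := ω.eval_testActive g (some x)
    { σ with acc := a₂, pdict := P } hz hs₁
  simp only [← hv] at hst
  have hact := hc₁.active_iff (y := x) (v' := v) (hpp v)
  -- an entry with a blank at `x` never becomes a member
  obtain ⟨b, hb⟩ : ∃ b : Prop, b ↔ v x ≠ Word.sym 0 ∧ ω.Active P σ.dict (some x) v :=
    ⟨_, Iff.rfl⟩
  have e4 : ∃ f₄, (failIf (.eq x Q.m) : Prog (Fin Q.m)).eval g
      { σ with reg := f₃, acc := a₃, pdict := P } = { σ with reg := f₄, acc := a₃, pdict := P } ∧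
      (∀ r < 2 * Q.m + 4, f₄ r = σ.reg r) ∧
      f₄ (2 * Q.m + 4) = if b then Word.sym 1 else Word.sym 0 := by
    have hxz : f₃ x = f₃ Q.m ↔ v x = Word.sym 0 := by
      rw [hf₃ x (by omega), hf₃ Q.m (by omega)]
      simp only [hz]
      rfl
    by_cases hx : v x = Word.sym 0
    · refine ⟨Function.update f₃ (2 * Q.m + 4) (Word.sym 0), ?_, fun r hr => ?_, ?_⟩
      · simp [failIf, Prog.eval, Cond.holds, hxz, hx, Instr.step]
      · rw [Function.update_of_ne (by omega), hf₃ r hr]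
      · simp [hb, hx]
    · refine ⟨f₃, ?_, hf₃, ?_⟩
      · simp [failIf, Prog.eval, Cond.holds, hxz, hx]
      · rw [hst]; simp [hb, hx]
  obtain ⟨f₄, e4, hf₄, hst₄⟩ := e4
  have hkc : (ω.idx x).kc.map f₄ = kw (ω.dep x) v := by
    refine (keyRegs_map (ω.dep x) f₄ ((hf₄ _ (by omega)).trans hz)).trans (kw_eq_iff.2 ?_)
    exact fun y _ => hf₄ y (by omega)
  have hes : (ω.idx x).es.map f₄ = [v x] := by
    simp only [idx, List.map_cons, List.map_nil]
    rw [hf₄ x (by omega)]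
    rfl
  obtain ⟨f, F, l', e5, hf, hF, hl', hll⟩ := Lst.set_spec g (ω.idx_wf x)
    { σ with reg := f₄, acc := a₃, pdict := P } ((hf₄ _ (by simp only [idx]; omega)).trans hz)
    ((hf₄ _ (by simp only [idx]; omega)).trans ho)
    (l := l) (by simpa only [hkc] using hl) b hst₄
    (by simp only [hes]; exact fun h => (hb.1 h).1)
  simp only [hkc, hes] at hF hl' hll
  have hc : ω.Change x v σ.pdict σ.dict P F := change_of_frame hrel hH hV hF hl hl'
    fun w hw => by rw [hll, if_neg hw]
  refine ⟨f, a₃, P, F, ?_, fun r hr => ?_, hc, hc.sound g hs ?_ (by rw [htV, htH]), ?_, ?_⟩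
  · simp only [hR, seqs, Prog.eval, refresh] at e2 ⊢
    rw [e2, e3, e4, e5]
  · rw [hf r (by simp only [idx]; omega)]
    exact hf₄ r hr
  · intro y c hcl
    by_cases hy : y = x
    · subst hy
      by_cases hcc : c = kw (ω.dep y) v
      · exact ⟨l', hcc ▸ hl'⟩
      · obtain ⟨l₀, hl₀⟩ := hs.cycle y c hcl
        exact ⟨l₀, hl₀.congr fun d _ w => hF.2 c (by rw [hcl, kw_length]) hcc d w⟩
    · obtain ⟨l₀, hl₀⟩ := hs.cycle y c hcl
      refine ⟨l₀, hl₀.congr fun d hd w => ?_⟩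
      rw [hF.1 d]
      rw [hd]
      exact fun e => hy (Fin.ext e)
  · rw [htH, hh]
    exact congrArg List.prod (List.map_congr_left fun w hw =>
      (hc.tbl_childViews (hpp v) hw).symm)
  · rw [Listed, hl'.mark _ rfl, hc.active_iff (hpp v), ← hact]
    have : [v x] ∈ l' ↔ b := by rw [hll]; simp
    simp only [this, ← hb]
    by_cases hb' : b <;> simp [hb']

end VarOrder

namespace VarOrder

variable {Q : Query} (ω : VarOrder Q)

/-! ### Active tuples extend to derivations -/

theorem exists_order : ∃ l : List (Fin Q.m), l.Nodup ∧ (∀ x, x ∈ l) ∧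
    l.Pairwise fun a b => ¬ ω.Anc b a := by
  let d : Fin Q.m → ℕ := fun x => (Finset.univ.filter fun y => ω.Anc y x).card
  have hd : ∀ x y, ω.Anc x y → d x < d y := fun x y h => Finset.card_lt_card (by
    refine Finset.ssubset_iff_subset_ne.2 ⟨fun z hz => ?_, fun e => ?_⟩
    · simp only [Finset.mem_filter, Finset.mem_univ, true_and] at hz ⊢
      exact Anc.trans ω hz h
    · have : x ∈ Finset.univ.filter fun z => ω.Anc z y := by simpa using h
      rw [← e] at this
      exact ω.anc_irrefl x (by simpa using this))
  let r : Fin Q.m → Fin Q.m → Prop := fun a b => d a ≤ d b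
  have : Std.Total r := ⟨fun a b => le_total (d a) (d b)⟩
  have : IsTrans _ r := ⟨fun a b c h h' => le_trans (α := ℕ) h h'⟩
  refine ⟨Finset.univ.toList.insertionSort r, ?_, fun x => ?_, ?_⟩
  · exact (List.perm_insertionSort r _).nodup_iff.2 (Finset.nodup_toList _)
  · exact (List.perm_insertionSort r _).mem_iff.2 (by simp)
  · exact (List.pairwise_insertionSort r _).imp fun h h' => not_lt.2 h (hd _ _ h')

theorem exists_ne_zero_of_finsum_ne_zero {α : Sort*} {M : Type*} [AddCommMonoid M] {f : α → M}
    (h : ∑ᶠ a, f a ≠ 0) : ∃ a, f a ≠ 0 := by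
  by_contra! h'
  exact h ((finsum_congr h').trans finsum_zero)

/-- The variables, ancestors first. -/
def order : List (Fin Q.m) := ω.exists_order.choose

theorem order_nodup : ω.order.Nodup := ω.exists_order.choose_spec.1

theorem mem_order (x : Fin Q.m) : x ∈ ω.order := ω.exists_order.choose_spec.2.1 x

theorem order_pairwise : ω.order.Pairwise fun a b => ¬ ω.Anc b a :=
  ω.exists_order.choose_spec.2.2

/-- The variables on which the activity of a node depends. -/
def nodeScope : Option (Fin Q.m) → Finset (Fin Q.m)
  | none => ∅
  | some x => ω.scope x

variable {A : Type u} {D : Type v} [CommRing D] (g : Fin Q.m → A → D)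

variable {ω} {P : ℕ → List (Word A) → D} {F : ℕ → List (Word A) → Word A}

theorem active_node_congr {o : Option (Fin Q.m)} {v v' : Fin Q.m → Word A}
    (h : Agree (ω.nodeScope o) v v') (ha : ω.Active P F o v) : ω.Active P F o v' := by
  rcases o with _ | x
  · refine ⟨ha.1, fun w hw => ?_, fun y hy => ?_⟩
    · have he : ω.schema w = ∅ := by
        rcases ω.mem_boundViews.1 hw with ⟨i, hi, rfl⟩ | ⟨y, hy, -, rfl⟩
        · simpa [relsUnder, schema] using hi
        · exact ω.dep_eq_empty hy
      rw [tbl_congr (v' := v) (by rw [he]; intro z hz; simp at hz)]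
      exact ha.2.1 w hw
    · obtain ⟨a, hl⟩ := ha.2.2 y hy
      refine ⟨a, (listed_congr (agree_scope_update ?_ a)).1 hl⟩
      rw [ω.dep_eq_empty (ω.mem_freeChildren.1 hy).1]
      intro z hz; simp at hz
  · exact active_congr h ha

/-- Below an active node, every child has a value that makes it active: for a free child its index
is nonempty, and for a bound child a nonzero sum has a nonzero summand. -/
theorem exists_active_child (hft : ω.FreeTop) (hs : ω.Sound g P F) {x : Fin Q.m}
    (hf : ∀ v, ω.Fresh P F x v) {v : Fin Q.m → Word A} (ha : ω.Active P F (ω.parent x) v) :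
    ∃ a, ω.Active P F (some x) (Function.update v x a) := by
  by_cases hx : x ∈ Q.free
  · obtain ⟨a, hl⟩ := ha.2.2 x (ω.mem_freeChildren.2 ⟨rfl, hx⟩)
    exact ⟨a, ((hf _).2.1 hl).2⟩
  · have hV := ha.2.1 (.V x) (ω.mem_boundViews.2 (Or.inr ⟨x, rfl, hx, rfl⟩))
    rw [hs.sum] at hV
    obtain ⟨a, hH⟩ := exists_ne_zero_of_finsum_ne_zero hV
    have hH := left_ne_zero_of_mul hH
    rw [(hf _).1] at hH
    refine ⟨a, ha.1, fun w hw h0 => hH ?_, fun y hy => absurd (hft x y ?_ ?_) hx⟩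
    · exact List.prod_eq_zero (List.mem_map.2 ⟨w, ω.boundViews_subset hw, h0⟩)
    · exact ω.anc_of_parent (ω.mem_freeChildren.1 hy).1
    · exact (ω.mem_freeChildren.1 hy).2

/-- If the nodes in `done` are active, then the variables in `rest` below them can be given values
that make all of them active. -/
theorem exists_active_extension (hft : ω.FreeTop) (hs : ω.Sound g P F) (rest : List (Fin Q.m))
    (hn : rest.Nodup) (hpw : rest.Pairwise fun a b => ¬ ω.Anc b a)
    (hf : ∀ x ∈ rest, ∀ v, ω.Fresh P F x v) (done : Set (Option (Fin Q.m)))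
    (hpar : ∀ x ∈ rest, ω.parent x ∈ done ∨ ∃ p ∈ rest, ω.parent x = some p)
    (hsc : ∀ o ∈ done, ∀ y ∈ rest, y ∉ ω.nodeScope o)
    (v : Fin Q.m → Word A) (ha : ∀ o ∈ done, ω.Active P F o v) :
    ∃ v' : Fin Q.m → Word A, (∀ y, y ∉ rest → v' y = v y) ∧ (∀ o ∈ done, ω.Active P F o v') ∧
      ∀ x ∈ rest, ω.Active P F (some x) v' := by
  induction rest generalizing done v with
  | nil => exact ⟨v, fun _ _ => rfl, ha, by simp⟩
  | cons x rest ih =>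
    obtain ⟨hx, hn⟩ := List.nodup_cons.1 hn
    obtain ⟨hxp, hpw⟩ := List.pairwise_cons.1 hpw
    have hpx : ω.parent x ∈ done := by
      rcases hpar x (by simp) with h | ⟨p, hp, h⟩
      · exact h
      · rcases List.mem_cons.1 hp with rfl | hp
        · exact absurd rfl (ne_of_parent h)
        · exact absurd (ω.anc_of_parent h) (hxp p hp)
    obtain ⟨a, hxa⟩ := exists_active_child g hft hs (hf x (by simp)) (ha _ hpx)
    obtain ⟨v', h1, h2, h3⟩ := ih hn hpw (fun y hy => hf y (List.mem_cons_of_mem _ hy))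
      (insert (some x) done) (fun y hy => by
        rcases hpar y (List.mem_cons_of_mem _ hy) with h | ⟨p, hp, h⟩
        · exact Or.inl (Or.inr h)
        · rcases List.mem_cons.1 hp with rfl | hp
          · exact Or.inl (Or.inl h)
          · exact Or.inr ⟨p, hp, h⟩)
      (by
        rintro o (rfl | ho) y hy hyo
        · rcases ω.mem_scope hyo with rfl | h
          · exact hx hy
          · exact hxp y hy h
        · exact hsc o ho y (List.mem_cons_of_mem _ hy) hyo)
      (Function.update v x a) (by
        rintro o (rfl | ho)
        · exact hxa
        · exact active_node_congr (agree_update (hsc o ho x (by simp)) v a).symm (ha o ho))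
    refine ⟨v', fun y hy => ?_, fun o ho => h2 o (Or.inr ho), fun y hy => ?_⟩
    · rw [List.mem_cons, not_or] at hy
      rw [h1 y hy.2, Function.update_of_ne hy.1]
    · rcases List.mem_cons.1 hy with rfl | hy
      · exact h2 _ (Or.inl rfl)
      · exact h3 y hy

theorem Active.rel_ne_zero {o : Option (Fin Q.m)} {v : Fin Q.m → Word A}
    (h : ω.Active P F o v) {i : Fin Q.n} (hi : i ∈ ω.relsUnder o) : ω.tbl P (.rel i) v ≠ 0 :=
  h.2.1 _ (ω.mem_boundViews.2 (Or.inl ⟨i, hi, rfl⟩))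

/-- An active tuple over the scope of `x` occurs in every relation that contains `x`. -/
theorem Active.exists_rel_ne_zero (hft : ω.FreeTop) (hs : ω.Sound g P F) {x : Fin Q.m}
    (hf : ∀ y, ω.Anc x y → ∀ v, ω.Fresh P F y v) {v : Fin Q.m → Word A}
    (ha : ω.Active P F (some x) v) {i : Fin Q.n} (hi : x ∈ Q.sch i) :
    ∃ v' : Fin Q.m → Word A, Agree (ω.scope x) v' v ∧ ω.tbl P (.rel i) v' ≠ 0 := by
  have hmem : ∀ y, y ∈ ω.order.filter (fun y => ω.Anc x y) ↔ ω.Anc x y := by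
    simp [ω.mem_order]
  have hsc : ∀ y, ω.Anc x y → y ∉ ω.scope x := fun y h hy => by
    rcases ω.mem_scope hy with rfl | h'
    · exact ω.anc_irrefl _ h
    · exact ω.anc_irrefl _ (Anc.trans ω h h')
  obtain ⟨v', h1, h2, h3⟩ := exists_active_extension g hft hs
    (ω.order.filter fun y => ω.Anc x y) (ω.order_nodup.filter _) (ω.order_pairwise.filter _)
    (fun y hy => hf y ((hmem y).1 hy)) {some x} (fun y hy => by
      rcases hp : ω.parent y with _ | p
      · exact absurd ((hmem y).1 hy) (ω.not_anc_of_root hp x)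
      · rcases (ω.anc_iff hp x).1 ((hmem y).1 hy) with rfl | h
        · exact Or.inl rfl
        · exact Or.inr ⟨p, (hmem p).2 h, rfl⟩)
    (by rintro o rfl y hy; exact hsc y ((hmem y).1 hy)) v (by rintro o rfl; exact ha)
  refine ⟨v', fun y hy => h1 y fun h => hsc y ((hmem y).1 h) hy, ?_⟩
  obtain ⟨o, ho⟩ := ω.exists_mem_relsUnder i
  rcases o with _ | z
  · simp [relsUnder] at ho
    simp [ho] at hi
  · rcases (ω.mem_relsAt.1 ho).2 x hi with rfl | h
    · exact (h2 _ rfl).rel_ne_zero ho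
    · exact (h3 z ((hmem z).2 h)).rel_ne_zero ho

/-- The tuples with nonzero payload in `H@x` are active. The converse fails, as the view of a free
child can vanish by cancellation. -/
theorem active_of_ne_zero (hft : ω.FreeTop) (hs : ω.Sound g P F)
    (hnb : ∀ i v, ω.tbl P (.rel i) v ≠ 0 → ∀ x ∈ Q.sch i, v x ≠ Word.sym 0) (x : Fin Q.m)
    (hf : ∀ y, ω.Anc x y → ∀ v, ω.Fresh P F y v) (v : Fin Q.m → Word A)
    (h : ((ω.childViews x).map fun w => ω.tbl P w v).prod ≠ 0) : ω.Active P F (some x) v := by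
  induction x using ω.wf.induction generalizing v with
  | _ x ih =>
    have h0 : ∀ w ∈ ω.childViews x, ω.tbl P w v ≠ 0 := fun w hw h0 =>
      h (List.prod_eq_zero (List.mem_map.2 ⟨w, hw, h0⟩))
    refine ⟨fun e => h ?_, fun w hw => h0 w (ω.boundViews_subset hw), fun y hy => ?_⟩
    · rw [← mul_one (List.prod _), e, mul_zero]
    · have hyx := (ω.mem_freeChildren.1 hy).1
      have hV := h0 (.V y) (ω.mem_childViews.2 (Or.inr ⟨y, hyx, rfl⟩))
      rw [hs.sum] at hV
      obtain ⟨a, hH⟩ := exists_ne_zero_of_finsum_ne_zero hV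
      have hfy := hf y (ω.anc_of_parent hyx)
      have hH := left_ne_zero_of_mul hH
      rw [(hfy _).1] at hH
      have hf' : ∀ z, ω.Anc y z → ∀ v, ω.Fresh P F z v := fun z hz =>
        hf z (Anc.trans ω (ω.anc_of_parent hyx) hz)
      have hay := ih y hyx hf' _ hH
      obtain ⟨i, hi⟩ := Q.covered y
      obtain ⟨v', hv', hR⟩ := hay.exists_rel_ne_zero g hft hs hf' hi
      refine ⟨a, (hfy _).2.2 ⟨?_, hay⟩⟩
      rw [← hv' y (ω.self_mem_scope y)]
      exact hnb i v' hR y hi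

end VarOrder

/-! ### Delays -/

section Delay

variable {A : Type u} {D : Type v}

/-- The number of steps since the last output, after `n` such steps before the trace. -/
def gapAfter : ℕ → List (Option (Record A D)) → ℕ
  | n, [] => n
  | n, none :: tr => gapAfter (n + 1) tr
  | _, some _ :: tr => gapAfter 0 tr

/-- The number of steps since the last output never exceeds `c`, after `n` such steps before the
trace. -/
def GapOK (c : ℕ) : ℕ → List (Option (Record A D)) → Prop
  | n, [] => n ≤ c
  | n, none :: tr => GapOK c (n + 1) tr
  | n, some _ :: tr => n ≤ c ∧ GapOK c 0 tr

theorem gapAfter_append (n : ℕ) (tr tr' : List (Option (Record A D))) :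
    gapAfter n (tr ++ tr') = gapAfter (gapAfter n tr) tr' := by
  induction tr generalizing n with
  | nil => rfl
  | cons e tr ih => cases e <;> exact ih _

theorem GapOK.le {c n : ℕ} {tr : List (Option (Record A D))} (h : GapOK c n tr) : n ≤ c := by
  induction tr generalizing n with
  | nil => exact h
  | cons e tr ih =>
    cases e with
    | none => exact (Nat.le_succ n).trans (ih h)
    | some r => exact h.1

theorem gapOK_append {c n : ℕ} {tr tr' : List (Option (Record A D))} :
    GapOK c n (tr ++ tr') ↔ GapOK c n tr ∧ GapOK c (gapAfter n tr) tr' := by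
  induction tr generalizing n with
  | nil => exact ⟨fun h => ⟨GapOK.le h, h⟩, fun h => h.2⟩
  | cons e tr ih =>
    cases e with
    | none => exact ih
    | some r => exact (and_congr_right fun _ => ih).trans and_assoc.symm

theorem GapOK.mono {c c' n : ℕ} {tr : List (Option (Record A D))} (h : GapOK c n tr)
    (hc : c ≤ c') : GapOK c' n tr := by
  induction tr generalizing n with
  | nil => exact le_trans (α := ℕ) h hc
  | cons e tr ih =>
    cases e with
    | none => exact ih h
    | some r => exact ⟨h.1.trans hc, ih h.2⟩

theorem Quiet.filterMap {tr : List (Option (Record A D))} (h : Quiet tr) :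
    tr.filterMap id = [] := by
  rw [List.filterMap_eq_nil_iff]
  exact fun e he => h e he

theorem Quiet.gap {tr : List (Option (Record A D))} (h : Quiet tr) {c n : ℕ}
    (hc : n + tr.length ≤ c) : GapOK c n tr ∧ gapAfter n tr = n + tr.length := by
  induction tr generalizing n with
  | nil => exact ⟨hc, rfl⟩
  | cons e tr ih =>
    obtain rfl : e = none := h e (by simp)
    simp only [List.length_cons] at hc ⊢
    obtain ⟨h1, h2⟩ := ih (fun e he => h e (by simp [he])) (n := n + 1) (by omega)
    exact ⟨h1, by rw [gapAfter, h2]; omega⟩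

theorem GapOK.delayAtMost {c : ℕ} {tr : List (Option (Record A D))} (h : GapOK c 0 tr) :
    DelayAtMost c tr := by
  rintro l₁ l₂ l₃ rfl hq
  rw [gapOK_append, gapOK_append] at h
  have h2 := h.1.2
  have := (Quiet.gap (c := gapAfter 0 l₁ + l₂.length) (n := gapAfter 0 l₁) hq le_rfl).2
  have h3 := h.2.le
  rw [gapAfter_append, this] at h3
  omega

/-- Running the trace takes at most `c` steps before the first output, between outputs and after
the last output, and there is an output. -/
def Paced (c : ℕ) (tr : List (Option (Record A D))) : Prop :=
  ∀ n, GapOK (n + c) n tr ∧ gapAfter n tr ≤ c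

/-- Traversing a nonempty list with a body of constant delay has constant delay. For an empty list
the conclusion would fail, since such traversals could follow each other without any output. -/
theorem Seg.paced {E : Type*} {b c : ℕ} {T : E → List (Option (Record A D)) → Prop} {l : List E}
    {tr : List (Option (Record A D))} (h : Seg b T l tr) (hl : l ≠ [])
    (hT : ∀ w ∈ l, ∀ t, T w t → Paced c t) : Paced (b + 2 * c) tr := by
  have key : ∀ n B, n + b + c ≤ B → c + b + c ≤ B →
      GapOK B n tr ∧ gapAfter n tr ≤ (if l = [] then n else c) + b := by
    clear hl
    induction h with
    | nil ht hb =>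
      intro n B h1 _
      have := ht.gap (c := B) (n := n) (by omega)
      exact ⟨this.1, by rw [this.2, if_pos rfl]; omega⟩
    | @cons t w t' l tr ht hb hw _ ih =>
      intro n B h1 h2
      obtain ⟨g1, g2⟩ := ht.gap (c := B) (n := n) (by omega)
      obtain ⟨g3, g4⟩ := hT w (by simp) t' hw (n + t.length)
      obtain ⟨g5, g6⟩ := ih (fun w hw => hT w (by simp [hw]))
        (gapAfter (n + t.length) t') B (by omega) h2
      refine ⟨?_, ?_⟩
      · rw [gapOK_append, gapOK_append, gapAfter_append, g2]
        exact ⟨⟨g1, g3.mono (by omega)⟩, g5⟩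
      · rw [gapAfter_append, gapAfter_append, g2, if_neg (by simp)]
        split_ifs at g6 <;> omega
  intro n
  obtain ⟨h1, h2⟩ := key n (n + (b + 2 * c)) (by omega) (by omega)
  rw [if_neg hl] at h2
  exact ⟨h1, by omega⟩

end Delay

namespace VarOrder

variable {Q : Query} (ω : VarOrder Q)

/-! ### Enumeration -/

/-- The topmost variables outside of `S`. -/
def frontier (S : Finset (Fin Q.m)) : Finset (Fin Q.m) :=
  Finset.univ.filter fun y => y ∉ S ∧ ∀ p, ω.parent y = some p → p ∈ S

/-- The views whose product is the payload of an output tuple: the relations over free variables,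
and the views of the bound variables without a bound parent. -/
def payloadViews : List (View Q) :=
  (Finset.univ.filter fun i => Q.sch i ⊆ Q.free).toList.map View.rel ++
    (ω.frontier Q.free).toList.map View.V

/-- Nested traversals of the indexes of the given variables, with output in the innermost one. -/
def nest : List (Fin Q.m) → Prog (Fin Q.m)
  | [] => .seq (ω.mulViews ω.payloadViews) (.instr (.emit (keyRegs Q.free) 0))
  | x :: L => (ω.idx x).forEach (nest L)

/-- A bound for the delay of nested traversals. It depends only on the nesting depth, because every
inner traversal produces an output. -/
def nestPace : List (Fin Q.m) → ℕ
  | [] => (ω.mulViews ω.payloadViews).cost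
  | x :: L => (ω.idx x).gap + 2 * nestPace L

/-- Put the constants `sym 0` and `sym 1` into the registers `m` and `m + 1`. -/
def setup : Prog (Fin Q.m) := .seq (.instr (.const Q.m 0)) (.instr (.const (Q.m + 1) 1))

/-- The free variables, ancestors first. -/
def freeOrder : List (Fin Q.m) := ω.order.filter fun x => x ∈ Q.free

/-- Enumerate the tuples over the free variables that are listed in all indexes, unless the root of
the view tree is inactive. -/
def enumerate : Prog (Fin Q.m) :=
  .seq (.seq setup (ω.testActive none))
    (.ite (.eq (2 * Q.m + 4) Q.m) .skip (ω.nest ω.freeOrder))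

variable {A : Type u} {D : Type v} [CommRing D] (g : Fin Q.m → A → D)

/-- The output record for a valuation. -/
def outRecord (P : ℕ → List (Word A) → D) (v : Fin Q.m → Word A) : Record A D :=
  (kw Q.free v, (ω.payloadViews.map fun w => ω.tbl P w v).prod)

/-- The trace lists, without repetition, all valuations that differ from `v` at most on `L` and are
listed in the indexes of the variables in `L`. -/
def Enumerates (P : ℕ → List (Word A) → D) (F : ℕ → List (Word A) → Word A)
    (L : List (Fin Q.m)) (v : Fin Q.m → Word A) (tr : List (Option (Record A D))) : Prop :=
  ∃ vs : List (Fin Q.m → Word A), vs.Nodup ∧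
    (∀ v', v' ∈ vs ↔ (∀ y, y ∉ L → v' y = v y) ∧ ∀ x ∈ L, ω.Listed F x v') ∧
    tr.filterMap id = vs.map (ω.outRecord P) ∧ Paced (ω.nestPace L) tr

variable {ω} {P : ℕ → List (Word A) → D} {F : ℕ → List (Word A) → Word A}

theorem Enumerates.congr {L : List (Fin Q.m)} {v v' : Fin Q.m → Word A}
    {tr : List (Option (Record A D))} (h : ω.Enumerates P F L v tr)
    (hv : ∀ y, y ∉ L → v y = v' y) : ω.Enumerates P F L v' tr := by
  obtain ⟨vs, h1, h2, h3⟩ := h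
  refine ⟨vs, h1, fun w => ?_, h3⟩
  rw [h2]
  exact and_congr_left fun _ => forall₂_congr fun y hy => by rw [hv y hy]

theorem Seg.enumerates {x : Fin Q.m} {L : List (Fin Q.m)} (hxL : x ∉ L) {v : Fin Q.m → Word A}
    {l : List (List (Word A))} (hl : l.Nodup) (hlen : ∀ w ∈ l, w.length = 1)
    {b : ℕ} {tr : List (Option (Record A D))}
    (h : Seg b (fun w t => ∀ a, w = [a] → ω.Enumerates P F L (Function.update v x a) t) l tr) :
    ∃ vs : List (Fin Q.m → Word A), vs.Nodup ∧
      (∀ v', v' ∈ vs ↔ (∀ y, y ∉ x :: L → v' y = v y) ∧ [v' x] ∈ l ∧ ∀ z ∈ L, ω.Listed F z v') ∧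
      tr.filterMap id = vs.map (ω.outRecord P) := by
  induction h with
  | nil ht _ => exact ⟨[], List.nodup_nil, by simp, Quiet.filterMap ht⟩
  | @cons t w t' l tr ht _ hw _ ih =>
    obtain ⟨a, rfl⟩ := List.length_eq_one_iff.1 (hlen w (by simp))
    obtain ⟨vs₁, n1, m1, e1, -⟩ := hw a rfl
    obtain ⟨vs₂, n2, m2, e2⟩ := ih (List.nodup_cons.1 hl).2 fun w hw => hlen w (by simp [hw])
    refine ⟨vs₁ ++ vs₂, List.nodup_append.2 ⟨n1, n2, ?_⟩, fun v' => ?_, ?_⟩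
    · rintro v₁ hv₁ v₂ hv₂ rfl
      have h1 := ((m1 _).1 hv₁).1 x hxL
      have h2 := ((m2 _).1 hv₂).2.1
      rw [Function.update_self] at h1
      rw [h1] at h2
      exact (List.nodup_cons.1 hl).1 h2
    · rw [List.mem_append, m1, m2]
      have h1 : (∀ y, y ∉ L → v' y = Function.update v x a y) ↔
          (∀ y, y ∉ x :: L → v' y = v y) ∧ v' x = a := by
        constructor
        · intro h
          refine ⟨fun y hy => ?_, by simpa using h x hxL⟩
          rw [List.mem_cons, not_or] at hy
          rw [h y hy.2, Function.update_of_ne hy.1]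
        · rintro ⟨h, hx⟩ y hy
          by_cases hyx : y = x
          · subst hyx; simpa using hx
          · rw [Function.update_of_ne hyx]
            exact h y (by simp [hyx, hy])
      rw [h1]
      simp only [List.mem_cons, List.cons.injEq, and_true]
      tauto
    · rw [List.filterMap_append, List.filterMap_append, ht.filterMap, e1, e2, List.nil_append,
        List.map_append]

theorem nest_exec (hs : ω.Sound g P F) (hf : ∀ x v, ω.Fresh P F x v) (L : List (Fin Q.m))
    (hn : L.Nodup) (hpw : L.Pairwise fun a b => ¬ ω.Anc b a) (hL : ∀ x ∈ L, x ∈ Q.free)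
    (σ : State A D) (hP : σ.pdict = P) (hF : σ.dict = F) (hz : σ.reg Q.m = Word.sym 0)
    (ho : σ.reg (Q.m + 1) = Word.sym 1)
    (ha : ∀ x ∈ L, (ω.Active P F (ω.parent x) (valOf σ.reg) ∧
      ∀ z ∈ L, z ∉ ω.nodeScope (ω.parent x)) ∨ ∃ p ∈ L, ω.parent x = some p) :
    ∃ tr σ', Exec g (ω.nest L) σ tr σ' ∧ σ'.pdict = P ∧ σ'.dict = F ∧
      (∀ r < 2 * Q.m + 4, (∀ x ∈ L, r ≠ (x : ℕ)) → σ'.reg r = σ.reg r) ∧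
      ω.Enumerates P F L (valOf σ.reg) tr := by
  induction L generalizing σ with
  | nil =>
    obtain ⟨a, e1, ha0, -⟩ := ω.eval_mulViews g ω.payloadViews σ hz
    obtain ⟨tr, x1, hlen, hq⟩ := (ω.straight_mulViews ω.payloadViews).exec g σ
    rw [e1] at x1
    refine ⟨_, _, Exec.seq x1 (Exec.instr _ _), hP, hF, fun _ _ _ => rfl, [valOf σ.reg],
      by simp, fun v' => ?_, ?_, fun n => ?_⟩
    · simp [funext_iff]
    · rw [List.filterMap_append, hq.filterMap]
      simp [Instr.event, outRecord, keyRegs_map _ _ hz, ha0, hP]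
    · obtain ⟨h1, h2⟩ := hq.gap (c := n + ω.nestPace []) (n := n)
        (by simp only [nestPace]; omega)
      rw [gapOK_append, gapAfter_append, h2]
      refine ⟨⟨h1, ?_⟩, ?_⟩
      · simp only [Instr.event, GapOK, nestPace]
        omega
      · simp [Instr.event, gapAfter]
  | cons x L ih =>
    obtain ⟨hxL, hn⟩ := List.nodup_cons.1 hn
    obtain ⟨hxp, hpw⟩ := List.pairwise_cons.1 hpw
    set v : Fin Q.m → Word A := valOf σ.reg with hv
    have hpx : ω.Active P F (ω.parent x) v := by
      rcases ha x (by simp) with h | ⟨p, hp, h⟩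
      · exact h.1
      · rcases List.mem_cons.1 hp with rfl | hp
        · exact absurd rfl (ne_of_parent h)
        · exact absurd (ω.anc_of_parent h) (hxp p hp)
    obtain ⟨l, hl⟩ := hs.cycle x (kw (ω.dep x) v) (kw_length _ _)
    have hdep : ∀ y ∈ ω.dep x, y ∉ x :: L := by
      intro y hy h
      rcases List.mem_cons.1 h with rfl | h
      · exact ω.self_notMem_dep _ hy
      · exact hxp y h (ω.mem_dep.1 hy).1
    let J : List (List (Word A)) → State A D → Prop := fun _ τ =>
      τ.pdict = P ∧ τ.dict = F ∧ ∀ r < 2 * Q.m + 4, (∀ y ∈ x :: L, r ≠ (y : ℕ)) → τ.reg r = σ.reg r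
    have hJv : ∀ ws τ, J ws τ → ∀ y, y ∉ x :: L → valOf τ.reg y = v y := fun ws τ h y hy =>
      h.2.2 y (by omega) fun z hz e => hy (Fin.ext e ▸ hz)
    have hJz : ∀ ws τ, J ws τ → τ.reg Q.m = Word.sym 0 := fun ws τ h =>
      (h.2.2 _ (by omega) fun y _ => by omega).trans hz
    have hJo : ∀ ws τ, J ws τ → τ.reg (Q.m + 1) = Word.sym 1 := fun ws τ h =>
      (h.2.2 _ (by omega) fun y _ => by omega).trans ho
    have hla : ∀ a, [a] ∈ l ↔ ω.Listed F x (Function.update v x a) := fun a =>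
      (ω.exists_listed_iff hl a).symm
    obtain ⟨tr, σ', hx, hseg, h1, h2, h3⟩ := Lst.forEach_exec g (ω.idx_wf x) (P := ω.nest L)
      (c := kw (ω.dep x) v) (l := l) J
      (fun w t => ∀ a, w = [a] → ω.Enumerates P F L (Function.update v x a) t)
      (fun ws τ h => ⟨by rw [h.2.1]; exact hl, by
          refine (keyRegs_map _ _ (hJz ws τ h)).trans (kw_eq_iff.2 fun y hy => ?_)
          exact hJv ws τ h y (hdep y hy), hJz ws τ h, hJo ws τ h⟩)
      (fun ws τ f h hf => ⟨h.1, h.2.1, fun r hr hr' => by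
          rw [← h.2.2 r hr hr']
          exact hf r hr (by simpa [idx] using hr' x (by simp))⟩)
      (by
        rintro ws w rest hlw τ hτ hw
        have hwl : w ∈ l := by rw [hlw]; simp
        obtain rfl : [τ.reg x] = w := by simpa [idx] using hw
        have hτv : ∀ y, y ∉ L → valOf τ.reg y = Function.update v x (τ.reg x) y := by
          intro y hy
          by_cases hyx : y = x
          · subst hyx; simp [valOf]
          · rw [Function.update_of_ne hyx]
            exact hJv ws τ hτ y (by simp [hyx, hy])
        have hact : ω.Active P F (some x) (valOf τ.reg) := by
          refine active_congr (fun y hy => (hτv y fun h => ?_).symm)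
            ((hf x _).2.1 ((hla _).1 hwl)).2
          rcases ω.mem_scope hy with rfl | hy
          · exact hxL h
          · exact hxp y h hy
        obtain ⟨tr, τ', x1, p1, p2, p3, p4⟩ := ih hn hpw (fun y hy => hL y (by simp [hy])) τ hτ.1
          hτ.2.1 (hJz ws τ hτ) (hJo ws τ hτ) (by
            intro y hy
            rcases ha y (by simp [hy]) with h | ⟨p, hp, h⟩
            · exact Or.inl ⟨active_node_congr (fun z hz => (hJv ws τ hτ z fun hzL =>
                h.2 z hzL hz).symm) h.1, fun z hz => h.2 z (by simp [hz])⟩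
            · rcases List.mem_cons.1 hp with rfl | hp
              · refine Or.inl ⟨h ▸ hact, fun z hz hzs => ?_⟩
                rw [h] at hzs
                rcases ω.mem_scope hzs with rfl | hzp
                · exact hxL hz
                · exact hxp z hz hzp
              · exact Or.inr ⟨p, hp, h⟩)
        refine ⟨tr, τ', x1, ?_, ⟨p1, p2, fun r hr hr' => ?_⟩, ?_⟩
        · rintro a ⟨⟩
          exact p4.congr hτv
        · rw [p3 r hr fun y hy => hr' y (by simp [hy])]
          exact hτ.2.2 r hr hr'
        · simp only [idx, List.map_cons, List.map_nil]
          rw [p3 x (by omega) fun y hy e => hxL (Fin.ext e ▸ hy)])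
      σ ⟨hP, hF, fun _ _ _ => rfl⟩
    have hlne : l ≠ [] := by
      rintro rfl
      obtain ⟨a, h⟩ := hpx.2.2 x (ω.mem_freeChildren.2 ⟨rfl, hL x (by simp)⟩)
      exact absurd ((hla a).2 h) (by simp)
    have hlen : ∀ w ∈ l, w.length = 1 := fun w hw => hl.len w hw
    obtain ⟨vs, n1, m1, e1⟩ := Seg.enumerates hxL hl.nodup hlen hseg
    refine ⟨tr, σ', hx, h1, h2, h3, vs, n1, fun v' => ?_, e1, ?_⟩
    · rw [m1]
      refine and_congr_right fun hv' => ?_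
      have : [v' x] ∈ l ↔ ω.Listed F x v' := by
        rw [hla]
        refine listed_congr fun y hy => ?_
        by_cases hyx : y = x
        · subst hyx; simp
        · rw [Function.update_of_ne hyx]
          exact (hv' y (hdep y ((Finset.mem_insert.1 hy).resolve_left hyx))).symm
      rw [this]
      simp
    · refine hseg.paced hlne fun w hw t ht => ?_
      obtain ⟨a, rfl⟩ := List.length_eq_one_iff.1 (hlen w hw)
      obtain ⟨vs, -, -, -, h⟩ := ht a rfl
      exact h

variable (ω) in
/-- A bound for the delay of the enumeration. -/
def pace : ℕ :=
  (setup (Q := Q)).cost + (ω.testActive none).cost + 1 + ω.nestPace ω.freeOrder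

theorem eval_setup (σ : State A D) : ∃ f, (setup (Q := Q)).eval g σ = { σ with reg := f } ∧
    f Q.m = Word.sym 0 ∧ f (Q.m + 1) = Word.sym 1 ∧
    ∀ r, r ≠ Q.m → r ≠ Q.m + 1 → f r = σ.reg r :=
  ⟨_, rfl, by simp [Prog.eval, Instr.step], by simp, fun r h h' => by
    simp [Prog.eval, Instr.step, h, h']⟩

theorem straight_setup : (setup (Q := Q)).Straight := ⟨trivial, trivial⟩

theorem enumerate_exec (hft : ω.FreeTop) (σ : State A D) (hs : ω.Sound g σ.pdict σ.dict)
    (hf : ∀ x v, ω.Fresh σ.pdict σ.dict x v) :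
    ∃ tr σ', Exec g ω.enumerate σ tr σ' ∧ σ'.pdict = σ.pdict ∧ σ'.dict = σ.dict ∧
      DelayAtMost ω.pace tr ∧ ∃ (v : Fin Q.m → Word A) (vs : List (Fin Q.m → Word A)), vs.Nodup ∧
        (∀ v', v' ∈ vs ↔ ω.Active σ.pdict σ.dict none v' ∧ (∀ y, y ∉ Q.free → v' y = v y) ∧
          ∀ x ∈ Q.free, ω.Listed σ.dict x v') ∧
        tr.filterMap id = vs.map (ω.outRecord σ.pdict) := by
  obtain ⟨f, e1, hz, ho, -⟩ := eval_setup g σ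
  obtain ⟨f', a, e2, ht, hf'⟩ := ω.eval_testActive g none { σ with reg := f } hz hs
  obtain ⟨tr₁, x1, hl1, hq⟩ :=
    Prog.Straight.exec g (P := .seq setup (ω.testActive none))
      ⟨straight_setup, ω.straight_testActive none⟩ σ
  rw [Prog.eval, e1, e2] at x1
  simp only [Prog.cost] at hl1
  have hmem : ∀ x, x ∈ ω.freeOrder ↔ x ∈ Q.free := by simp [freeOrder, ω.mem_order]
  have hact : ∀ v', ω.Active σ.pdict σ.dict none v' ↔ ω.Active σ.pdict σ.dict none (valOf f) :=
    fun v' => ⟨active_node_congr fun y hy => by simp [nodeScope] at hy,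
      active_node_congr fun y hy => by simp [nodeScope] at hy⟩
  have hz' : f' Q.m = Word.sym 0 := (hf' _ (by omega)).trans hz
  by_cases hA : ω.Active σ.pdict σ.dict none (valOf f)
  · have hA' : f' (2 * Q.m + 4) = Word.sym 1 := ht.trans (if_pos hA)
    obtain ⟨tr₂, σ', x2, p1, p2, -, vs, n, m, e, hp⟩ := nest_exec g hs hf ω.freeOrder
      (ω.order_nodup.filter _) (ω.order_pairwise.filter _) (fun x hx => (hmem x).1 hx)
      { σ with reg := f', acc := a } rfl rfl hz' ((hf' _ (by omega)).trans ho) (by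
        intro x hx
        rcases hp : ω.parent x with _ | p
        · exact Or.inl ⟨(hact _).2 hA, by simp [nodeScope]⟩
        · exact Or.inr ⟨p, (hmem p).2 (hft p x (ω.anc_of_parent hp) ((hmem x).1 hx)), rfl⟩)
    refine ⟨_, σ', Exec.seq x1 (Exec.ite_false ?_ x2), p1, p2, GapOK.delayAtMost ?_, valOf f',
      vs, n,
      fun v' => ?_, ?_⟩
    · simp only [Cond.holds]
      rw [hA', hz']
      simp
    · obtain ⟨g1, g2⟩ := hq.gap (c := ω.pace) (n := 0) (by unfold pace; omega)
      rw [gapOK_append, g2]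
      refine ⟨g1, (hp _).1.mono ?_⟩
      unfold pace; omega
    · rw [m, hact]
      simp [hmem, hA]
    · rw [List.filterMap_append, hq.filterMap]
      exact e
  · have hA' : f' (2 * Q.m + 4) = Word.sym 0 := ht.trans (if_neg hA)
    refine ⟨_, _, Exec.seq x1 (Exec.ite_true ?_ (Exec.skip _)), rfl, rfl, GapOK.delayAtMost ?_,
      valOf f, [], List.nodup_nil, fun v' => ?_, ?_⟩
    · simp only [Cond.holds]
      rw [hA', hz']
    · obtain ⟨g1, g2⟩ := hq.gap (c := ω.pace) (n := 0) (by unfold pace; omega)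
      rw [gapOK_append, g2]
      refine ⟨g1, ?_⟩
      simp only [GapOK]
      unfold pace; omega
    · rw [hact]
      simp [hA]
    · rw [List.filterMap_append, hq.filterMap]
      rfl

end VarOrder

section Updates

variable {Q : Query}

/-! ### Reading and storing records -/

/-- The registers that hold a record: the tag of the relation, then the tuple. -/
def recRegs (Q : Query) : List ℕ := (Q.m + 2) :: List.range Q.m

/-- Read the next record, and set the flag `2 * m + 6` to `sym 0` at the end of the input, and
to `sym 1` otherwise. -/
def readNext : Prog (Fin Q.m) := seqs [
  .instr (.read (recRegs Q) 0),
  .instr (.const (2 * Q.m + 6) 1),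
  .ite (.eq (Q.m + 2) Q.m) (.instr (.const (2 * Q.m + 6) 0)) .skip]

/-- Run `f i` if the record in the registers is for the relation `i`. -/
def onTag (f : Fin Q.n → Prog (Fin Q.m)) : Prog (Fin Q.m) :=
  seqs ((List.finRange Q.n).map fun i : Fin Q.n =>
    .seq (.instr (.const (2 * Q.m + 4) (i + 1))) (.ite (.eq (Q.m + 2) (2 * Q.m + 4)) (f i) .skip))

/-- Add the payload in register `0` to the payload of the current tuple in the relation `i`. -/
def addRel (i : Fin Q.n) : Prog (Fin Q.m) := seqs [
  .instr (.pload 1 (table (.rel i)) (keyRegs (Q.sch i))),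
  .instr (.padd 0 1 0),
  .instr (.pstore (table (.rel i)) (keyRegs (Q.sch i)) 0)]

/-- Process all records of the input with the program `P`. -/
def loadAll (P : Prog (Fin Q.m)) : Prog (Fin Q.m) :=
  .seq readNext (.loop (.eq (2 * Q.m + 6) (Q.m + 1)) (.seq P readNext))

theorem straight_readNext : (readNext (Q := Q)).Straight := by
  simp [readNext, straight_seqs, Prog.Straight]

theorem straight_addRel (i : Fin Q.n) : (addRel i).Straight := by
  simp [addRel, straight_seqs, Prog.Straight]

theorem straight_onTag {f : Fin Q.n → Prog (Fin Q.m)} (hf : ∀ i, (f i).Straight) :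
    (onTag f).Straight := by
  simp [onTag, straight_seqs, Prog.Straight, hf]

variable {A : Type u} {D : Type v} [CommRing D] (g : Fin Q.m → A → D)

/-- `v` is a tuple over the schema of the relation `i`. -/
def Typed (i : Fin Q.n) (v : Fin Q.m → Word A) : Prop := ∀ x, v x ≠ Word.sym 0 ↔ x ∈ Q.sch i

theorem Typed.ofFn {i : Fin Q.n} {v : Fin Q.m → Word A} (h : Typed i v) :
    List.ofFn v = kw (Q.sch i) v := by
  rw [kw, List.ofFn_inj]
  funext x
  split_ifs with hx
  · rfl
  · exact not_not.1 fun h' => hx ((h x).1 h')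

/-- The input record that adds `p` to the payload of `v` in the relation `i`. -/
def record (i : Fin Q.n) (v : Fin Q.m → Word A) (p : D) : Record A D :=
  (Word.sym (i + 1) :: List.ofFn v, p)

/-- The payloads of all relations after adding `p` to the payload of `v` in the relation `i`. -/
def addTo (R : Fin Q.n → (Fin Q.m → Word A) → D) (i : Fin Q.n) (v : Fin Q.m → Word A) (p : D) :
    Fin Q.n → (Fin Q.m → Word A) → D :=
  fun j v' => R j v' + if j = i ∧ Agree (Q.sch i) v' v then p else 0

theorem assign_of_notMem {rs : List ℕ} (ws : List (Word A)) (f : ℕ → Word A) {r : ℕ}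
    (hr : r ∉ rs) : assign f rs ws r = f r := by
  induction rs generalizing ws f with
  | nil => rfl
  | cons s rs ih =>
    rw [List.mem_cons, not_or] at hr
    rw [assign, ih _ _ hr.2, Function.update_of_ne hr.1]

theorem map_assign {rs : List ℕ} (hn : rs.Nodup) {ws : List (Word A)}
    (hl : ws.length = rs.length) (f : ℕ → Word A) : rs.map (assign f rs ws) = ws := by
  induction rs generalizing ws f with
  | nil => simp at hl; simp [hl]
  | cons r rs ih =>
    rcases ws with _ | ⟨w, ws⟩
    · simp at hl
    · obtain ⟨hr, hn⟩ := List.nodup_cons.1 hn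
      simp only [List.map_cons, assign, List.headD_cons, List.tail_cons]
      rw [ih hn (by simpa using hl), assign_of_notMem _ _ hr, Function.update_self]

theorem assign_nil (rs : List ℕ) (f : ℕ → Word A) (r : ℕ) :
    assign f rs [] r = if r ∈ rs then Word.sym 0 else f r := by
  induction rs generalizing f with
  | nil => simp [assign]
  | cons s rs ih =>
    simp only [assign, List.headD_nil, List.tail_nil, ih, List.mem_cons]
    by_cases h : r = s <;> by_cases h' : r ∈ rs <;> simp [h, h']

theorem recRegs_nodup : (recRegs Q).Nodup := by
  simp [recRegs, List.nodup_range]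

theorem recRegs_length : (recRegs Q).length = Q.m + 1 := by simp [recRegs]

theorem mem_recRegs {r : ℕ} : r ∈ recRegs Q ↔ r = Q.m + 2 ∨ r < Q.m := by simp [recRegs]

theorem range_map_eq_ofFn (f : ℕ → Word A) :
    (List.range Q.m).map f = List.ofFn (valOf (Q := Q) f) := by
  rw [List.ofFn_eq_map, ← List.map_coe_finRange_eq_range, List.map_map]
  rfl

theorem eval_readNext (σ : State A D) (hz : σ.reg Q.m = Word.sym 0) :
    ∃ f a inp, (readNext (Q := Q)).eval g σ = { σ with reg := f, acc := a, input := inp } ∧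
      f Q.m = σ.reg Q.m ∧ f (Q.m + 1) = σ.reg (Q.m + 1) ∧
      (σ.input = [] → f (2 * Q.m + 6) = Word.sym 0) ∧
      ∀ (i : Fin Q.n) (v : Fin Q.m → Word A) p rest, σ.input = record i v p :: rest → f (2 * Q.m + 6) = Word.sym 1 ∧
        f (Q.m + 2) = Word.sym (i + 1) ∧ valOf f = v ∧ a 0 = p ∧ inp = rest := by
  rcases hin : σ.input with _ | ⟨⟨ws, d⟩, inp⟩
  · have h1 : ∀ r, r ≠ Q.m + 2 → ¬ r < Q.m → assign σ.reg (recRegs Q) [] r = σ.reg r := by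
      intro r h h'
      rw [assign_nil, if_neg (by rw [mem_recRegs]; omega)]
    have h2 : assign σ.reg (recRegs Q) [] (Q.m + 2) = Word.sym 0 := by
      rw [assign_nil, if_pos (by rw [mem_recRegs]; omega)]
    refine ⟨Function.update (Function.update (assign σ.reg (recRegs Q) []) (2 * Q.m + 6)
      (Word.sym 1)) (2 * Q.m + 6) (Word.sym 0), Function.update σ.acc 0 0, [], ?_, ?_, ?_, ?_, ?_⟩
    · have hm := (h1 Q.m (by omega) (by omega)).trans hz
      simp only [readNext, seqs, Prog.eval, Instr.step, hin, Cond.holds]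
      rw [if_pos]
      rw [Function.update_of_ne (by omega), Function.update_of_ne (by omega), h2, hm]
    · rw [Function.update_of_ne (by omega), Function.update_of_ne (by omega),
        h1 _ (by omega) (by omega)]
    · rw [Function.update_of_ne (by omega), Function.update_of_ne (by omega),
        h1 _ (by omega) (by omega)]
    · intro _; simp
    · rintro i v p rest ⟨⟩
  · by_cases hr : ∃ (i : Fin Q.n) (v : Fin Q.m → Word A), ws = Word.sym (i + 1) :: List.ofFn v
    · obtain ⟨i, v, rfl⟩ := hr
      have h1 := map_assign (recRegs_nodup (Q := Q)) (ws := Word.sym (i + 1) :: List.ofFn v)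
        (by simp [recRegs_length]) σ.reg
      have h2 : ∀ r, r ∉ recRegs Q → assign σ.reg (recRegs Q) (Word.sym (i + 1) :: List.ofFn v) r =
          σ.reg r := fun r => assign_of_notMem _ _
      rw [recRegs, List.map_cons, List.cons.injEq, range_map_eq_ofFn, List.ofFn_inj] at h1
      change assign σ.reg (recRegs Q) _ _ = _ ∧ valOf (assign σ.reg (recRegs Q) _) = _ at h1
      have hm := h2 Q.m (by rw [mem_recRegs]; omega)
      refine ⟨Function.update (assign σ.reg (recRegs Q) (Word.sym (i + 1) :: List.ofFn v))
        (2 * Q.m + 6) (Word.sym 1), Function.update σ.acc 0 d, inp, ?_, ?_, ?_, by simp, ?_⟩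
      · simp only [readNext, seqs, Prog.eval, Instr.step, hin, Cond.holds]
        rw [if_neg]
        rw [Function.update_of_ne (by omega), Function.update_of_ne (by omega), h1.1, hm, hz]
        simp
      · rw [Function.update_of_ne (by omega), hm]
      · rw [Function.update_of_ne (by omega), h2 _ (by rw [mem_recRegs]; omega)]
      · intro j w p rest h
        simp only [record, List.cons.injEq, Prod.mk.injEq, Word.sym.injEq, List.ofFn_inj] at h
        obtain ⟨⟨⟨h3, rfl⟩, rfl⟩, rfl⟩ := h
        refine ⟨by simp, ?_, ?_, by simp, rfl⟩
        · rw [Function.update_of_ne (by omega), h1.1, h3]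
        · funext x
          rw [valOf, Function.update_of_ne (by omega)]
          exact congrFun h1.2 x
    · have h1 : ∀ r, r ∉ recRegs Q → assign σ.reg (recRegs Q) ws r = σ.reg r := fun r =>
        assign_of_notMem _ _
      have h3 : ∃ f, (readNext (Q := Q)).eval g σ =
          { σ with reg := f, acc := Function.update σ.acc 0 d, input := inp } ∧
          ∀ r, r ≠ 2 * Q.m + 6 → f r = assign σ.reg (recRegs Q) ws r := by
        simp only [readNext, seqs, Prog.eval, Instr.step, hin]
        split_ifs
        · exact ⟨_, rfl, fun r hr => by
            rw [Function.update_of_ne hr, Function.update_of_ne hr]⟩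
        · exact ⟨_, rfl, fun r hr => by rw [Function.update_of_ne hr]⟩
      obtain ⟨f, e, hf⟩ := h3
      refine ⟨f, _, _, e, ?_, ?_, by simp, ?_⟩
      · rw [hf _ (by omega), h1 _ (by rw [mem_recRegs]; omega)]
      · rw [hf _ (by omega), h1 _ (by rw [mem_recRegs]; omega)]
      · intro i v p rest h
        simp only [record, List.cons.injEq, Prod.mk.injEq] at h
        exact absurd ⟨i, v, h.1.1⟩ hr

theorem eval_seqs_append (l l' : List (Prog (Fin Q.m))) (σ : State A D) :
    (seqs (l ++ l')).eval g σ = (seqs l').eval g ((seqs l).eval g σ) := by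
  induction l generalizing σ with
  | nil => rfl
  | cons P l ih => exact ih _

theorem eval_onTag (f : Fin Q.n → Prog (Fin Q.m)) (i : Fin Q.n) (σ : State A D)
    (hi : σ.reg (Q.m + 2) = Word.sym (i + 1)) :
    ∃ f₀, (∀ r, r ≠ 2 * Q.m + 4 → f₀ r = σ.reg r) ∧
      ∀ τ, (f i).eval g { σ with reg := f₀ } = τ → τ.reg (Q.m + 2) = Word.sym (i + 1) →
      ∃ f₁, (onTag f).eval g σ = { τ with reg := f₁ } ∧ ∀ r, r ≠ 2 * Q.m + 4 → f₁ r = τ.reg r := by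
  have skip : ∀ l : List (Fin Q.n), i ∉ l → ∀ σ : State A D,
      σ.reg (Q.m + 2) = Word.sym (i + 1) → ∃ f₁, (seqs (l.map fun i : Fin Q.n =>
        Prog.seq (.instr (.const (2 * Q.m + 4) (i + 1)))
          (.ite (.eq (Q.m + 2) (2 * Q.m + 4)) (f i) .skip))).eval g σ = { σ with reg := f₁ } ∧
        ∀ r, r ≠ 2 * Q.m + 4 → f₁ r = σ.reg r := by
    intro l hl
    induction l with
    | nil => exact fun σ _ => ⟨_, rfl, fun _ _ => rfl⟩
    | cons j l ih =>
      intro σ hσ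
      rw [List.mem_cons, not_or] at hl
      obtain ⟨f₁, h1, h2⟩ := ih hl.2
        { σ with reg := Function.update σ.reg (2 * Q.m + 4) (Word.sym (j + 1)) }
        ((Function.update_of_ne (by omega) _ _).trans hσ)
      refine ⟨f₁, ?_, fun r hr => (h2 r hr).trans (Function.update_of_ne hr _ _)⟩
      rw [List.map_cons, seqs, Prog.eval, ← h1]
      congr 1
      simp only [Prog.eval, Instr.step, Cond.holds]
      refine if_neg ?_
      rw [Function.update_of_ne (by omega), hσ, Function.update_self]
      simp only [Word.sym.injEq, Nat.add_right_cancel_iff]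
      exact fun h => hl.1 (Fin.ext h)
  obtain ⟨l₁, l₂, hl⟩ := List.append_of_mem (List.mem_finRange i)
  have hn := List.nodup_finRange Q.n
  rw [hl] at hn
  have hl₁ : i ∉ l₁ := fun h => (List.nodup_append.1 hn).2.2 i h i (by simp) rfl
  have hl₂ : i ∉ l₂ := (List.nodup_cons.1 (List.nodup_append.1 hn).2.1).1
  obtain ⟨f₁, h1, h1'⟩ := skip l₁ hl₁ σ hi
  refine ⟨Function.update f₁ (2 * Q.m + 4) (Word.sym (i + 1)), fun r hr => ?_, fun τ hτ hτi => ?_⟩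
  · rw [Function.update_of_ne hr, h1' r hr]
  · obtain ⟨f₂, h2, h2'⟩ := skip l₂ hl₂ τ hτi
    refine ⟨f₂, ?_, h2'⟩
    rw [onTag, hl, List.map_append, eval_seqs_append, h1, List.map_cons, seqs, Prog.eval, ← h2]
    congr 1
    simp only [Prog.eval, Instr.step, Cond.holds]
    refine (if_pos ?_).trans hτ
    · rw [Function.update_of_ne (by omega), Function.update_self, h1' _ (by omega), hi]

variable (ω : VarOrder Q)

theorem eval_addRel (i : Fin Q.n) (σ : State A D) (hz : σ.reg Q.m = Word.sym 0) :
    ∃ a P, (addRel i).eval g σ = { σ with acc := a, pdict := P } ∧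
      (∀ j v, ω.tbl P (.rel j) v =
        addTo (fun j v => ω.tbl σ.pdict (.rel j) v) i (valOf σ.reg) (σ.acc 0) j v) ∧
      ∀ x v, ω.tbl P (.H x) v = ω.tbl σ.pdict (.H x) v ∧
        ω.tbl P (.V x) v = ω.tbl σ.pdict (.V x) v := by
  refine ⟨_, _, rfl, fun j v => ?_, fun x v => ⟨?_, ?_⟩⟩
  · simp only [Prog.eval, Instr.step, keyRegs_map _ _ hz, VarOrder.tbl, VarOrder.schema, addTo]
    by_cases h : j = i
    · subst h
      by_cases h' : Agree (Q.sch j) v (valOf σ.reg)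
      · rw [Function.update_self, kw_eq_iff.2 h', Function.update_self, if_pos ⟨rfl, h'⟩]
        simp
      · rw [Function.update_self, Function.update_of_ne (mt kw_eq_iff.1 h'),
          if_neg fun h => h' h.2, add_zero]
    · rw [Function.update_of_ne (fun e => h (View.rel.inj (table_injective e))),
        if_neg fun h' => h h'.1, add_zero]
  · simp only [Prog.eval, Instr.step, VarOrder.tbl]
    rw [Function.update_of_ne fun e => by cases table_injective e]
  · simp only [Prog.eval, Instr.step, VarOrder.tbl]
    rw [Function.update_of_ne fun e => by cases table_injective e]

/-- If `P` processes one record within `c` steps, then `loadAll P` processes the whole input in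
linear time. -/
theorem loadAll_exec {P : Prog (Fin Q.m)} {c : ℕ}
    (I : (Fin Q.n → (Fin Q.m → Word A) → D) → (ℕ → List (Word A) → D) →
      (ℕ → List (Word A) → Word A) → Prop)
    (hP : ∀ R (σ : State A D) (i : Fin Q.n), I R σ.pdict σ.dict → σ.reg Q.m = Word.sym 0 →
      σ.reg (Q.m + 1) = Word.sym 1 → σ.reg (Q.m + 2) = Word.sym (i + 1) →
      Typed i (valOf σ.reg) → ∃ tr σ', Exec g P σ tr σ' ∧ tr.length ≤ c ∧
        σ'.reg Q.m = Word.sym 0 ∧ σ'.reg (Q.m + 1) = Word.sym 1 ∧ σ'.input = σ.input ∧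
        I (addTo R i (valOf σ.reg) (σ.acc 0)) σ'.pdict σ'.dict)
    (recs : List (Fin Q.n × (Fin Q.m → Word A) × D)) (ht : ∀ e ∈ recs, Typed e.1 e.2.1)
    (R : Fin Q.n → (Fin Q.m → Word A) → D) (σ : State A D) (hI : I R σ.pdict σ.dict)
    (hz : σ.reg Q.m = Word.sym 0) (ho : σ.reg (Q.m + 1) = Word.sym 1)
    (hin : σ.input = recs.map fun e => record e.1 e.2.1 e.2.2) :
    ∃ tr σ', Exec g (loadAll P) σ tr σ' ∧
      tr.length ≤ ((readNext (Q := Q)).cost + c + 1) * (recs.length + 1) ∧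
      σ'.reg Q.m = Word.sym 0 ∧ σ'.reg (Q.m + 1) = Word.sym 1 ∧
      I (recs.foldl (fun R e => addTo R e.1 e.2.1 e.2.2) R) σ'.pdict σ'.dict := by
  induction recs generalizing R σ with
  | nil =>
    obtain ⟨f, a, inp, e1, h1, h2, h3, -⟩ := eval_readNext g σ hz
    obtain ⟨tr, x1, hl, -⟩ := straight_readNext.exec g σ
    rw [e1] at x1
    refine ⟨_, _, Exec.seq x1 (Exec.loop_done ?_), ?_, h1.trans hz, h2.trans ho, hI⟩
    · simp only [Cond.holds]
      rw [h3 hin, h2, ho]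
      simp
    · simp; omega
  | cons e recs ih =>
    obtain ⟨i, v, p⟩ := e
    obtain ⟨f, a, inp, e1, h1, h2, -, h3⟩ := eval_readNext g σ hz
    obtain ⟨h4, h5, rfl, rfl, rfl⟩ := h3 i v p _ hin
    obtain ⟨tr, x1, hl, -⟩ := straight_readNext.exec g σ
    rw [e1] at x1
    obtain ⟨tr₂, σ₂, x2, l2, z2, o2, in2, I2⟩ := hP R
      { σ with reg := f, acc := a, input := recs.map fun e => record e.1 e.2.1 e.2.2 } i hI
      (h1.trans hz) (h2.trans ho) h5 (ht (i, valOf f, a 0) (by simp))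
    obtain ⟨tr₃, σ₃, x3, l3, z3, o3, I3⟩ := ih (fun e he => ht e (by simp [he])) _ σ₂ I2 z2 o2 in2
    rw [loadAll] at x3
    cases x3 with
    | seq y1 y2 =>
      refine ⟨_, _, Exec.seq x1 (Exec.loop_step ?_ (Exec.seq x2 y1) y2), ?_, z3, o3, I3⟩
      · simp only [Cond.holds]
        rw [h4, h2, ho]
      · simp only [List.length_append, List.length_cons] at l3 ⊢
        rw [mul_add _ (recs.length + 1)]
        omega

end Updates

namespace VarOrder

variable {Q : Query} (ω : VarOrder Q)

/-! ### Updates along a path of the variable order -/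

/-- The variables of the relation `i`, descendants first. -/
def bottomUp (i : Fin Q.n) : List (Fin Q.m) := ω.order.reverse.filter (· ∈ Q.sch i)

/-- Add the current record to its relation, and refresh the views of the variables of the relation
at the updated tuple. -/
def updatePath : Prog (Fin Q.m) :=
  onTag fun i => .seq (addRel i) (seqs ((ω.bottomUp i).map ω.refresh))

/-- The variables of every relation are closed under ancestors. -/
def PathClosed : Prop := ∀ i, ∀ x ∈ Q.sch i, ∀ p, ω.parent x = some p → p ∈ Q.sch i

theorem straight_updatePath : ω.updatePath.Straight :=
  straight_onTag fun i => ⟨straight_addRel i, straight_seqs.2 fun P hP => by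
    obtain ⟨x, -, rfl⟩ := List.mem_map.1 hP
    exact ω.straight_refresh x⟩

theorem mem_bottomUp {i : Fin Q.n} {x : Fin Q.m} : x ∈ ω.bottomUp i ↔ x ∈ Q.sch i := by
  simp [bottomUp, ω.mem_order]

theorem order_reverse_pairwise : ω.order.reverse.Pairwise fun a b => ¬ ω.Anc a b :=
  List.pairwise_reverse.2 ω.order_pairwise

variable {A : Type u} {D : Type v} [CommRing D] (g : Fin Q.m → A → D)

/-- The hash maps store the relations `R` and all views over them. -/
structure Stored (R : Fin Q.n → (Fin Q.m → Word A) → D) (P : ℕ → List (Word A) → D)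
    (F : ℕ → List (Word A) → Word A) : Prop where
  rel : ∀ i v, ω.tbl P (.rel i) v = R i v
  sound : ω.Sound g P F
  fresh : ∀ x v, ω.Fresh P F x v

variable {ω} {P P' : ℕ → List (Word A) → D} {F : ℕ → List (Word A) → Word A}

theorem Sound.congr_payload (h : ω.Sound g P F)
    (hHV : ∀ x v, ω.tbl P' (.H x) v = ω.tbl P (.H x) v ∧ ω.tbl P' (.V x) v = ω.tbl P (.V x) v) :
    ω.Sound g P' F where
  cycle := h.cycle
  finite x v := by simpa only [(hHV _ _).1] using h.finite x v
  sum x v := by simpa only [(hHV _ _).1, (hHV _ _).2] using h.sum x v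

theorem Fresh.congr_payload {x : Fin Q.m} {v : Fin Q.m → Word A} (h : ω.Fresh P F x v)
    (hHV : ∀ x v, ω.tbl P' (.H x) v = ω.tbl P (.H x) v ∧ ω.tbl P' (.V x) v = ω.tbl P (.V x) v)
    (hR : ∀ i ∈ ω.relsAt x, ω.tbl P' (.rel i) v = ω.tbl P (.rel i) v) : ω.Fresh P' F x v := by
  have hw : ∀ w ∈ ω.childViews x, ω.tbl P' w v = ω.tbl P w v := by
    intro w hw
    rcases ω.mem_childViews.1 hw with ⟨i, hi, rfl⟩ | ⟨z, hz, rfl⟩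
    · exact hR i hi
    · exact (hHV z v).2
  refine ⟨?_, h.2.trans (and_congr_right fun _ => and_congr_right fun _ => and_congr_left fun _ =>
    forall₂_congr fun w hw' => by rw [hw w (ω.boundViews_subset hw')])⟩
  rw [(hHV x v).1, h.1]
  exact congrArg List.prod (List.map_congr_left fun w hw' => (hw w hw').symm)

/-- Refreshing, bottom-up, a chain of variables that is closed under parents repairs all views. -/
theorem refresh_chain (L : List (Fin Q.m)) (hn : L.Nodup)
    (hpw : L.Pairwise fun a b => ¬ ω.Anc a b)
    (hpar : ∀ x ∈ L, ∀ y, ω.parent x = some y → y ∈ L ∧ ω.scope y ⊆ ω.dep x)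
    (σ : State A D) (hz : σ.reg Q.m = Word.sym 0) (ho : σ.reg (Q.m + 1) = Word.sym 1)
    (hs : ω.Sound g σ.pdict σ.dict)
    (hf : ∀ y v, ω.Fresh σ.pdict σ.dict y v ∨ (y ∈ L ∧ Agree (ω.scope y) v (valOf σ.reg))) :
    ∃ f a P F, (seqs (L.map ω.refresh)).eval g σ =
        { σ with reg := f, acc := a, pdict := P, dict := F } ∧
      (∀ r < 2 * Q.m + 4, f r = σ.reg r) ∧
      (∀ i v, ω.tbl P (.rel i) v = ω.tbl σ.pdict (.rel i) v) ∧ ω.Sound g P F ∧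
      ∀ x v, ω.Fresh P F x v := by
  induction L generalizing σ with
  | nil =>
    exact ⟨_, _, _, _, rfl, fun _ _ => rfl, fun _ _ => rfl, hs, fun y v =>
      (hf y v).resolve_right (by simp)⟩
  | cons x L ih =>
    obtain ⟨hx, hn⟩ := List.nodup_cons.1 hn
    obtain ⟨hxp, hpw⟩ := List.pairwise_cons.1 hpw
    obtain ⟨f, a, P, F, e, h1, hc, hs', hfx⟩ := ω.refresh_spec g x σ hz ho hs
    have hv : valOf (Q := Q) f = valOf σ.reg := funext fun y => h1 y (by omega)
    obtain ⟨f', a', P', F', e', h1', h2', h3'⟩ := ih hn hpw (fun z hz y hy => by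
        obtain ⟨h, h'⟩ := hpar z (by simp [hz]) y hy
        refine ⟨(List.mem_cons.1 h).resolve_left ?_, h'⟩
        rintro rfl
        exact hxp z hz (ω.anc_of_parent hy))
      { σ with reg := f, acc := a, pdict := P, dict := F } ((h1 _ (by omega)).trans hz)
      ((h1 _ (by omega)).trans ho) hs' (by
        intro y v
        simp only [hv]
        by_cases hy : y = x ∧ Agree (ω.scope x) v (valOf σ.reg)
        · obtain ⟨rfl, h⟩ := hy
          exact Or.inl (hfx.congr h.symm)
        · by_cases hp : ω.parent x = some y ∧ Agree (ω.dep x) v (valOf σ.reg)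
          · obtain ⟨h, h'⟩ := hpar x (by simp) y hp.1
            exact Or.inr ⟨(List.mem_cons.1 h).resolve_left (ne_of_parent hp.1).symm,
              hp.2.mono h'⟩
          · rcases hf y v with h | ⟨h, h'⟩
            · exact Or.inl (hc.fresh h (fun e h' => hy ⟨e, h'⟩) fun e h' => hp ⟨e, h'⟩)
            · refine Or.inr ⟨(List.mem_cons.1 h).resolve_left ?_, h'⟩
              rintro rfl
              exact hy ⟨rfl, h'⟩)
    refine ⟨f', a', P', F', ?_, fun r hr => (h1' r hr).trans (h1 r hr),
      fun i v => (h2' i v).trans (hc.rel i v), h3'⟩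
    rw [List.map_cons, seqs, Prog.eval, e, e']

theorem PathClosed.mem (hpc : ω.PathClosed) {i : Fin Q.n} {x y : Fin Q.m} (hx : x ∈ Q.sch i)
    (h : ω.Anc y x) : y ∈ Q.sch i := by
  induction h using Relation.TransGen.head_induction_on with
  | single h => exact hpc i x hx _ h
  | head h _ ih => exact hpc i _ ih _ h

theorem updatePath_spec (hpc : ω.PathClosed) (R : Fin Q.n → (Fin Q.m → Word A) → D)
    (σ : State A D) (i : Fin Q.n) (hI : ω.Stored g R σ.pdict σ.dict)
    (hz : σ.reg Q.m = Word.sym 0) (ho : σ.reg (Q.m + 1) = Word.sym 1)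
    (hi : σ.reg (Q.m + 2) = Word.sym (i + 1)) :
    ∃ tr σ', Exec g ω.updatePath σ tr σ' ∧ tr.length ≤ ω.updatePath.cost ∧
      σ'.reg Q.m = Word.sym 0 ∧ σ'.reg (Q.m + 1) = Word.sym 1 ∧ σ'.input = σ.input ∧
      ω.Stored g (addTo R i (valOf σ.reg) (σ.acc 0)) σ'.pdict σ'.dict := by
  obtain ⟨f₀, h0, hrun⟩ := eval_onTag g
    (fun i => .seq (addRel i) (seqs ((ω.bottomUp i).map ω.refresh))) i σ hi
  have hv : valOf (Q := Q) f₀ = valOf σ.reg := funext fun y => h0 y (by omega)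
  have hz0 : f₀ Q.m = Word.sym 0 := (h0 _ (by omega)).trans hz
  obtain ⟨a, P, e1, hrel, hHV⟩ := eval_addRel g ω i { σ with reg := f₀ } hz0
  simp only [hv] at hrel
  obtain ⟨f, a', P', F', e2, h1, h2, h3, h4⟩ := refresh_chain g (ω.bottomUp i)
    ((List.nodup_reverse.2 ω.order_nodup).filter _) (ω.order_reverse_pairwise.filter _)
    (fun x hx y hy => by
      rw [mem_bottomUp] at hx ⊢
      refine ⟨hpc i x hx y hy, fun z hz => ?_⟩
      have hzx : ω.Anc z x := by
        rcases ω.mem_scope hz with rfl | h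
        · exact ω.anc_of_parent hy
        · exact Anc.trans ω h (ω.anc_of_parent hy)
      exact ω.mem_dep.2 ⟨hzx, x, Or.inl rfl, i, hpc.mem hx hzx, hx⟩)
    { σ with reg := f₀, acc := a, pdict := P } hz0 ((h0 _ (by omega)).trans ho)
    (hI.sound.congr_payload g hHV) (by
      intro y v
      simp only [hv]
      by_cases h : i ∈ ω.relsAt y ∧ Agree (Q.sch i) v (valOf σ.reg)
      · have hy := (ω.mem_relsAt.1 h.1).1
        refine Or.inr ⟨ω.mem_bottomUp.2 hy, h.2.mono fun z hz => ?_⟩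
        rcases ω.mem_scope hz with rfl | h'
        · exact hy
        · exact hpc.mem hy h'
      · refine Or.inl ((hI.fresh y v).congr_payload hHV fun j hj => ?_)
        rw [hrel, addTo, if_neg, add_zero]
        rintro ⟨rfl, h'⟩
        exact h ⟨hj, h'⟩)
  obtain ⟨f₁, e3, h5⟩ := hrun _ (by rw [Prog.eval, e1, e2])
    ((h1 _ (by omega)).trans ((h0 _ (by omega)).trans hi))
  obtain ⟨tr, x, hl, -⟩ := ω.straight_updatePath.exec g σ
  rw [updatePath, e3] at x
  refine ⟨tr, _, x, hl, ?_, ?_, rfl, fun j v => ?_, h3, h4⟩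
  · exact (h5 _ (by omega)).trans ((h1 _ (by omega)).trans hz0)
  · exact (h5 _ (by omega)).trans ((h1 _ (by omega)).trans ((h0 _ (by omega)).trans ho))
  · refine (h2 j v).trans ((hrel j v).trans ?_)
    simp only [addTo]
    rw [hI.rel]

theorem sound_zero : ω.Sound g (fun _ _ => (0 : D)) (fun _ _ => Word.sym 0) where
  cycle _ c _ := ⟨[], Lst.isCycle_nil c⟩
  finite x v := by simp [tbl]
  sum x v := by simp [tbl]

theorem not_listed_zero (x : Fin Q.m) (v : Fin Q.m → Word A) :
    ¬ ω.Listed (fun _ _ => Word.sym 0) x v := by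
  simp [Listed]

theorem exists_child (x : Fin Q.m) : (∃ i, i ∈ ω.relsAt x) ∨ ∃ y, ω.parent y = some x := by
  obtain ⟨i, hi⟩ := Q.covered x
  obtain ⟨o, ho⟩ := ω.exists_mem_relsUnder i
  rcases o with _ | z
  · simp only [relsUnder, Finset.mem_filter] at ho
    simp [ho.2] at hi
  · rcases (ω.mem_relsAt.1 ho).2 x hi with rfl | h
    · exact Or.inl ⟨i, ho⟩
    · obtain ⟨y, hy, -⟩ := Relation.TransGen.head'_iff.1 h
      exact Or.inr ⟨y, hy⟩

/-- Empty hash maps store empty relations. -/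
theorem stored_zero : ω.Stored g (fun _ _ => 0) (fun _ _ => (0 : D)) (fun _ _ => Word.sym 0) := by
  refine ⟨fun _ _ => rfl, sound_zero g, fun x v => ⟨?_, ?_⟩⟩
  · refine (List.prod_eq_zero (List.mem_map.2 ?_)).symm
    rcases ω.exists_child x with ⟨i, hi⟩ | ⟨y, hy⟩
    · exact ⟨.rel i, ω.mem_childViews.2 (Or.inl ⟨i, hi, rfl⟩), rfl⟩
    · exact ⟨.V y, ω.mem_childViews.2 (Or.inr ⟨y, hy, rfl⟩), rfl⟩
  · refine iff_of_false (not_listed_zero x v) fun h => ?_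
    rcases ω.exists_child x with ⟨i, hi⟩ | ⟨y, hy⟩
    · exact h.2.2.1 (.rel i) (ω.mem_boundViews.2 (Or.inl ⟨i, hi, rfl⟩)) rfl
    · by_cases hyf : y ∈ Q.free
      · obtain ⟨a, ha⟩ := h.2.2.2 y (ω.mem_freeChildren.2 ⟨hy, hyf⟩)
        exact not_listed_zero y _ ha
      · exact h.2.2.1 (.V y) (ω.mem_boundViews.2 (Or.inr ⟨y, hy, hyf, rfl⟩)) rfl

end VarOrder

section Log

variable {Q : Query}

/-! ### The log of all keys -/

/-- The list of the keys of all relations, tagged by their relation. -/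
def log (Q : Query) : Lst := ⟨Q.m, Q.m, [], recRegs Q⟩

/-- The registers for a copy of a record. -/
def copyRegs (Q : Query) : List ℕ := (List.range (Q.m + 1)).map fun j => Q.m + 3 + j

/-- Add the current record to the log. -/
def markRec : Prog (Fin Q.m) := .seq (.instr (.const (2 * Q.m + 4) 1)) (log Q).set

/-- Keep the current record in the log iff its payload in the relation `i` is nonzero. -/
def syncRec (i : Fin Q.n) : Prog (Fin Q.m) := seqs [
  .instr (.pload 0 (table (.rel i)) (keyRegs (Q.sch i))),
  .instr (.const (2 * Q.m + 4) 1),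
  .ite (.isZero 0) (.instr (.const (2 * Q.m + 4) 0)) .skip,
  (log Q).set]

/-- Add the current record to its relation, without updating the views. -/
def loadRec : Prog (Fin Q.m) := onTag fun i => .seq (addRel i) (syncRec i)

theorem log_wf : (log Q).WF where
  kc_lt := by simp [log]
  es_lt r hr := by
    have := mem_recRegs.1 hr
    simp only [log]; omega
  nodup := recRegs_nodup
  zero h := by have := mem_recRegs.1 h; simp only [log] at this; omega

theorem mem_copyRegs {r : ℕ} : r ∈ copyRegs Q ↔ Q.m + 3 ≤ r ∧ r < 2 * Q.m + 4 := by
  simp only [copyRegs, List.mem_map, List.mem_range]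
  constructor
  · rintro ⟨j, hj, rfl⟩; omega
  · intro h; exact ⟨r - (Q.m + 3), by omega, by omega⟩

theorem copyRegs_nodup : (copyRegs Q).Nodup :=
  List.nodup_range.map fun a b h => by simpa using h

theorem copyRegs_length : (copyRegs Q).length = (recRegs Q).length := by
  simp [copyRegs, recRegs_length]

variable {A : Type u} {D : Type v} [CommRing D] (g : Fin Q.m → A → D)

/-- The entry of the log for the key `v` of the relation `i`. -/
def entryWord (i : Fin Q.n) (v : Fin Q.m → Word A) : List (Word A) :=
  Word.sym (i + 1) :: kw (Q.sch i) v

/-- The valuation in an entry of the log. -/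
def wordVal (w : List (Word A)) (x : Fin Q.m) : Word A := w.getD (x + 1) (Word.sym 0)

theorem agree_wordVal (i : Fin Q.n) (v : Fin Q.m → Word A) :
    Agree (Q.sch i) v (wordVal (entryWord i v)) := by
  intro x hx
  simp [wordVal, entryWord, kw, hx]

theorem entryWord_inj {i j : Fin Q.n} {v u : Fin Q.m → Word A} :
    entryWord j u = entryWord i v ↔ j = i ∧ Agree (Q.sch i) u v := by
  simp only [entryWord, List.cons.injEq, Word.sym.injEq, Nat.add_right_cancel_iff, Fin.val_inj]
  constructor
  · rintro ⟨rfl, h⟩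
    exact ⟨rfl, kw_eq_iff.1 h⟩
  · rintro ⟨rfl, h⟩
    exact ⟨rfl, kw_eq_iff.2 h⟩

theorem recRegs_map (f : ℕ → Word A) :
    (recRegs Q).map f = f (Q.m + 2) :: List.ofFn (valOf (Q := Q) f) := by
  rw [recRegs, List.map_cons, range_map_eq_ofFn]

theorem wordVal_recRegs (f : ℕ → Word A) : wordVal ((recRegs Q).map f) = valOf (Q := Q) f := by
  funext x
  simp [recRegs_map, wordVal]

theorem recRegs_map_typed {f : ℕ → Word A} {i : Fin Q.n} (hi : f (Q.m + 2) = Word.sym (i + 1))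
    (ht : Typed i (valOf f)) : (recRegs Q).map f = entryWord i (valOf f) := by
  rw [recRegs_map, hi, ht.ofFn, entryWord]

theorem set_log (σ : State A D) (hz : σ.reg Q.m = Word.sym 0) (ho : σ.reg (Q.m + 1) = Word.sym 1)
    {i : Fin Q.n} (hi : σ.reg (Q.m + 2) = Word.sym (i + 1)) (ht : Typed i (valOf σ.reg))
    {l : List (List (Word A))} (hl : (log Q).IsCycle σ.dict [] l) (b : Prop)
    (hb : σ.reg (2 * Q.m + 4) = if b then Word.sym 1 else Word.sym 0) :
    ∃ f F l', (log Q).set.eval g σ = { σ with reg := f, dict := F } ∧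
      (∀ r < 2 * Q.m + 4, f r = σ.reg r) ∧ (∀ d, d.unpair.1 ≠ Q.m → F d = σ.dict d) ∧
      (log Q).IsCycle F [] l' ∧
      ∀ w, w ∈ l' ↔ if w = entryWord i (valOf σ.reg) then b else w ∈ l := by
  have hw : (log Q).es.map σ.reg = entryWord i (valOf σ.reg) := recRegs_map_typed hi ht
  obtain ⟨f, F, l', e, h1, h2, h3, h4⟩ := Lst.set_spec g log_wf σ hz ho hl b hb (fun _ => by
    rw [hw]; simp [entryWord])
  refine ⟨f, F, l', e, fun r hr => h1 r (by simp only [log]; omega), h2.1, h3, ?_⟩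
  rwa [hw] at h4

theorem straight_syncRec (i : Fin Q.n) : (syncRec i).Straight := by
  simp [syncRec, straight_seqs, Prog.Straight, Lst.straight_set]

theorem straight_markRec : (markRec (Q := Q)).Straight := ⟨trivial, Lst.straight_set _⟩

theorem eval_markRec (σ : State A D) (hz : σ.reg Q.m = Word.sym 0)
    (ho : σ.reg (Q.m + 1) = Word.sym 1) {i : Fin Q.n} (hi : σ.reg (Q.m + 2) = Word.sym (i + 1))
    (ht : Typed i (valOf σ.reg)) {l : List (List (Word A))} (hl : (log Q).IsCycle σ.dict [] l) :
    ∃ f F l', markRec.eval g σ = { σ with reg := f, dict := F } ∧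
      (∀ r < 2 * Q.m + 4, f r = σ.reg r) ∧ (∀ d, d.unpair.1 ≠ Q.m → F d = σ.dict d) ∧
      (log Q).IsCycle F [] l' ∧ ∀ w, w ∈ l' ↔ w = entryWord i (valOf σ.reg) ∨ w ∈ l := by
  have h0 : ∀ r < 2 * Q.m + 4,
      Function.update σ.reg (2 * Q.m + 4) (Word.sym 1) r = σ.reg r := fun r hr =>
    Function.update_of_ne (by omega) _ _
  have hv : valOf (Q := Q) (Function.update σ.reg (2 * Q.m + 4) (Word.sym 1)) = valOf σ.reg :=
    funext fun y => h0 y (by omega)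
  obtain ⟨f, F, l', e, h1, h2, h3, h4⟩ := set_log g
    { σ with reg := Function.update σ.reg (2 * Q.m + 4) (Word.sym 1) } ((h0 _ (by omega)).trans hz)
    ((h0 _ (by omega)).trans ho) ((h0 _ (by omega)).trans hi) (by rwa [hv]) hl True (by simp)
  refine ⟨f, F, l', e, fun r hr => (h1 r hr).trans (h0 r hr), h2, h3, fun w => ?_⟩
  rw [h4]
  simp only [hv]
  split_ifs with h <;> simp [h]

variable (ω : VarOrder Q)

theorem eval_syncRec (σ : State A D) (hz : σ.reg Q.m = Word.sym 0)
    (ho : σ.reg (Q.m + 1) = Word.sym 1) {i : Fin Q.n} (hi : σ.reg (Q.m + 2) = Word.sym (i + 1))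
    (ht : Typed i (valOf σ.reg)) {l : List (List (Word A))} (hl : (log Q).IsCycle σ.dict [] l) :
    ∃ f a F l', (syncRec i).eval g σ = { σ with reg := f, acc := a, dict := F } ∧
      (∀ r < 2 * Q.m + 4, f r = σ.reg r) ∧ (∀ d, d.unpair.1 ≠ Q.m → F d = σ.dict d) ∧
      (log Q).IsCycle F [] l' ∧ ∀ w, w ∈ l' ↔ if w = entryWord i (valOf σ.reg) then
        ω.tbl σ.pdict (.rel i) (valOf σ.reg) ≠ 0 else w ∈ l := by
  obtain ⟨b, hb⟩ : ∃ b : Prop, b = (ω.tbl σ.pdict (.rel i) (valOf σ.reg) ≠ 0) := ⟨_, rfl⟩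
  have h0 : ∃ f a, (∀ r < 2 * Q.m + 4, f r = σ.reg r) ∧
      f (2 * Q.m + 4) = (if b then Word.sym 1 else Word.sym 0) ∧
      (syncRec i).eval g σ = (log Q).set.eval g { σ with reg := f, acc := a } := by
    simp only [syncRec, seqs, Prog.eval, Instr.step, Cond.holds, Function.update_self,
      keyRegs_map _ _ hz]
    change ∃ f a, _ ∧ _ ∧ Prog.eval g (log Q).set
      (if ω.tbl σ.pdict (.rel i) (valOf σ.reg) = 0 then _ else _) = _
    by_cases h : ω.tbl σ.pdict (.rel i) (valOf σ.reg) = 0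
    · rw [if_pos h]
      exact ⟨_, _, fun r hr => by
        rw [Function.update_of_ne (by omega), Function.update_of_ne (by omega)], by
        simp [hb, h], rfl⟩
    · rw [if_neg h]
      exact ⟨_, _, fun r hr => by rw [Function.update_of_ne (by omega)], by simp [hb, h], rfl⟩
  obtain ⟨f, a, h0, h0', e0⟩ := h0
  have hv : valOf (Q := Q) f = valOf σ.reg := funext fun y => h0 y (by omega)
  obtain ⟨f', F, l', e, h1, h2, h3, h4⟩ := set_log g { σ with reg := f, acc := a }
    ((h0 _ (by omega)).trans hz) ((h0 _ (by omega)).trans ho) ((h0 _ (by omega)).trans hi)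
    (by rwa [hv]) hl b h0'
  refine ⟨f', a, F, l', e0.trans e, fun r hr => (h1 r hr).trans (h0 r hr), h2, h3, fun w => ?_⟩
  rw [h4]
  simp only [hv, hb]

/-- The log lists exactly the keys of the relations `R`. -/
def Logs (R : Fin Q.n → (Fin Q.m → Word A) → D) (l : List (List (Word A))) : Prop :=
  ∀ w, w ∈ l ↔ ∃ i v, w = entryWord i v ∧ R i v ≠ 0

/-- The keys of the relations are data values. -/
def Valued (R : Fin Q.n → (Fin Q.m → Word A) → D) : Prop :=
  ∀ i v, R i v ≠ 0 → ∀ x ∈ Q.sch i, v x ≠ Word.sym 0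

theorem Valued.addTo {R : Fin Q.n → (Fin Q.m → Word A) → D} (h : Valued R) {i : Fin Q.n}
    {v : Fin Q.m → Word A} (ht : Typed i v) (p : D) : Valued (addTo R i v p) := by
  intro j u hu x hx
  by_cases hj : j = i ∧ Agree (Q.sch i) u v
  · obtain ⟨rfl, hj⟩ := hj
    rw [hj x hx]
    exact (ht x).2 hx
  · rw [FIVM.addTo, if_neg hj, add_zero] at hu
    exact h j u hu x hx

theorem Logs.addTo {R : Fin Q.n → (Fin Q.m → Word A) → D} {i : Fin Q.n} {v : Fin Q.m → Word A}
    {p : D} (hR : ∀ u, Agree (Q.sch i) u v → R i u = R i v) {l l' : List (List (Word A))}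
    (hl : ∀ w, w ≠ entryWord i v → (w ∈ l ↔ ∃ i v, w = entryWord i v ∧ R i v ≠ 0))
    (hl' : ∀ w, w ∈ l' ↔ if w = entryWord i v then addTo R i v p i v ≠ 0 else w ∈ l) :
    Logs (addTo R i v p) l' := by
  intro w
  rw [hl']
  split_ifs with h
  · constructor
    · exact fun h' => ⟨i, v, h, h'⟩
    · rintro ⟨j, u, rfl, hu⟩
      obtain ⟨rfl, ha⟩ := entryWord_inj.1 h
      rw [FIVM.addTo, if_pos ⟨rfl, ha⟩, hR u ha] at hu
      rwa [FIVM.addTo, if_pos ⟨rfl, agree_refl _ _⟩]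
  · rw [hl w h]
    refine exists_congr fun j => exists_congr fun u => and_congr_right ?_
    rintro rfl
    rw [FIVM.addTo, if_neg (mt entryWord_inj.2 h), add_zero]

theorem loadRec_spec (R : Fin Q.n → (Fin Q.m → Word A) → D)
    (σ : State A D) (i : Fin Q.n) (hz : σ.reg Q.m = Word.sym 0) (ho : σ.reg (Q.m + 1) = Word.sym 1)
    (hi : σ.reg (Q.m + 2) = Word.sym (i + 1)) (ht : Typed i (valOf σ.reg))
    (hR : ∀ i v, ω.tbl σ.pdict (.rel i) v = R i v) {l : List (List (Word A))}
    (hl : (log Q).IsCycle σ.dict [] l) (hm : Logs R l) :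
    ∃ tr σ', Exec g loadRec σ tr σ' ∧ tr.length ≤ (loadRec (Q := Q)).cost ∧
      σ'.reg Q.m = Word.sym 0 ∧ σ'.reg (Q.m + 1) = Word.sym 1 ∧ σ'.input = σ.input ∧
      (∀ d, d.unpair.1 ≠ Q.m → σ'.dict d = σ.dict d) ∧
      (∀ j v, ω.tbl σ'.pdict (.rel j) v = addTo R i (valOf σ.reg) (σ.acc 0) j v) ∧
      (∀ x v, ω.tbl σ'.pdict (.H x) v = ω.tbl σ.pdict (.H x) v ∧
        ω.tbl σ'.pdict (.V x) v = ω.tbl σ.pdict (.V x) v) ∧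
      ∃ l', (log Q).IsCycle σ'.dict [] l' ∧ Logs (addTo R i (valOf σ.reg) (σ.acc 0)) l' := by
  obtain ⟨f₀, h0, hrun⟩ := eval_onTag g (fun i => .seq (addRel i) (syncRec i)) i σ hi
  have hv : valOf (Q := Q) f₀ = valOf σ.reg := funext fun y => h0 y (by omega)
  have hz0 : f₀ Q.m = Word.sym 0 := (h0 _ (by omega)).trans hz
  have ho0 : f₀ (Q.m + 1) = Word.sym 1 := (h0 _ (by omega)).trans ho
  have hi0 : f₀ (Q.m + 2) = Word.sym (i + 1) := (h0 _ (by omega)).trans hi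
  obtain ⟨a, P, e1, hrel, hHV⟩ := eval_addRel g ω i { σ with reg := f₀ } hz0
  simp only [hv] at hrel
  have hrel' : ∀ j v, ω.tbl P (.rel j) v = addTo R i (valOf σ.reg) (σ.acc 0) j v := fun j v => by
    rw [hrel, addTo, addTo, hR]
  obtain ⟨f, a', F, l', e2, h1, h2, h3, h4⟩ := eval_syncRec g ω
    { σ with reg := f₀, acc := a, pdict := P } hz0 ho0 hi0 (by rwa [hv]) hl
  simp only [hv] at h4
  obtain ⟨f₁, e3, h5⟩ := hrun _ (by rw [Prog.eval, e1, e2]) ((h1 _ (by omega)).trans hi0)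
  obtain ⟨tr, x, hlen, -⟩ := (straight_onTag (f := fun i : Fin Q.n => .seq (addRel i) (syncRec i))
    fun i => ⟨straight_addRel i, straight_syncRec i⟩).exec g σ
  rw [e3] at x
  refine ⟨tr, _, x, hlen, ?_, ?_, rfl, h2, hrel', hHV, l', h3, ?_⟩
  · exact (h5 _ (by omega)).trans ((h1 _ (by omega)).trans hz0)
  · exact (h5 _ (by omega)).trans ((h1 _ (by omega)).trans ho0)
  · refine Logs.addTo (fun u hu => ?_) (fun w _ => hm w) (fun w => ?_)
    · rw [← hR, ← hR]
      exact VarOrder.tbl_congr hu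
    · rw [h4 w, hrel']

end Log

namespace VarOrder

variable {Q : Query} (ω : VarOrder Q)

/-! ### Propagating all keys through the views -/

/-- Refresh all views bottom-up, at all tuples that extend to a key in the log. -/
def passes : Prog (Fin Q.m) :=
  seqs (ω.order.reverse.map fun x => (log Q).forEach (ω.refresh x))

/-- The time per log entry of the passes for the variables in `L`. -/
def passCost (L : List (Fin Q.m)) : ℕ :=
  (L.map fun x => (log Q).gap + (ω.refresh x).cost).sum

/-- For every view there is a relation that contains all variables of the view. -/
def Anchored : Prop := ∀ x, ∃ i, ω.scope x ⊆ Q.sch i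

variable {A : Type u} {D : Type v} [CommRing D] (g : Fin Q.m → A → D)

/-- The hash maps store the relations `R` and the log `l`, and views that are nonzero only at tuples
that extend to an entry of the log. -/
structure Covered (R : Fin Q.n → (Fin Q.m → Word A) → D) (l : List (List (Word A)))
    (P : ℕ → List (Word A) → D) (F : ℕ → List (Word A) → Word A) : Prop where
  rel : ∀ i v, ω.tbl P (.rel i) v = R i v
  sound : ω.Sound g P F
  cycle : (log Q).IsCycle F [] l
  cover : ∀ x v, (ω.tbl P (.H x) v ≠ 0 ∨ ω.Listed F x v) →
    ∃ w ∈ l, Agree (ω.scope x) v (wordVal w)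

variable {ω} {P P' : ℕ → List (Word A) → D} {F F' : ℕ → List (Word A) → Word A}
  {R : Fin Q.n → (Fin Q.m → Word A) → D} {l : List (List (Word A))}

theorem Sound.congr_dict (h : ω.Sound g P F) (hF : ∀ d, d.unpair.1 ≠ Q.m → F' d = F d) :
    ω.Sound g P F' where
  cycle x c hc := by
    obtain ⟨l, hl⟩ := h.cycle x c hc
    refine ⟨l, hl.congr fun d hd w => ?_⟩
    rw [hF]
    rw [hd]
    exact x.isLt.ne
  finite := h.finite
  sum := h.sum

theorem listed_congr_dict (hF : ∀ d, d.unpair.1 ≠ Q.m → F' d = F d) (x : Fin Q.m)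
    (v : Fin Q.m → Word A) : ω.Listed F' x v ↔ ω.Listed F x v := by
  rw [Listed, Listed, hF]
  simpa [idx, Lst.dm] using x.isLt.ne

theorem Stored.congr_dict (h : ω.Stored g R P F) (hF : ∀ d, d.unpair.1 ≠ Q.m → F' d = F d) :
    ω.Stored g R P F' := by
  refine ⟨h.rel, h.sound.congr_dict g hF, fun x v => ⟨(h.fresh x v).1, ?_⟩⟩
  simp only [Active, listed_congr_dict hF]
  exact (h.fresh x v).2

/-- An active tuple over the scope of `x` extends to a key of the relation that covers the scope. -/
theorem Active.exists_rel_ne_zero_anchor (hft : ω.FreeTop) (han : ω.Anchored)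
    (hs : ω.Sound g P F) {x : Fin Q.m} (hf : ∀ y, ω.Anc x y → ∀ v, ω.Fresh P F y v)
    {v : Fin Q.m → Word A} (ha : ω.Active P F (some x) v) :
    ∃ i, ω.scope x ⊆ Q.sch i ∧ ∃ v', Agree (ω.scope x) v v' ∧ ω.tbl P (.rel i) v' ≠ 0 := by
  obtain ⟨i, hi⟩ := han x
  obtain ⟨v', h, h'⟩ := ha.exists_rel_ne_zero g hft hs hf (hi (ω.self_mem_scope x))
  exact ⟨i, hi, v', h.symm, h'⟩

/-- One pass over the log makes the view `H@x` and the index of `x` fresh everywhere: at the tuples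
that extend to a log entry because they are refreshed, and elsewhere because the stored entries
vanish and no tuple is active. -/
theorem pass_exec (hft : ω.FreeTop) (han : ω.Anchored) (hR : Valued R)
    (hl : ∀ i v, R i v ≠ 0 → ∃ w ∈ l, Agree (Q.sch i) v (wordVal w)) (x : Fin Q.m)
    (σ : State A D) (hz : σ.reg Q.m = Word.sym 0) (ho : σ.reg (Q.m + 1) = Word.sym 1)
    (hc : ω.Covered g R l σ.pdict σ.dict)
    (hf : ∀ y, ω.Anc x y → ∀ v, ω.Fresh σ.pdict σ.dict y v) :
    ∃ tr σ', Exec g ((log Q).forEach (ω.refresh x)) σ tr σ' ∧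
      tr.length ≤ ((log Q).gap + (ω.refresh x).cost) * (l.length + 1) ∧
      (∀ r < 2 * Q.m + 4, r ∉ recRegs Q → σ'.reg r = σ.reg r) ∧
      ω.Covered g R l σ'.pdict σ'.dict ∧
      (∀ y, y ≠ x → ω.parent x ≠ some y → (∀ v, ω.Fresh σ.pdict σ.dict y v) →
        ∀ v, ω.Fresh σ'.pdict σ'.dict y v) ∧
      ∀ v, ω.Fresh σ'.pdict σ'.dict x v := by
  let J : List (List (Word A)) → State A D → Prop := fun ws τ =>
    ω.Covered g R l τ.pdict τ.dict ∧ (∀ r < 2 * Q.m + 4, r ∉ recRegs Q → τ.reg r = σ.reg r) ∧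
      (∀ y, y ≠ x → ω.parent x ≠ some y → (∀ v, ω.Fresh σ.pdict σ.dict y v) →
        ∀ v, ω.Fresh τ.pdict τ.dict y v) ∧ ∀ w ∈ ws, ω.Fresh τ.pdict τ.dict x (wordVal w)
  have hJz : ∀ ws τ, J ws τ → τ.reg Q.m = Word.sym 0 := fun ws τ h =>
    (h.2.1 _ (by omega) fun h => by have := mem_recRegs.1 h; omega).trans hz
  have hJo : ∀ ws τ, J ws τ → τ.reg (Q.m + 1) = Word.sym 1 := fun ws τ h =>
    (h.2.1 _ (by omega) fun h => by have := mem_recRegs.1 h; omega).trans ho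
  obtain ⟨tr, σ', hx, hseg, h1, h2, h3, h4⟩ := Lst.forEach_exec g (log_wf (Q := Q))
    (P := ω.refresh x) (c := []) (l := l) J (fun _ t => t.length ≤ (ω.refresh x).cost)
    (fun ws τ h => ⟨h.1.cycle, rfl, hJz ws τ h, hJo ws τ h⟩)
    (fun ws τ f h hf => ⟨h.1, fun r hr hr' => (hf r hr hr').trans (h.2.1 r hr hr'), h.2.2⟩)
    (by
      rintro ws w rest hlw τ hτ hw
      have hw' : wordVal w = valOf (Q := Q) τ.reg := by rw [← hw]; exact wordVal_recRegs _
      obtain ⟨f, a, P', F', e, k1, k2, k3, k4⟩ :=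
        ω.refresh_spec g x τ (hJz _ _ hτ) (hJo _ _ hτ) hτ.1.sound
      rw [← hw'] at k2 k4
      obtain ⟨tr, y, hlen, -⟩ := (ω.straight_refresh x).exec g τ
      rw [e] at y
      refine ⟨tr, _, y, hlen, ⟨⟨fun i v => (k2.rel i v).trans (hτ.1.rel i v), k3, ?_, ?_⟩,
        fun r hr hr' => (k1 r hr).trans (hτ.2.1 r hr hr'), ?_, ?_⟩, ?_⟩
      · refine hτ.1.cycle.congr fun d hd w => ?_
        exact congrFun (k2.other d (by rw [hd]; exact le_rfl)) _
      · intro y v hv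
        by_cases h : y = x ∧ Agree (ω.scope x) v (wordVal w)
        · obtain ⟨rfl, h⟩ := h
          exact ⟨w, by rw [hlw]; simp, h⟩
        · have h' : y = x → ¬ Agree (ω.scope x) v (wordVal w) := fun e h' => h ⟨e, h'⟩
          rw [k2.H y v h', k2.listed y v h'] at hv
          exact hτ.1.cover y v hv
      · intro y hy hp hfy v
        exact k2.fresh (hτ.2.2.1 y hy hp hfy v) (fun e => absurd e hy) fun e => absurd e hp
      · intro w' hw'
        rcases List.mem_append.1 hw' with hw' | hw'
        · by_cases h : Agree (ω.scope x) (wordVal w') (wordVal w)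
          · exact k4.congr h.symm
          · exact k2.fresh (hτ.2.2.2 w' hw') (fun _ => h) fun e => absurd rfl (ne_of_parent e)
        · rw [List.mem_singleton.1 hw']
          exact k4
      · rw [← hw]
        exact List.map_congr_left fun r hr => k1 r (log_wf.es_lt r hr))
    σ ⟨hc, fun _ _ _ => rfl, fun _ _ _ h => h, by simp⟩
  refine ⟨tr, σ', hx, ?_, h2, h1, h3, fun v => ?_⟩
  · have := hseg.length_le fun w t h => h
    nlinarith
  · by_cases h : ∃ w ∈ l, Agree (ω.scope x) v (wordVal w)
    · obtain ⟨w, hw, h⟩ := h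
      exact (h4 w hw).congr h.symm
    -- away from the log, both sides of the equations for `x` vanish
    · have hfd : ∀ y, ω.Anc x y → ∀ v, ω.Fresh σ'.pdict σ'.dict y v := by
        intro y hy
        refine h3 y ?_ ?_ (hf y hy)
        · rintro rfl; exact ω.anc_irrefl _ hy
        · exact fun e => ω.anc_irrefl _ (Anc.trans ω hy (ω.anc_of_parent e))
      have hna : ¬ ω.Active σ'.pdict σ'.dict (some x) v := by
        intro ha
        obtain ⟨i, hi, v', hv', hv0⟩ := ha.exists_rel_ne_zero_anchor g hft han h1.sound hfd
        rw [h1.rel] at hv0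
        obtain ⟨w, hw, hvw⟩ := hl i v' hv0
        exact h ⟨w, hw, hv'.trans (hvw.mono hi)⟩
      have hH : ω.tbl σ'.pdict (.H x) v = 0 := by
        by_contra h0
        exact h (h1.cover x v (Or.inl h0))
      have hL : ¬ ω.Listed σ'.dict x v := fun h0 => h (h1.cover x v (Or.inr h0))
      refine ⟨?_, iff_of_false hL fun h => hna h.2⟩
      rw [hH]
      by_contra h0
      exact hna (active_of_ne_zero g hft h1.sound (fun i v => by rw [h1.rel]; exact hR i v) x hfd v
        (Ne.symm h0))

theorem passes_exec_aux (hft : ω.FreeTop) (han : ω.Anchored) (hR : Valued R)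
    (hl : ∀ i v, R i v ≠ 0 → ∃ w ∈ l, Agree (Q.sch i) v (wordVal w)) (L : List (Fin Q.m))
    (hpw : L.Pairwise fun a b => ¬ ω.Anc a b) (hn : L.Nodup)
    (hpar : ∀ x ∈ L, ∀ y, ω.parent x = some y → y ∈ L)
    (σ : State A D) (hz : σ.reg Q.m = Word.sym 0) (ho : σ.reg (Q.m + 1) = Word.sym 1)
    (hc : ω.Covered g R l σ.pdict σ.dict)
    (hf : ∀ y, y ∉ L → ∀ v, ω.Fresh σ.pdict σ.dict y v) :
    ∃ tr σ', Exec g (seqs (L.map fun x => (log Q).forEach (ω.refresh x))) σ tr σ' ∧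
      tr.length ≤ ω.passCost L * (l.length + 1) ∧
      (∀ r < 2 * Q.m + 4, r ∉ recRegs Q → σ'.reg r = σ.reg r) ∧
      (log Q).IsCycle σ'.dict [] l ∧ ω.Stored g R σ'.pdict σ'.dict := by
  induction L generalizing σ with
  | nil =>
    exact ⟨[], σ, Exec.skip σ, by simp, fun _ _ _ => rfl, hc.cycle, hc.rel, hc.sound,
      fun x => hf x (by simp)⟩
  | cons x L ih =>
    obtain ⟨hx, hn⟩ := List.nodup_cons.1 hn
    obtain ⟨hxp, hpw⟩ := List.pairwise_cons.1 hpw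
    obtain ⟨tr, σ₁, x1, k1, k2, k3, k4, k5⟩ := pass_exec g hft han hR hl x σ hz ho hc
      fun y hy => hf y fun h => by
        rcases List.mem_cons.1 h with rfl | h
        · exact ω.anc_irrefl _ hy
        · exact hxp y h hy
    obtain ⟨tr', σ', x2, j1, j2, j3⟩ := ih hpw hn (fun z hz y hy => by
        refine (List.mem_cons.1 (hpar z (by simp [hz]) y hy)).resolve_left ?_
        rintro rfl
        exact hxp z hz (ω.anc_of_parent hy)) σ₁
      ((k2 _ (by omega) fun h => by have := mem_recRegs.1 h; omega).trans hz)
      ((k2 _ (by omega) fun h => by have := mem_recRegs.1 h; omega).trans ho) k3 (by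
        intro y hy
        by_cases h : y = x
        · rw [h]; exact k5
        · exact k4 y h (fun e => hy ((List.mem_cons.1 (hpar x (by simp) y e)).resolve_left h))
            (hf y (by simp [h, hy])))
    refine ⟨tr ++ tr', σ', Exec.seq x1 x2, ?_, fun r hr hr' => (j2 r hr hr').trans (k2 r hr hr'),
      j3⟩
    rw [List.length_append]
    simp only [passCost, List.map_cons, List.sum_cons] at j1 ⊢
    rw [add_mul]
    omega

theorem passes_exec (hft : ω.FreeTop) (han : ω.Anchored) (hR : Valued R)
    (hl : ∀ i v, R i v ≠ 0 → ∃ w ∈ l, Agree (Q.sch i) v (wordVal w))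
    (σ : State A D) (hz : σ.reg Q.m = Word.sym 0) (ho : σ.reg (Q.m + 1) = Word.sym 1)
    (hc : ω.Covered g R l σ.pdict σ.dict) :
    ∃ tr σ', Exec g ω.passes σ tr σ' ∧
      tr.length ≤ ω.passCost ω.order.reverse * (l.length + 1) ∧
      (∀ r < 2 * Q.m + 4, r ∉ recRegs Q → σ'.reg r = σ.reg r) ∧
      (log Q).IsCycle σ'.dict [] l ∧ ω.Stored g R σ'.pdict σ'.dict :=
  passes_exec_aux g hft han hR hl _ ω.order_reverse_pairwise
    (List.nodup_reverse.2 ω.order_nodup) (fun _ _ y _ => by simp [ω.mem_order]) σ hz ho hc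
    fun y hy => absurd (by simp [ω.mem_order]) hy

end VarOrder

namespace VarOrder

variable {Q : Query} (ω : VarOrder Q)

/-! ### Updates by propagating all keys -/

/-- Add the current record to its relation, refresh all views, and update the log. The record is
kept in the log during the passes even if its payload has become zero. -/
def updateLog : Prog (Fin Q.m) :=
  .seq (.seq (moveVec (copyRegs Q) (recRegs Q)) (onTag fun i : Fin Q.n => .seq (addRel i) markRec))
    (.seq ω.passes (.seq (moveVec (recRegs Q) (copyRegs Q)) (onTag (syncRec (Q := Q)))))

/-- The time per log entry of `updateLog`. -/
def updateLogCost : ℕ :=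
  (Prog.seq (moveVec (copyRegs Q) (recRegs Q))
    (onTag fun i : Fin Q.n => .seq (addRel i) markRec)).cost +
  ω.passCost ω.order.reverse +
  (Prog.seq (moveVec (recRegs Q) (copyRegs Q)) (onTag (syncRec (Q := Q)))).cost

variable {A : Type u} {D : Type v} [CommRing D] (g : Fin Q.m → A → D)

/-- The hash maps store the relations `R`, all views over them, and the log. -/
structure StoredLog (R : Fin Q.n → (Fin Q.m → Word A) → D) (l : List (List (Word A)))
    (P : ℕ → List (Word A) → D) (F : ℕ → List (Word A) → Word A) : Prop where
  stored : ω.Stored g R P F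
  valued : Valued R
  cycle : (log Q).IsCycle F [] l
  logs : Logs R l

variable {ω} {P P' : ℕ → List (Word A) → D} {F F' : ℕ → List (Word A) → Word A}
  {R : Fin Q.n → (Fin Q.m → Word A) → D} {l l' : List (List (Word A))}

theorem le_mul_succ (a n : ℕ) : a ≤ a * (n + 1) := Nat.le_mul_of_pos_right a n.succ_pos

theorem Logs.exists_agree (hm : Logs R l) {i : Fin Q.n} {v : Fin Q.m → Word A} (h : R i v ≠ 0) :
    ∃ w ∈ l, Agree (Q.sch i) v (wordVal w) :=
  ⟨entryWord i v, (hm _).2 ⟨i, v, rfl, h⟩, agree_wordVal i v⟩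

/-- The entries of the views before an update are covered by the log as well. -/
theorem StoredLog.cover (hft : ω.FreeTop) (han : ω.Anchored) (h : ω.StoredLog g R l P F)
    (x : Fin Q.m) (v : Fin Q.m → Word A) (hv : ω.tbl P (.H x) v ≠ 0 ∨ ω.Listed F x v) :
    ∃ w ∈ l, Agree (ω.scope x) v (wordVal w) := by
  have ha : ω.Active P F (some x) v := by
    rcases hv with hv | hv
    · rw [(h.stored.fresh x v).1] at hv
      exact active_of_ne_zero g hft h.stored.sound
        (fun i v => by rw [h.stored.rel]; exact h.valued i v) x (fun y _ => h.stored.fresh y) v hv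
    · exact ((h.stored.fresh x v).2.1 hv).2
  obtain ⟨i, hi, v', hv', h0⟩ :=
    ha.exists_rel_ne_zero_anchor g hft han h.stored.sound fun y _ => h.stored.fresh y
  rw [h.stored.rel] at h0
  obtain ⟨w, hw, hvw⟩ := Logs.exists_agree h.logs h0
  exact ⟨w, hw, hv'.trans (hvw.mono hi)⟩

theorem updateLog_spec (hft : ω.FreeTop) (han : ω.Anchored) (σ : State A D) (i : Fin Q.n)
    (hI : ω.StoredLog g R l σ.pdict σ.dict)
    (hz : σ.reg Q.m = Word.sym 0) (ho : σ.reg (Q.m + 1) = Word.sym 1)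
    (hi : σ.reg (Q.m + 2) = Word.sym (i + 1)) (ht : Typed i (valOf σ.reg)) :
    ∃ tr σ', Exec g ω.updateLog σ tr σ' ∧ tr.length ≤ ω.updateLogCost * (l.length + 2) ∧
      ∃ l', ω.StoredLog g (addTo R i (valOf σ.reg) (σ.acc 0)) l' σ'.pdict σ'.dict := by
  obtain ⟨fb, eb, hcopy, hfb⟩ := eval_moveVec g (copyRegs Q) (recRegs Q) copyRegs_length
    copyRegs_nodup (fun r hr h => by
      have := mem_recRegs.1 hr; have := mem_copyRegs.1 h; omega) σ
  have hfb' : ∀ r < Q.m + 3, fb r = σ.reg r := fun r hr => hfb r fun h => by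
    have := mem_copyRegs.1 h; omega
  obtain ⟨f₀, h0, hrun⟩ := eval_onTag g (fun i => .seq (addRel i) markRec) i
    { σ with reg := fb } ((hfb' _ (by omega)).trans hi)
  have h0' : ∀ r < Q.m + 3, f₀ r = σ.reg r := fun r hr => (h0 r (by omega)).trans (hfb' r hr)
  have hv : valOf (Q := Q) f₀ = valOf σ.reg := funext fun y => h0' y (by omega)
  have hz0 : f₀ Q.m = Word.sym 0 := (h0' _ (by omega)).trans hz
  have ho0 : f₀ (Q.m + 1) = Word.sym 1 := (h0' _ (by omega)).trans ho
  have hi0 : f₀ (Q.m + 2) = Word.sym (i + 1) := (h0' _ (by omega)).trans hi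
  obtain ⟨a, P, e1, hrel, hHV⟩ := eval_addRel g ω i { σ with reg := f₀ } hz0
  simp only [hv] at hrel
  set v : Fin Q.m → Word A := valOf σ.reg with hvdef
  have hrel' : ∀ j u, ω.tbl P (.rel j) u = addTo R i v (σ.acc 0) j u := fun j u => by
    rw [hrel, addTo, addTo, hI.stored.rel]
  obtain ⟨f, F, l₁, e2, h1, h2, h3, h4⟩ := eval_markRec g
    { σ with reg := f₀, acc := a, pdict := P } hz0 ho0 hi0 (by rwa [hv]) hI.cycle
  simp only [hv] at h4
  obtain ⟨f₁, e3, h5⟩ := hrun _ (by rw [Prog.eval, e1, e2]) ((h1 _ (by omega)).trans hi0)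
  have hpre : (Prog.seq (moveVec (copyRegs Q) (recRegs Q))
      (onTag fun i : Fin Q.n => .seq (addRel i) markRec)).Straight :=
    ⟨straight_moveVec _ _, straight_onTag fun i : Fin Q.n => ⟨straight_addRel i, straight_markRec⟩⟩
  obtain ⟨tr₁, x1, len1, -⟩ := hpre.exec g σ
  rw [Prog.eval, eb, e3] at x1
  have hf₁ : ∀ r < 2 * Q.m + 4, f₁ r = fb r := fun r hr =>
    (h5 r (by omega)).trans ((h1 r hr).trans (h0 r (by omega)))
  have hsub : ∀ w ∈ l, w ∈ l₁ := fun w hw => (h4 w).2 (Or.inr hw)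
  have hval := hI.valued.addTo ht (σ.acc 0)
  obtain ⟨tr₂, σ₂, x2, len2, k1, k2, k3⟩ := passes_exec (ω := ω) (l := l₁) g hft han hval (by
      intro j u hu
      by_cases hj : j = i ∧ Agree (Q.sch i) u v
      · exact ⟨entryWord i v, (h4 _).2 (Or.inl rfl),
          by rw [← entryWord_inj.2 hj]; exact agree_wordVal j u⟩
      · rw [addTo, if_neg hj, add_zero] at hu
        obtain ⟨w, hw, h⟩ := Logs.exists_agree hI.logs hu
        exact ⟨w, hsub w hw, h⟩)
    { σ with reg := f₁, acc := a, pdict := P, dict := F }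
    ((hf₁ _ (by omega)).trans ((hfb' _ (by omega)).trans hz))
    ((hf₁ _ (by omega)).trans ((hfb' _ (by omega)).trans ho))
    ⟨hrel', (hI.stored.sound.congr_payload g hHV).congr_dict g h2, h3, fun x u hu => by
      rw [(hHV x u).1, listed_congr_dict h2] at hu
      obtain ⟨w, hw, h⟩ := hI.cover g hft han x u hu
      exact ⟨w, hsub w hw, h⟩⟩
  obtain ⟨fr, er, hrest, hfr⟩ := eval_moveVec g (recRegs Q) (copyRegs Q) copyRegs_length.symm
    recRegs_nodup (fun r hr h => by
      have := mem_recRegs.1 h; have := mem_copyRegs.1 hr; omega) σ₂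
  have hfr' : (recRegs Q).map fr = (recRegs Q).map σ.reg := by
    rw [hrest, ← hcopy]
    refine List.map_congr_left fun r hr => ?_
    have := mem_copyRegs.1 hr
    rw [k1 r (by omega) fun h => by have := mem_recRegs.1 h; omega]
    exact hf₁ r (by omega)
  rw [recRegs_map, recRegs_map, List.cons.injEq, List.ofFn_inj] at hfr'
  have hz2 : fr Q.m = Word.sym 0 := by
    rw [hfr _ fun h => by have := mem_recRegs.1 h; omega,
      k1 _ (by omega) fun h => by have := mem_recRegs.1 h; omega]
    exact (hf₁ _ (by omega)).trans ((hfb' _ (by omega)).trans hz)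
  have ho2 : fr (Q.m + 1) = Word.sym 1 := by
    rw [hfr _ fun h => by have := mem_recRegs.1 h; omega,
      k1 _ (by omega) fun h => by have := mem_recRegs.1 h; omega]
    exact (hf₁ _ (by omega)).trans ((hfb' _ (by omega)).trans ho)
  obtain ⟨f₂, h6, hrun'⟩ := eval_onTag g syncRec i { σ₂ with reg := fr } (hfr'.1.trans hi)
  have hv2 : valOf (Q := Q) f₂ = v := by
    rw [hvdef, ← hfr'.2]
    exact funext fun y => h6 y (by omega)
  have hi2 := (h6 (Q.m + 2) (by omega)).trans (hfr'.1.trans hi)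
  obtain ⟨f₃, a₃, F₃, l₂, e4, h7, h8, h9, h10⟩ := eval_syncRec g ω
    { σ₂ with reg := f₂ } ((h6 _ (by omega)).trans hz2) ((h6 _ (by omega)).trans ho2) hi2
    (by rw [hv2]; exact ht) k2
  simp only [hv2] at h10
  obtain ⟨f₄, e5, -⟩ := hrun' _ e4 ((h7 _ (by omega)).trans hi2)
  have hpost : (Prog.seq (moveVec (recRegs Q) (copyRegs Q)) (onTag (syncRec (Q := Q)))).Straight :=
    ⟨straight_moveVec _ _, straight_onTag straight_syncRec⟩
  obtain ⟨tr₃, x3, len3, -⟩ := hpost.exec g σ₂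
  rw [Prog.eval, er, e5] at x3
  refine ⟨_, _, Exec.seq x1 (Exec.seq x2 x3), ?_, l₂, k3.congr_dict g h8, hval, h9, ?_⟩
  · have hlen : l₁.length ≤ l.length + 1 := by
      have : l₁ ⊆ entryWord i v :: l := fun w hw => List.mem_cons.2 ((h4 w).1 hw)
      exact (List.subperm_of_subset h3.nodup this).length_le
    have h2 : ω.passCost ω.order.reverse * (l₁.length + 1) ≤
        ω.passCost ω.order.reverse * (l.length + 2) := Nat.mul_le_mul_left _ (by omega)
    have h3 := len1.trans (le_mul_succ _ (l.length + 1))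
    have h4 := len3.trans (le_mul_succ _ (l.length + 1))
    rw [List.length_append, List.length_append, updateLogCost, add_mul, add_mul]
    exact (add_le_add h3 (add_le_add (len2.trans h2) h4)).trans_eq (add_assoc _ _ _).symm
  · refine Logs.addTo (fun u hu => ?_) (fun w hw => ?_) (fun w => ?_) (l := l₁)
    · rw [← hI.stored.rel, ← hI.stored.rel]
      exact tbl_congr hu
    · rw [h4, or_iff_right hw]
      exact hI.logs w
    · rw [h10 w, k3.rel]

/-! ### Running the phases -/

variable (ω)

/-- Preprocessing by path updates: every record of the input is processed as an update. -/
def preprocessPath : Prog (Fin Q.m) := .seq setup (loadAll ω.updatePath)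

/-- A single-tuple update that refreshes one path of the view tree. -/
def maintainPath : Prog (Fin Q.m) := .seq (.seq setup readNext) ω.updatePath

/-- Preprocessing with a log: store and log all records of the input, then compute all views. -/
def preprocessLog : Prog (Fin Q.m) := .seq setup (.seq (loadAll loadRec) ω.passes)

/-- A single-tuple update that recomputes all views from the log. -/
def maintainLog : Prog (Fin Q.m) := .seq (.seq setup readNext) ω.updateLog

variable {ω}

theorem setup_readNext_exec (σ : State A D) {i : Fin Q.n} {v : Fin Q.m → Word A} {p : D}
    (hin : σ.input = [record i v p]) :
    ∃ tr σ', Exec g (.seq setup readNext) σ tr σ' ∧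
      tr.length ≤ (Prog.seq (setup (Q := Q)) readNext).cost ∧ σ'.reg Q.m = Word.sym 0 ∧
      σ'.reg (Q.m + 1) = Word.sym 1 ∧ σ'.reg (Q.m + 2) = Word.sym (i + 1) ∧ valOf σ'.reg = v ∧
      σ'.acc 0 = p ∧ σ'.pdict = σ.pdict ∧ σ'.dict = σ.dict := by
  obtain ⟨f, e1, hz, ho, -⟩ := eval_setup g σ
  obtain ⟨f', a, inp, e2, h1, h2, -, h3⟩ := eval_readNext g { σ with reg := f } hz
  obtain ⟨-, h4, h5, h6, -⟩ := h3 i v p [] hin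
  obtain ⟨tr, x, hl, -⟩ := Prog.Straight.exec g (P := .seq setup readNext)
    ⟨straight_setup, straight_readNext⟩ σ
  rw [Prog.eval, e1, e2] at x
  exact ⟨tr, _, x, hl, h1.trans hz, h2.trans ho, h4, h5, h6, rfl, rfl⟩

theorem maintainPath_exec (hpc : ω.PathClosed) (σ : State A D)
    (hI : ω.Stored g R σ.pdict σ.dict) {i : Fin Q.n} {v : Fin Q.m → Word A} {p : D}
    (hin : σ.input = [record i v p]) :
    ∃ tr σ', Exec g ω.maintainPath σ tr σ' ∧ tr.length ≤ ω.maintainPath.cost ∧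
      ω.Stored g (addTo R i v p) σ'.pdict σ'.dict := by
  obtain ⟨tr, σ₁, x1, l1, hz, ho, hi, rfl, rfl, h1, h2⟩ := setup_readNext_exec g σ hin
  obtain ⟨tr', σ₂, x2, l2, -, -, -, h3⟩ := updatePath_spec g hpc R σ₁ i (by rwa [h1, h2]) hz ho hi
  refine ⟨_, σ₂, Exec.seq x1 x2, ?_, h3⟩
  rw [List.length_append, maintainPath, Prog.cost]
  omega

theorem maintainLog_exec (hft : ω.FreeTop) (han : ω.Anchored) (σ : State A D)
    (hI : ω.StoredLog g R l σ.pdict σ.dict) {i : Fin Q.n} {v : Fin Q.m → Word A} (ht : Typed i v)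
    {p : D} (hin : σ.input = [record i v p]) :
    ∃ tr σ', Exec g ω.maintainLog σ tr σ' ∧
      tr.length ≤ ((Prog.seq (setup (Q := Q)) readNext).cost + ω.updateLogCost) * (l.length + 2) ∧
      ∃ l', ω.StoredLog g (addTo R i v p) l' σ'.pdict σ'.dict := by
  obtain ⟨tr, σ₁, x1, l1, hz, ho, hi, rfl, rfl, h1, h2⟩ := setup_readNext_exec g σ hin
  obtain ⟨tr', σ₂, x2, l2, h3⟩ :=
    updateLog_spec g hft han σ₁ i (by rwa [h1, h2]) hz ho hi ht
  refine ⟨_, σ₂, Exec.seq x1 x2, ?_, h3⟩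
  rw [List.length_append, add_mul]
  exact add_le_add (l1.trans (le_mul_succ _ (l.length + 1))) l2

/-- The contents of the relations after reading the records `recs`. -/
def loaded (recs : List (Fin Q.n × (Fin Q.m → Word A) × D)) :
    Fin Q.n → (Fin Q.m → Word A) → D :=
  recs.foldl (fun R e => addTo R e.1 e.2.1 e.2.2) fun _ _ => 0

variable (ω) in
/-- The time per record of `preprocessPath`. -/
def preprocessPathCost : ℕ :=
  (setup (Q := Q)).cost + ((readNext (Q := Q)).cost + ω.updatePath.cost + 1)

theorem preprocessPath_exec (hpc : ω.PathClosed)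
    (recs : List (Fin Q.n × (Fin Q.m → Word A) × D)) (ht : ∀ e ∈ recs, Typed e.1 e.2.1) :
    ∃ tr σ', Exec g ω.preprocessPath
        (State.start (recs.map fun e => record e.1 e.2.1 e.2.2)) tr σ' ∧
      tr.length ≤ ω.preprocessPathCost * (recs.length + 1) ∧
      ω.Stored g (loaded recs) σ'.pdict σ'.dict := by
  set σ : State A D := State.start (recs.map fun e => record e.1 e.2.1 e.2.2)
  obtain ⟨f, e1, hz, ho, -⟩ := eval_setup g σ
  obtain ⟨tr, x1, l1, -⟩ := straight_setup.exec g σ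
  rw [e1] at x1
  obtain ⟨tr', σ', x2, l2, -, -, h⟩ := loadAll_exec g (P := ω.updatePath)
    (c := ω.updatePath.cost) (fun R P F => ω.Stored g R P F)
    (fun R σ i hI hz ho hi _ => updatePath_spec g hpc R σ i hI hz ho hi) recs ht
    (fun _ _ => 0) { σ with reg := f } (stored_zero g) hz ho rfl
  refine ⟨_, σ', Exec.seq x1 x2, ?_, h⟩
  rw [List.length_append, preprocessPathCost, add_mul]
  exact add_le_add (l1.trans (le_mul_succ _ _)) l2

variable (ω) in
/-- The time per record of `preprocessLog`. -/
def preprocessLogCost : ℕ :=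
  (setup (Q := Q)).cost + ((readNext (Q := Q)).cost + (loadRec (Q := Q)).cost + 1) +
    ω.passCost ω.order.reverse

theorem preprocessLog_exec (hft : ω.FreeTop) (han : ω.Anchored)
    (recs : List (Fin Q.n × (Fin Q.m → Word A) × D)) (ht : ∀ e ∈ recs, Typed e.1 e.2.1) :
    ∃ tr σ' l, Exec g ω.preprocessLog
        (State.start (recs.map fun e => record e.1 e.2.1 e.2.2)) tr σ' ∧
      tr.length ≤ ω.preprocessLogCost * (recs.length + l.length + 1) ∧
      ω.StoredLog g (loaded recs) l σ'.pdict σ'.dict := by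
  set σ : State A D := State.start (recs.map fun e => record e.1 e.2.1 e.2.2)
  obtain ⟨f, e1, hz, ho, -⟩ := eval_setup g σ
  obtain ⟨tr, x1, l1, -⟩ := straight_setup.exec g σ
  rw [e1] at x1
  obtain ⟨tr', σ₁, x2, l2, hz1, ho1, hrel, hval, hs, h0, l, hcyc, hlogs⟩ :=
    loadAll_exec g (P := loadRec) (c := (loadRec (Q := Q)).cost)
    (fun R P F => (∀ i v, ω.tbl P (.rel i) v = R i v) ∧ Valued R ∧ ω.Sound g P F ∧
      (∀ x v, ω.tbl P (.H x) v = 0 ∧ ¬ ω.Listed F x v) ∧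
      ∃ l, (log Q).IsCycle F [] l ∧ Logs R l)
    (fun R σ i ⟨hrel, hval, hs, h0, l, hcyc, hlogs⟩ hz ho hi ht => by
      obtain ⟨tr, σ', x, hl, k1, k2, k3, k4, k5, k6, k7⟩ :=
        loadRec_spec g ω R σ i hz ho hi ht hrel hcyc hlogs
      exact ⟨tr, σ', x, hl, k1, k2, k3, k5, hval.addTo ht _,
        (hs.congr_payload g k6).congr_dict g k4, fun x v => ⟨((k6 x v).1).trans (h0 x v).1,
          (listed_congr_dict k4 x v).not.2 (h0 x v).2⟩, k7⟩) recs ht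
    (fun _ _ => 0) { σ with reg := f }
    ⟨fun _ _ => rfl, fun i v h => absurd rfl h, sound_zero g,
      fun x v => ⟨rfl, not_listed_zero x v⟩, [], Lst.isCycle_nil _, fun w => by simp⟩ hz ho rfl
  obtain ⟨tr₂, σ₂, x3, l3, -, k2, k3⟩ := passes_exec (ω := ω) g hft han hval
    (fun i v h => Logs.exists_agree hlogs h) σ₁ hz1 ho1
    ⟨hrel, hs, hcyc, fun x v h => (h.elim (fun h => h (h0 x v).1) (h0 x v).2).elim⟩
  refine ⟨_, σ₂, l, Exec.seq x1 (Exec.seq x2 x3), ?_, k3, hval, k2, hlogs⟩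
  rw [List.length_append, List.length_append, preprocessLogCost, add_mul, add_mul, ← add_assoc]
  exact add_le_add (add_le_add (l1.trans (le_mul_succ _ _))
    (l2.trans (Nat.mul_le_mul_left _ (by omega)))) (l3.trans (Nat.mul_le_mul_left _ (by omega)))

end VarOrder

/-! ### Databases as tables of words -/

section Words

variable {Q : Query} {Dom : Fin Q.m → Type u} {D : Type v}

/-- A valuation by words. -/
def emb (s : Valuation Q Dom) (x : Fin Q.m) : Word (Value Q Dom) := Word.val ⟨x, s x⟩

/-- A tuple by words, with blanks outside of its schema. -/
def tupleWord (S : Finset (Fin Q.m)) (t : Tuple Q Dom S) (x : Fin Q.m) : Word (Value Q Dom) :=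
  if h : x ∈ S then Word.val ⟨x, t ⟨x, h⟩⟩ else Word.sym 0

theorem key_eq_kw (S : Finset (Fin Q.m)) (t : Tuple Q Dom S) :
    key Q S t = kw S (tupleWord S t) := by
  rw [key, kw, List.ofFn_inj]
  funext x
  by_cases h : x ∈ S <;> simp [tupleWord, h]

theorem key_eq_ofFn (S : Finset (Fin Q.m)) (t : Tuple Q Dom S) :
    key Q S t = List.ofFn (tupleWord S t) := rfl

theorem key_proj (S : Finset (Fin Q.m)) (s : Valuation Q Dom) :
    key Q S (proj Q S s) = kw S (emb s) := by
  rw [key, kw, List.ofFn_inj]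
  funext x
  by_cases h : x ∈ S <;> simp [emb, h, proj]

theorem key_injective (S : Finset (Fin Q.m)) :
    Function.Injective (key Q S : Tuple Q Dom S → List (Word (Value Q Dom))) := by
  intro t t' h
  rw [key_eq_ofFn, key_eq_ofFn, List.ofFn_inj] at h
  funext ⟨x, hx⟩
  have := congrFun h x
  simpa [tupleWord, hx] using this

theorem typed_tupleWord (i : Fin Q.n) (t : Tuple Q Dom (Q.sch i)) :
    Typed i (tupleWord (Q.sch i) t) := by
  intro x
  by_cases h : x ∈ Q.sch i <;> simp [tupleWord, h]

theorem emb_update (s : Valuation Q Dom) (x : Fin Q.m) (a : Dom x) :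
    emb (Function.update s x a) = Function.update (emb s) x (Word.val ⟨x, a⟩) := by
  funext y
  by_cases h : y = x
  · subst h; simp [emb]
  · simp [emb, h]

theorem emb_apply_inj {s s' : Valuation Q Dom} {x : Fin Q.m} :
    emb s x = emb s' x ↔ s x = s' x := by
  simp [emb]

variable [CommRing D]

/-- The relations of a database as functions of valuations by words. -/
def relWord (db : Database Q Dom D) (i : Fin Q.n) (v : Fin Q.m → Word (Value Q Dom)) : D :=
  if h : ∃ t, kw (Q.sch i) v = key Q (Q.sch i) t then db i h.choose else 0

theorem relWord_of_key (db : Database Q Dom D) {i : Fin Q.n} {v : Fin Q.m → Word (Value Q Dom)}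
    {t : Tuple Q Dom (Q.sch i)} (h : kw (Q.sch i) v = key Q (Q.sch i) t) :
    relWord db i v = db i t := by
  have h' : ∃ t, kw (Q.sch i) v = key Q (Q.sch i) t := ⟨t, h⟩
  rw [relWord, dif_pos h', key_injective _ (h'.choose_spec.symm.trans h)]

theorem relWord_emb (db : Database Q Dom D) (i : Fin Q.n) (s : Valuation Q Dom) :
    relWord db i (emb s) = db i (proj Q (Q.sch i) s) :=
  relWord_of_key db (key_proj _ s).symm

theorem exists_key_of_relWord {db : Database Q Dom D} {i : Fin Q.n}
    {v : Fin Q.m → Word (Value Q Dom)} (h : relWord db i v ≠ 0) :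
    ∃ t, kw (Q.sch i) v = key Q (Q.sch i) t := by
  by_contra h'
  exact h (dif_neg h')

theorem relWord_zero : relWord (fun _ => 0 : Database Q Dom D) = fun _ _ => 0 := by
  funext i v
  rw [relWord]
  split_ifs <;> rfl

theorem relWord_update (db : Database Q Dom D) (i : Fin Q.n) (t : Tuple Q Dom (Q.sch i)) (p : D) :
    relWord (db.update i t p) = addTo (relWord db) i (tupleWord (Q.sch i) t) p := by
  funext j v
  by_cases h : ∃ t', kw (Q.sch j) v = key Q (Q.sch j) t'
  · obtain ⟨t', h⟩ := h
    rw [relWord_of_key _ h, addTo, relWord_of_key _ h]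
    by_cases hj : j = i
    · subst hj
      rw [Database.update, Function.update_self, Finsupp.add_apply, Finsupp.single_apply]
      congr 1
      have : t = t' ↔ j = j ∧ Agree (Q.sch j) v (tupleWord (Q.sch j) t) := by
        rw [← kw_eq_iff, h, ← key_eq_kw, (key_injective _).eq_iff]
        simp [eq_comm]
      simp only [this]
    · rw [Database.update, Function.update_of_ne hj, if_neg fun h => hj h.1, add_zero]
  · rw [relWord, dif_neg h, addTo, relWord, dif_neg h, if_neg, add_zero]
    rintro ⟨rfl, h'⟩
    exact h ⟨t, by rw [key_eq_kw]; exact kw_eq_iff.2 h'⟩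

theorem exists_val_of_relWord {db : Database Q Dom D} {i : Fin Q.n}
    {v : Fin Q.m → Word (Value Q Dom)} (h : relWord db i v ≠ 0) {x : Fin Q.m} (hx : x ∈ Q.sch i) :
    ∃ a : Dom x, v x = Word.val ⟨x, a⟩ := by
  obtain ⟨t, ht⟩ := exists_key_of_relWord h
  rw [key_eq_kw, kw_eq_iff] at ht
  exact ⟨t ⟨x, hx⟩, by rw [ht x hx, tupleWord, dif_pos hx]⟩

theorem valued_relWord (db : Database Q Dom D) : Valued (relWord db) := by
  intro i v h x hx
  obtain ⟨a, ha⟩ := exists_val_of_relWord h hx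
  simp [ha]

/-- The records of the database `db` at the entries `L`. -/
def records (db : Database Q Dom D) (L : List ((i : Fin Q.n) × Tuple Q Dom (Q.sch i))) :
    List (Fin Q.n × (Fin Q.m → Word (Value Q Dom)) × D) :=
  L.map fun e => (e.1, tupleWord (Q.sch e.1) e.2, db e.1 e.2)

theorem loaded_records (db : Database Q Dom D)
    (L : List ((i : Fin Q.n) × Tuple Q Dom (Q.sch i))) (hn : L.Nodup)
    (hL : ∀ e, e ∈ L ↔ db e.1 e.2 ≠ 0) : VarOrder.loaded (records db L) = relWord db := by
  have key : ∀ (L : List ((i : Fin Q.n) × Tuple Q Dom (Q.sch i))) (db₀ : Database Q Dom D),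
      L.Nodup → (∀ e ∈ L, db₀ e.1 e.2 = 0) → ∃ db₁ : Database Q Dom D,
        (records db L).foldl (fun R e => addTo R e.1 e.2.1 e.2.2) (relWord db₀) = relWord db₁ ∧
        ∀ e : (i : Fin Q.n) × Tuple Q Dom (Q.sch i),
          db₁ e.1 e.2 = if e ∈ L then db e.1 e.2 else db₀ e.1 e.2 := by
    intro L
    induction L with
    | nil => exact fun db₀ _ _ => ⟨db₀, rfl, by simp⟩
    | cons e L ih =>
      intro db₀ hn h0
      obtain ⟨he, hn⟩ := List.nodup_cons.1 hn
      have hu : ∀ e' : (i : Fin Q.n) × Tuple Q Dom (Q.sch i),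
          (db₀.update e.1 e.2 (db e.1 e.2)) e'.1 e'.2 =
            if e' = e then db e.1 e.2 else db₀ e'.1 e'.2 := by
        rintro ⟨j, t'⟩
        obtain ⟨i, t⟩ := e
        by_cases hj : j = i
        · subst hj
          have h0 := h0 ⟨j, t⟩ (by simp)
          simp only at h0
          simp only [Database.update, Function.update_self, Finsupp.add_apply,
            Finsupp.single_apply, Sigma.mk.injEq, heq_eq_eq, true_and]
          by_cases ht : t' = t
          · subst ht; simp [h0]
          · rw [if_neg ht, if_neg (Ne.symm ht), add_zero]
        · simp [Database.update, hj]
      obtain ⟨db₁, h1, h2⟩ := ih (db₀.update e.1 e.2 (db e.1 e.2)) hn (fun e' he' => by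
        rw [hu, if_neg (by rintro rfl; exact he he')]
        exact h0 e' (by simp [he']))
      refine ⟨db₁, ?_, fun e' => ?_⟩
      · rw [← h1, relWord_update]
        rfl
      · rw [h2, hu]
        by_cases h : e' = e
        · subst h; simp [he]
        · simp [h]
  obtain ⟨db₁, h1, h2⟩ := key L (fun _ => 0) hn (by simp)
  have : db₁ = db := by
    funext i
    ext t
    have := h2 ⟨i, t⟩
    rw [this]
    split_ifs with h
    · rfl
    · exact (not_not.1 (mt (hL ⟨i, t⟩).2 h)).symm
  rw [VarOrder.loaded, ← relWord_zero, h1, this]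

theorem length_eq_size (db : Database Q Dom D)
    (L : List ((i : Fin Q.n) × Tuple Q Dom (Q.sch i))) (hn : L.Nodup)
    (hL : ∀ e, e ∈ L ↔ db e.1 e.2 ≠ 0) : L.length = db.size := by
  have : L.toFinset = Finset.univ.sigma fun i => (db i).support := by
    ext e
    simp [hL]
  rw [← List.toFinset_card_of_nodup hn, this, Finset.card_sigma, Database.size]

theorem log_length_le (db : Database Q Dom D) {l : List (List (Word (Value Q Dom)))}
    (hn : l.Nodup) (hl : Logs (relWord db) l) : l.length ≤ db.size := by
  have : l.toFinset ⊆ (Finset.univ.sigma fun i => (db i).support).image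
      fun e : (i : Fin Q.n) × Tuple Q Dom (Q.sch i) =>
        entryWord e.1 (tupleWord (Q.sch e.1) e.2) := by
    intro w hw
    obtain ⟨i, v, rfl, h⟩ := (hl w).1 (List.mem_toFinset.1 hw)
    obtain ⟨t, ht⟩ := exists_key_of_relWord h
    rw [relWord_of_key db ht] at h
    refine Finset.mem_image.2 ⟨⟨i, t⟩, by simpa using h, ?_⟩
    rw [entryWord_inj]
    rw [key_eq_kw] at ht
    exact ⟨rfl, kw_eq_iff.1 ht.symm⟩
  have h := (Finset.card_le_card this).trans Finset.card_image_le
  rwa [List.toFinset_card_of_nodup hn, Finset.card_sigma] at h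

end Words

namespace VarOrder

variable {Q : Query} {Dom : Fin Q.m → Type u} {D : Type v} [CommRing D] {ω : VarOrder Q}
  {g : (x : Fin Q.m) → Dom x → D} {db : Database Q Dom D}
  {P : ℕ → List (Word (Value Q Dom)) → D}
  {F : ℕ → List (Word (Value Q Dom)) → Word (Value Q Dom)}

/-! ### The stored tables are the views -/

theorem Stored.exists_val (hft : ω.FreeTop) (h : ω.Stored (liftValue Q g) (relWord db) P F)
    {x : Fin Q.m} {v : Fin Q.m → Word (Value Q Dom)} (ha : ω.Active P F (some x) v) :
    ∃ a : Dom x, v x = Word.val ⟨x, a⟩ := by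
  obtain ⟨i, hi⟩ := Q.covered x
  obtain ⟨v', hv, h0⟩ := ha.exists_rel_ne_zero _ hft h.sound (fun y _ => h.fresh y) hi
  rw [h.rel] at h0
  rw [← hv x (ω.self_mem_scope x)]
  exact exists_val_of_relWord h0 hi

theorem Stored.active_of_H_ne_zero (hft : ω.FreeTop)
    (h : ω.Stored (liftValue Q g) (relWord db) P F) {x : Fin Q.m}
    {v : Fin Q.m → Word (Value Q Dom)} (h0 : ω.tbl P (.H x) v ≠ 0) : ω.Active P F (some x) v := by
  rw [(h.fresh x v).1] at h0
  exact active_of_ne_zero _ hft h.sound (fun i v => by rw [h.rel]; exact valued_relWord db i v) x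
    (fun y _ => h.fresh y) v h0

theorem wordWeight_val (x : Fin Q.m) (a : Dom x) :
    wordWeight Q (liftValue Q g) x (Word.val ⟨x, a⟩) = weight Q g x a := by
  simp [wordWeight, weight, liftWord, liftValue]

theorem val_injective (x : Fin Q.m) :
    Function.Injective fun a : Dom x => (Word.val ⟨x, a⟩ : Word (Value Q Dom)) := by
  intro a b h
  simpa using h

/-- Marginalization only sums over the domain of the variable. -/
theorem Stored.sum_emb (hft : ω.FreeTop) (h : ω.Stored (liftValue Q g) (relWord db) P F)
    (x : Fin Q.m) (s : Valuation Q Dom) : ω.tbl P (.V x) (emb s) =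
      ∑ᶠ a : Dom x, ω.tbl P (.H x) (emb (Function.update s x a)) * weight Q g x a := by
  rw [h.sound.sum]
  set f : Word (Value Q Dom) → D := fun a => ω.tbl P (.H x) (Function.update (emb s) x a) *
    wordWeight Q (liftValue Q g) x a with hf
  have h1 : ∀ a, f a ≠ 0 → a ∈ Set.range fun a : Dom x => (Word.val ⟨x, a⟩ : Word (Value Q Dom)) := by
    intro a ha
    obtain ⟨b, hb⟩ := h.exists_val hft (h.active_of_H_ne_zero hft (left_ne_zero_of_mul ha))
    rw [Function.update_self] at hb
    exact ⟨b, hb.symm⟩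
  have h2 : ∑ᶠ a, f a = ∑ᶠ a ∈ Set.range fun a : Dom x =>
      (Word.val ⟨x, a⟩ : Word (Value Q Dom)), f a := by
    refine finsum_congr fun a => ?_
    by_cases ha : a ∈ Set.range fun a : Dom x => (Word.val ⟨x, a⟩ : Word (Value Q Dom))
    · rw [finsum_eq_if, if_pos ha]
    · rw [finsum_eq_if, if_neg ha]
      exact not_not.1 (mt (h1 a) ha)
  rw [h2, finsum_mem_range (val_injective x)]
  exact finsum_congr fun a => by rw [hf, emb_update]; simp only [wordWeight_val]

theorem Stored.finite_emb (h : ω.Stored (liftValue Q g) (relWord db) P F)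
    (x : Fin Q.m) (s : Valuation Q Dom) :
    {a : Dom x | ω.tbl P (.H x) (emb (Function.update s x a)) ≠ 0}.Finite := by
  have := (h.sound.finite x (emb s)).preimage ((val_injective (Dom := Dom) x).injOn)
  refine this.subset fun a ha => ?_
  simpa [emb_update] using ha

theorem tbl_H_emb (h : ω.Stored (liftValue Q g) (relWord db) P F) (x : Fin Q.m)
    (s : Valuation Q Dom) : ω.tbl P (.H x) (emb s) =
      (∏ i ∈ ω.relsAt x, ω.tbl P (.rel i) (emb s)) *
        ∏ y ∈ ω.children (some x), ω.tbl P (.V y) (emb s) := by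
  rw [(h.fresh x _).1, childViews, List.map_append, List.prod_append, List.map_map, List.map_map,
    ← Finset.prod_map_toList, ← Finset.prod_map_toList]
  rfl

theorem Stored.view_eq (hft : ω.FreeTop) (h : ω.Stored (liftValue Q g) (relWord db) P F)
    (x : Fin Q.m) : (∀ s, ω.tbl P (.H x) (emb s) = ω.viewH g db x s) ∧
      ∀ s, ω.tbl P (.V x) (emb s) = ω.viewV g db x s := by
  induction x using ω.wf.induction with
  | _ x ih =>
    have hH : ∀ s, ω.tbl P (.H x) (emb s) = ω.viewH g db x s := by
      intro s
      rw [tbl_H_emb h, viewH, Finset.prod_subtype (ω.children (some x))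
        (fun y => ω.mem_children)]
      congr 1
      · exact Finset.prod_congr rfl fun i _ => by rw [h.rel, relWord_emb]
      · exact Finset.prod_congr rfl fun y _ => (ih y.1 y.2).2 s
    refine ⟨hH, fun s => ?_⟩
    rw [h.sum_emb hft, viewV_eq]
    exact finsum_congr fun a => by rw [hH]

theorem Stored.materialized (hft : ω.FreeTop) {σ : State (Value Q Dom) D}
    (h : ω.Stored (liftValue Q g) (relWord db) σ.pdict σ.dict) :
    Materialized ω table g db σ := by
  refine ⟨fun i t => ?_, fun x s => ?_, fun x s => ?_⟩
  · have := h.rel i (tupleWord (Q.sch i) t)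
    rw [relWord_of_key db (key_eq_kw _ t).symm] at this
    rw [← this, key_eq_kw]
    rfl
  · rw [← (h.view_eq hft x).1, key_proj]
    rfl
  · rw [← (h.view_eq hft x).2, key_proj]
    rfl

end VarOrder

namespace VarOrder

variable {Q : Query} {Dom : Fin Q.m → Type u} {D : Type v} [CommRing D] {ω : VarOrder Q}
  {g : (x : Fin Q.m) → Dom x → D} {db : Database Q Dom D}
  {P : ℕ → List (Word (Value Q Dom)) → D}
  {F : ℕ → List (Word (Value Q Dom)) → Word (Value Q Dom)}

/-! ### Variable elimination -/

/-- The summand of the query result with all variables outside of `S` marginalized: the product of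
the relations over `S`, of the views of the topmost variables outside of `S`, and of the lifted
bound variables in `S`. -/
def partialProd (ω : VarOrder Q) (g : (x : Fin Q.m) → Dom x → D)
    (P : ℕ → List (Word (Value Q Dom)) → D) (S : Finset (Fin Q.m)) (s : Valuation Q Dom) : D :=
  (∏ i ∈ Finset.univ.filter (fun i => Q.sch i ⊆ S), ω.tbl P (.rel i) (emb s)) *
    (∏ y ∈ ω.frontier S, ω.tbl P (.V y) (emb s)) * ∏ x ∈ S \ Q.free, g x (s x)

theorem mem_frontier {S : Finset (Fin Q.m)} {y : Fin Q.m} :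
    y ∈ ω.frontier S ↔ y ∉ S ∧ ∀ p, ω.parent y = some p → p ∈ S := by
  simp [frontier]

theorem frontier_univ : ω.frontier Finset.univ = ∅ := by
  ext y; simp [mem_frontier]

/-- `S` is closed under ancestors. -/
def UpClosed (ω : VarOrder Q) (S : Finset (Fin Q.m)) : Prop := ∀ x ∈ S, ∀ y, ω.Anc y x → y ∈ S

theorem dep_subset_of_frontier {S : Finset (Fin Q.m)} (hS : ω.UpClosed S) {y : Fin Q.m}
    (hy : y ∈ ω.frontier S) : ω.dep y ⊆ S := by
  intro z hz
  have hzy := (ω.mem_dep.1 hz).1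
  rcases hp : ω.parent y with _ | p
  · exact absurd hzy (ω.not_anc_of_root hp z)
  · have := (mem_frontier.1 hy).2 p hp
    rcases (ω.anc_iff hp z).1 hzy with rfl | h
    · exact this
    · exact hS p this z h

theorem filter_sch_insert {S : Finset (Fin Q.m)} (hS : ω.UpClosed S) {x : Fin Q.m}
    (hx : x ∈ ω.frontier S) :
    Finset.univ.filter (fun i => Q.sch i ⊆ insert x S) =
      Finset.univ.filter (fun i => Q.sch i ⊆ S) ∪ ω.relsAt x := by
  have hxS := (mem_frontier.1 hx).1
  ext i
  simp only [Finset.mem_filter, Finset.mem_univ, true_and, Finset.mem_union, mem_relsAt]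
  constructor
  · intro h
    by_cases hxi : x ∈ Q.sch i
    · refine Or.inr ⟨hxi, fun y hy => ?_⟩
      rcases ω.path i x hxi y hy with h' | h' | h'
      · exact Or.inl h'.symm
      · rcases Finset.mem_insert.1 (h hy) with h'' | h''
        · exact Or.inl h''
        · exact absurd (hS y h'' x h') hxS
      · exact Or.inr h'
    · exact Or.inl fun y hy => (Finset.mem_insert.1 (h hy)).resolve_left
        (by rintro rfl; exact hxi hy)
  · rintro (h | ⟨hxi, h⟩) y hy
    · exact Finset.mem_insert_of_mem (h hy)
    · refine Finset.insert_subset_insert x (dep_subset_of_frontier hS hx)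
        (ω.sch_subset_scope (ω.mem_relsAt.2 ⟨hxi, h⟩) hy)

theorem frontier_insert {S : Finset (Fin Q.m)} (hS : ω.UpClosed S) {x : Fin Q.m}
    (hx : x ∈ ω.frontier S) :
    ω.frontier (insert x S) = (ω.frontier S).erase x ∪ ω.children (some x) := by
  obtain ⟨hxS, -⟩ := mem_frontier.1 hx
  ext y
  simp only [Finset.mem_union, Finset.mem_erase, mem_frontier, mem_children, Finset.mem_insert,
    not_or]
  constructor
  · rintro ⟨⟨h1, h2⟩, h3⟩
    rcases hp : ω.parent y with _ | p
    · exact Or.inl ⟨h1, h2, by simp⟩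
    · rcases h3 p hp with rfl | h
      · exact Or.inr rfl
      · refine Or.inl ⟨h1, h2, ?_⟩
        rintro q ⟨⟩
        exact h
  · rintro (⟨h1, h2, h3⟩ | h)
    · exact ⟨⟨h1, h2⟩, fun p hp => Or.inr (h3 p hp)⟩
    · refine ⟨⟨ne_of_parent h, fun hy => hxS (hS y hy x (ω.anc_of_parent h))⟩, fun p hp => ?_⟩
      rw [h, Option.some.injEq] at hp
      exact Or.inl hp.symm

omit [CommRing D] in
theorem tbl_emb_update {S : Finset (Fin Q.m)} {w : View Q} (hw : ω.schema w ⊆ S) {x : Fin Q.m}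
    (hx : x ∉ S) (s : Valuation Q Dom) (a : Dom x) :
    ω.tbl P w (emb (Function.update s x a)) = ω.tbl P w (emb s) := by
  rw [emb_update]
  exact tbl_congr (agree_update (fun h => hx (hw h)) _ _)

/-- One elimination step: the variable `x` is marginalized. -/
theorem partialProd_eq_sum (hft : ω.FreeTop) (h : ω.Stored (liftValue Q g) (relWord db) P F)
    {S : Finset (Fin Q.m)} (hS : ω.UpClosed S) {x : Fin Q.m} (hx : x ∈ ω.frontier S)
    (hxf : x ∉ Q.free) (s : Valuation Q Dom) :
    ω.partialProd g P S s = ∑ᶠ a, ω.partialProd g P (insert x S) (Function.update s x a) := by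
  obtain ⟨hxS, hxp⟩ := mem_frontier.1 hx
  have hstep : ∀ a, ω.partialProd g P (insert x S) (Function.update s x a) =
      ((∏ i ∈ Finset.univ.filter (fun i => Q.sch i ⊆ S), ω.tbl P (.rel i) (emb s)) *
        (∏ y ∈ (ω.frontier S).erase x, ω.tbl P (.V y) (emb s)) * ∏ z ∈ S \ Q.free, g z (s z)) *
        (ω.tbl P (.H x) (emb (Function.update s x a)) * weight Q g x a) := by
    intro a
    rw [partialProd, filter_sch_insert hS hx, frontier_insert hS hx, Finset.prod_union,
      Finset.prod_union, tbl_H_emb h, weight, if_neg hxf, Finset.insert_sdiff_of_notMem _ hxf,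
      Finset.prod_insert, Function.update_self]
    · have h1 : ∏ i ∈ Finset.univ.filter (fun i => Q.sch i ⊆ S),
          ω.tbl P (.rel i) (emb (Function.update s x a)) =
          ∏ i ∈ Finset.univ.filter (fun i => Q.sch i ⊆ S), ω.tbl P (.rel i) (emb s) :=
        Finset.prod_congr rfl fun i hi =>
          tbl_emb_update (w := .rel i) (Finset.mem_filter.1 hi).2 hxS s a
      have h2 : ∏ y ∈ (ω.frontier S).erase x, ω.tbl P (.V y) (emb (Function.update s x a)) =
          ∏ y ∈ (ω.frontier S).erase x, ω.tbl P (.V y) (emb s) :=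
        Finset.prod_congr rfl fun y hy => tbl_emb_update (w := .V y)
          (dep_subset_of_frontier hS (Finset.mem_of_mem_erase hy)) hxS s a
      have h3 : ∏ z ∈ S \ Q.free, g z (Function.update s x a z) = ∏ z ∈ S \ Q.free, g z (s z) :=
        Finset.prod_congr rfl fun z hz => by
          rw [Function.update_of_ne]
          rintro rfl
          exact hxS (Finset.mem_sdiff.1 hz).1
      rw [h1, h2, h3]
      ring
    · exact fun h => hxS (Finset.mem_sdiff.1 h).1
    · rw [Finset.disjoint_left]
      intro y hy hy'
      exact hxS ((mem_frontier.1 (Finset.mem_of_mem_erase hy)).2 x (ω.mem_children.1 hy'))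
    · rw [Finset.disjoint_left]
      intro i hi hi'
      exact hxS ((Finset.mem_filter.1 hi).2 (ω.mem_relsAt.1 hi').1)
  rw [finsum_congr hstep, ← mul_finsum', ← h.sum_emb hft, partialProd,
    ← Finset.mul_prod_erase _ _ hx]
  · ring
  · exact (h.finite_emb x s).subset fun a ha h0 => ha (by simp only [h0, zero_mul])

/-- Summation by fibres. -/
theorem finsum_fiberwise {α β M : Type*} [AddCommMonoid M] (f : α → M)
    (hf : (Function.support f).Finite) (A : α → Prop) (π : α → β) :
    ∑ᶠ (s) (_ : A s), f s = ∑ᶠ (b : β) (s) (_ : A s ∧ π s = b), f s := by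
  let F : α × β → M := fun e => if A e.1 ∧ π e.1 = e.2 then f e.1 else 0
  have hF : (Function.support F).Finite := by
    refine (hf.image fun s => (s, π s)).subset fun e he => ?_
    by_cases h : A e.1 ∧ π e.1 = e.2
    · exact ⟨e.1, by simpa [F, h] using he, Prod.ext rfl h.2⟩
    · exact absurd (if_neg h) he
  have h1 := finsum_curry F hF
  have h2 := finsum_curry (F ∘ Prod.swap) (by
    refine (hF.image Prod.swap).subset fun e he => ⟨e.swap, he, Prod.swap_swap e⟩)
  have h3 : ∑ᶠ e, (F ∘ Prod.swap) e = ∑ᶠ e, F e := finsum_comp_equiv (Equiv.prodComm β α) (f := F)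
  rw [h3, h1] at h2
  have h4 : ∀ s, ∑ᶠ b, F (s, b) = ∑ᶠ _ : A s, f s := by
    intro s
    rw [finsum_eq_single _ (π s), finsum_eq_if]
    · simp [F]
    · intro b hb
      exact if_neg fun h => hb h.2.symm
  rw [← finsum_congr h4, h2]
  exact finsum_congr fun b => finsum_congr fun s => by rw [finsum_eq_if]; rfl

/-- The summand of the query result. -/
theorem partialProd_univ (h : ω.Stored (liftValue Q g) (relWord db) P F) (s : Valuation Q Dom) :
    ω.partialProd g P Finset.univ s =
      (∏ i, db i (proj Q (Q.sch i) s)) * ∏ x ∈ Q.freeᶜ, g x (s x) := by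
  rw [partialProd, frontier_univ, Finset.prod_empty, mul_one, Finset.compl_eq_univ_sdiff]
  congr 1
  refine Finset.prod_congr (by simp) fun i _ => ?_
  rw [h.rel, relWord_emb]

theorem finite_support_partialProd (h : ω.Stored (liftValue Q g) (relWord db) P F) :
    (Function.support (ω.partialProd g P Finset.univ)).Finite := by
  have hfin : (Set.univ.pi fun i => ((db i).support : Set (Tuple Q Dom (Q.sch i)))).Finite :=
    Set.Finite.pi fun i => Finset.finite_toSet _
  refine (hfin.preimage (f := fun (s : Valuation Q Dom) i => proj Q (Q.sch i) s)
    (Function.Injective.injOn ?_)).subset fun s hs => ?_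
  · intro s s' hss
    funext x
    obtain ⟨i, hi⟩ := Q.covered x
    exact congrFun (congrFun hss i) ⟨x, hi⟩
  · rw [Function.mem_support, partialProd_univ h] at hs
    simp only [Set.mem_preimage, Set.mem_pi, Set.mem_univ, forall_true_left, Finset.mem_coe,
      Finsupp.mem_support_iff]
    exact fun i h0 => hs (by rw [Finset.prod_eq_zero (Finset.mem_univ i) h0, zero_mul])

/-- Several elimination steps: the variables in `L`, a downward closed set of bound variables, are
marginalized. -/
theorem partialProd_eq_sum_agree (hft : ω.FreeTop)
    (h : ω.Stored (liftValue Q g) (relWord db) P F) (L : List (Fin Q.m)) (hn : L.Nodup)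
    (hpw : L.Pairwise fun a b => ¬ ω.Anc b a) (hL : ∀ x ∈ L, x ∉ Q.free)
    (hup : ∀ x ∈ L, ∀ y, ω.Anc x y → y ∈ L) (s₀ : Valuation Q Dom) :
    ω.partialProd g P (Finset.univ.filter (· ∉ L)) s₀ =
      ∑ᶠ (s) (_ : ∀ y, y ∉ L → s y = s₀ y), ω.partialProd g P Finset.univ s := by
  induction L generalizing s₀ with
  | nil =>
    have h1 : ∀ s, (∀ y, y ∉ ([] : List (Fin Q.m)) → s y = s₀ y) ↔ s = s₀ := by
      intro s; simp [funext_iff]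
    simp only [h1, finsum_cond_eq_left]
    congr 1
    simp
  | cons x L ih =>
    obtain ⟨hx, hn⟩ := List.nodup_cons.1 hn
    obtain ⟨hxp, hpw⟩ := List.pairwise_cons.1 hpw
    set S := Finset.univ.filter (· ∉ x :: L) with hSdef
    have hmem : ∀ y, y ∈ S ↔ y ∉ x :: L := by simp [hSdef]
    have hS : ω.UpClosed S := by
      intro z hz y hy
      rw [hmem] at hz ⊢
      exact fun h' => hz (hup y h' z hy)
    have hxS : x ∈ ω.frontier S := by
      refine mem_frontier.2 ⟨by simp [hSdef], fun p hp => ?_⟩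
      rw [hmem]
      intro h'
      rcases List.mem_cons.1 h' with rfl | h'
      · exact absurd rfl (ne_of_parent hp)
      · exact hxp p h' (ω.anc_of_parent hp)
    have hins : insert x S = Finset.univ.filter (· ∉ L) := by
      ext y
      rw [Finset.mem_insert, hmem]
      by_cases hy : y = x
      · subst hy; simp [hx]
      · simp [hy]
    have hup' : ∀ z ∈ L, ∀ y, ω.Anc z y → y ∈ L := by
      intro z hz y hy
      refine (List.mem_cons.1 (hup z (by simp [hz]) y hy)).resolve_left ?_
      rintro rfl
      exact hxp z hz hy
    rw [partialProd_eq_sum hft h hS hxS (hL x (by simp)),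
      finsum_fiberwise _ (finite_support_partialProd h) _ (fun s => s x)]
    refine finsum_congr fun a => ?_
    rw [hins, ih hn hpw (fun y hy => hL y (by simp [hy])) hup']
    refine finsum_congr fun s => ?_
    have : (∀ y, y ∉ L → s y = Function.update s₀ x a y) ↔
        (∀ y, y ∉ x :: L → s y = s₀ y) ∧ s x = a := by
      constructor
      · intro h
        refine ⟨fun y hy => ?_, by simpa using h x hx⟩
        rw [List.mem_cons, not_or] at hy
        rw [h y hy.2, Function.update_of_ne hy.1]
      · rintro ⟨h, hx⟩ y hy
        by_cases hyx : y = x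
        · subst hyx; simpa using hx
        · rw [Function.update_of_ne hyx]
          exact h y (by simp [hyx, hy])
    simp only [this]

/-- The bound variables, ancestors first. -/
def boundOrder (ω : VarOrder Q) : List (Fin Q.m) := ω.order.filter fun x => x ∉ Q.free

theorem mem_boundOrder {x : Fin Q.m} : x ∈ ω.boundOrder ↔ x ∉ Q.free := by
  simp [boundOrder, ω.mem_order]

/-- The payload of an output tuple is a product of stored entries. -/
theorem result_eq_partialProd (hft : ω.FreeTop) (h : ω.Stored (liftValue Q g) (relWord db) P F)
    (s₀ : Valuation Q Dom) :
    result Q g db (proj Q Q.free s₀) = ω.partialProd g P Q.free s₀ := by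
  have h1 := partialProd_eq_sum_agree hft h ω.boundOrder (ω.order_nodup.filter _)
    (ω.order_pairwise.filter _) (fun x => mem_boundOrder.1) (fun x hx y hy => by
      rw [mem_boundOrder] at hx ⊢
      exact fun h => hx (hft x y hy h)) s₀
  have h2 : Finset.univ.filter (· ∉ ω.boundOrder) = Q.free := by
    ext x; simp [mem_boundOrder]
  rw [h2] at h1
  rw [h1, result]
  refine finsum_congr fun s => ?_
  rw [partialProd_univ h]
  have : proj Q Q.free s = proj Q Q.free s₀ ↔ ∀ y, y ∉ ω.boundOrder → s y = s₀ y := by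
    simp only [mem_boundOrder, not_not]
    rw [funext_iff, Subtype.forall]
    rfl
  simp only [this]

/-- The views that determine the payload of an output tuple are those that decide the activity of
the free nodes. -/
theorem mem_payloadViews (hft : ω.FreeTop) {w : View Q} : w ∈ ω.payloadViews ↔
    ∃ o, (∀ x, o = some x → x ∈ Q.free) ∧ w ∈ ω.boundViews o := by
  simp only [payloadViews, List.mem_append, List.mem_map, Finset.mem_toList, Finset.mem_filter,
    Finset.mem_univ, true_and, mem_frontier]
  constructor
  · rintro (⟨i, hi, rfl⟩ | ⟨y, ⟨hy, hp⟩, rfl⟩)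
    · obtain ⟨o, ho⟩ := ω.exists_mem_relsUnder i
      refine ⟨o, ?_, ω.mem_boundViews.2 (Or.inl ⟨i, ho, rfl⟩)⟩
      rintro x rfl
      exact hi (ω.mem_relsAt.1 ho).1
    · exact ⟨_, hp, ω.mem_boundViews.2 (Or.inr ⟨y, rfl, hy, rfl⟩)⟩
  · rintro ⟨o, ho, hw⟩
    rcases ω.mem_boundViews.1 hw with ⟨i, hi, rfl⟩ | ⟨y, rfl, hy, rfl⟩
    · refine Or.inl ⟨i, ?_, rfl⟩
      rcases o with _ | x
      · simp only [relsUnder, Finset.mem_filter] at hi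
        simp [hi.2]
      · intro y hy
        have hx := ho x rfl
        rcases (ω.mem_relsAt.1 hi).2 y hy with rfl | h
        · exact hx
        · exact hft y x h hx
    · exact Or.inr ⟨y, ⟨hy, ho⟩, rfl⟩

theorem upClosed_free (hft : ω.FreeTop) : ω.UpClosed Q.free := fun x hx y hy => hft y x hy hx

theorem schema_payloadViews (hft : ω.FreeTop) {w : View Q} (hw : w ∈ ω.payloadViews) :
    ω.schema w ⊆ Q.free := by
  simp only [payloadViews, List.mem_append, List.mem_map, Finset.mem_toList, Finset.mem_filter,
    Finset.mem_univ, true_and] at hw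
  rcases hw with ⟨i, hi, rfl⟩ | ⟨y, hy, rfl⟩
  · exact hi
  · exact dep_subset_of_frontier (upClosed_free hft) hy

theorem partialProd_free (s : Valuation Q Dom) : ω.partialProd g P Q.free s =
    (ω.payloadViews.map fun w => ω.tbl P w (emb s)).prod := by
  rw [partialProd, sdiff_self, Finset.bot_eq_empty, Finset.prod_empty, mul_one, payloadViews,
    List.map_append, List.prod_append, List.map_map, List.map_map, ← Finset.prod_map_toList,
    ← Finset.prod_map_toList]
  rfl

end VarOrder

namespace VarOrder

variable {Q : Query} {Dom : Fin Q.m → Type u} {D : Type v} [CommRing D] {ω : VarOrder Q}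
  {g : (x : Fin Q.m) → Dom x → D} {db : Database Q Dom D}
  {P : ℕ → List (Word (Value Q Dom)) → D}
  {F : ℕ → List (Word (Value Q Dom)) → Word (Value Q Dom)}

/-! ### The enumerated tuples are the query result -/

/-- A listed tuple over the free variables has a derivation. -/
theorem Stored.exists_derivation (hft : ω.FreeTop)
    (h : ω.Stored (liftValue Q g) (relWord db) P F) {v : Fin Q.m → Word (Value Q Dom)}
    (ha : ω.Active P F none v) (hl : ∀ x ∈ Q.free, ω.Listed F x v) :
    ∃ s : Valuation Q Dom, Agree Q.free v (emb s) ∧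
      (∀ i, db i (proj Q (Q.sch i) s) ≠ 0) ∧
      ∀ o, (∀ x, o = some x → x ∈ Q.free) → ω.Active P F o (emb s) := by
  obtain ⟨v', h1, h2, h3⟩ := exists_active_extension (liftValue Q g) hft h.sound ω.boundOrder
    (ω.order_nodup.filter _) (ω.order_pairwise.filter _) (fun x _ => h.fresh x)
    {o | ∀ x, o = some x → x ∈ Q.free}
    (fun x hx => by
      by_cases hp : ∃ p, ω.parent x = some p ∧ p ∉ Q.free
      · obtain ⟨p, hp, hpf⟩ := hp
        exact Or.inr ⟨p, mem_boundOrder.2 hpf, hp⟩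
      · refine Or.inl fun p hpx => ?_
        by_contra hpf
        exact hp ⟨p, hpx, hpf⟩)
    (by
      rintro (_ | x) ho y hy hys
      · simp [nodeScope] at hys
      · rcases ω.mem_scope hys with rfl | h'
        · exact mem_boundOrder.1 hy (ho y rfl)
        · exact mem_boundOrder.1 hy (hft y x h' (ho x rfl)))
    v (by
      rintro (_ | x) ho
      · exact ha
      · exact ((h.fresh x v).2.1 (hl x (ho x rfl))).2)
  have hact : ∀ x, ω.Active P F (some x) v' := by
    intro x
    by_cases hx : x ∈ Q.free
    · refine h2 (some x) ?_
      rintro y ⟨⟩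
      exact hx
    · exact h3 x (mem_boundOrder.2 hx)
  choose s hs using fun x => h.exists_val hft (hact x)
  have hs' : v' = emb s := funext hs
  subst hs'
  refine ⟨s, fun x hx => (h1 x fun h' => mem_boundOrder.1 h' hx).symm, fun i => ?_, h2⟩
  rw [← relWord_emb, ← h.rel]
  obtain ⟨o, ho⟩ := ω.exists_mem_relsUnder i
  rcases o with _ | x
  · exact (h2 none (by rintro x ⟨⟩)).rel_ne_zero ho
  · exact (hact x).rel_ne_zero ho

/-- A tuple of nonzero payload is listed: the factors of its payload are nonzero, and these are all
views that decide the activity of the free nodes. -/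
theorem Stored.listed_of_result_ne_zero (hft : ω.FreeTop)
    (h : ω.Stored (liftValue Q g) (relWord db) P F) {s : Valuation Q Dom}
    (h0 : result Q g db (proj Q Q.free s) ≠ 0) :
    ω.Active P F none (emb s) ∧ ∀ x ∈ Q.free, ω.Listed F x (emb s) := by
  have hw : ∀ w ∈ ω.payloadViews, ω.tbl P w (emb s) ≠ 0 := by
    intro w hw h'
    rw [result_eq_partialProd hft h, partialProd_free] at h0
    exact h0 (List.prod_eq_zero (List.mem_map.2 ⟨w, hw, h'⟩))
  have h1 : (1 : D) ≠ 0 := fun e => h0 (by rw [← mul_one (result _ _ _ _), e, mul_zero])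
  have hact : ∀ o, (∀ x, o = some x → x ∈ Q.free) →
      (∀ y ∈ ω.freeChildren o, ω.Listed F y (emb s)) → ω.Active P F o (emb s) :=
    fun o ho hy => ⟨h1, fun w hwo => hw w ((mem_payloadViews hft).2 ⟨o, ho, hwo⟩),
      fun y hyo => ⟨emb s y, by rw [Function.update_eq_self]; exact hy y hyo⟩⟩
  have hl : ∀ x, x ∈ Q.free → ω.Listed F x (emb s) := by
    intro x
    induction x using ω.wf.induction with
    | _ x ih =>
      intro hx
      refine (h.fresh x _).2.2 ⟨by simp [emb], hact _ ?_ fun y hy => ?_⟩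
      · rintro y ⟨⟩
        exact hx
      · obtain ⟨hp, hy⟩ := ω.mem_freeChildren.1 hy
        exact ih y hp hy
  exact ⟨hact none (by rintro x ⟨⟩) fun y hy => hl y (ω.mem_freeChildren.1 hy).2, hl⟩

theorem kw_free_eq_key {v : Fin Q.m → Word (Value Q Dom)} {s : Valuation Q Dom}
    (h : Agree Q.free v (emb s)) : kw Q.free v = key Q Q.free (proj Q Q.free s) := by
  rw [key_proj]
  exact kw_eq_iff.2 h

theorem Stored.outRecord_eq (hft : ω.FreeTop)
    (h : ω.Stored (liftValue Q g) (relWord db) P F) {v : Fin Q.m → Word (Value Q Dom)}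
    {s : Valuation Q Dom} (hs : Agree Q.free v (emb s)) :
    ω.outRecord P v =
      (key Q Q.free (proj Q Q.free s), result Q g db (proj Q Q.free s)) := by
  rw [outRecord, kw_free_eq_key hs, result_eq_partialProd hft h, partialProd_free]
  congr 2
  exact List.map_congr_left fun w hw => tbl_congr (hs.mono (schema_payloadViews hft hw))

theorem Stored.listsResult (hft : ω.FreeTop)
    (h : ω.Stored (liftValue Q g) (relWord db) P F) {v₀ : Fin Q.m → Word (Value Q Dom)}
    {vs : List (Fin Q.m → Word (Value Q Dom))} (hn : vs.Nodup)
    (hvs : ∀ v, v ∈ vs ↔ ω.Active P F none v ∧ (∀ y, y ∉ Q.free → v y = v₀ y) ∧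
      ∀ x ∈ Q.free, ω.Listed F x v) :
    ListsResult g db (vs.map (ω.outRecord P)) := by
  choose s hs hder hact using fun v : {v // v ∈ vs} =>
    h.exists_derivation hft ((hvs v.1).1 v.2).1 ((hvs v.1).1 v.2).2.2
  refine ⟨vs.attach.map fun v => proj Q Q.free (s v), ?_, ?_, fun t ht => ?_, fun t ht => ?_,
    fun hD t ht => ?_⟩
  · refine (List.nodup_attach.2 hn).map fun v v' hvv => Subtype.ext (funext fun y => ?_)
    by_cases hy : y ∈ Q.free
    · rw [hs v y hy, hs v' y hy, emb_apply_inj]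
      exact congrFun hvv ⟨y, hy⟩
    · rw [((hvs v.1).1 v.2).2.1 y hy, ((hvs v'.1).1 v'.2).2.1 y hy]
  · rw [List.map_map]
    conv_lhs => rw [← List.attach_map_subtype_val vs, List.map_map]
    exact List.map_congr_left fun v _ => h.outRecord_eq hft (hs v)
  · obtain ⟨s₀, rfl⟩ : ∃ s₀, proj Q Q.free s₀ = t := by
      rw [result] at ht
      obtain ⟨s₀, hs₀⟩ := exists_ne_zero_of_finsum_ne_zero ht
      obtain ⟨e, -⟩ := exists_ne_zero_of_finsum_ne_zero hs₀
      exact ⟨s₀, e⟩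
    obtain ⟨h1, h2⟩ := h.listed_of_result_ne_zero hft ht
    let v : Fin Q.m → Word (Value Q Dom) := fun y => if y ∈ Q.free then emb s₀ y else v₀ y
    have hv : Agree Q.free (emb s₀) v := fun y hy => by simp [v, hy]
    have hmem : v ∈ vs := by
      refine (hvs v).2 ⟨active_node_congr (fun y hy => by simp [nodeScope] at hy) h1,
        fun y hy => by simp [v, hy], fun x hx => (listed_congr (hv.mono fun y hy => ?_)).1 (h2 x hx)⟩
      rcases ω.mem_scope hy with rfl | hy
      · exact hx
      · exact hft y x hy hx
    refine List.mem_map.2 ⟨⟨v, hmem⟩, List.mem_attach _ _, funext fun ⟨y, hy⟩ => ?_⟩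
    exact (emb_apply_inj.1 ((hv y hy).trans (hs ⟨v, hmem⟩ y hy))).symm
  · obtain ⟨v, -, rfl⟩ := List.mem_map.1 ht
    exact ⟨s v, rfl, hder v⟩
  · obtain ⟨v, -, rfl⟩ := List.mem_map.1 ht
    have h1 := (hact v none (by rintro x ⟨⟩)).1
    have : Nontrivial D := ⟨1, 0, h1⟩
    rw [result_eq_partialProd hft h, partialProd_free]
    refine List.prod_ne_zero fun h0 => ?_
    obtain ⟨w, hw, h0⟩ := List.mem_map.1 h0
    obtain ⟨o, ho, hwo⟩ := (mem_payloadViews hft).1 hw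
    exact (hact v o ho).2.1 w hwo h0

theorem Stored.enumerate (hft : ω.FreeTop) {σ : State (Value Q Dom) D}
    (h : ω.Stored (liftValue Q g) (relWord db) σ.pdict σ.dict) :
    ∃ tr σ', Exec (liftValue Q g) ω.enumerate { σ with input := [] } tr σ' ∧
      ListsResult g db (tr.filterMap id) ∧ DelayAtMost ω.pace tr ∧
      σ'.pdict = σ.pdict ∧ σ'.dict = σ.dict := by
  obtain ⟨tr, σ', hx, h1, h2, h3, v, vs, hn, hvs, hout⟩ :=
    enumerate_exec (liftValue Q g) hft { σ with input := [] } h.sound h.fresh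
  refine ⟨tr, σ', hx, ?_, h3, h1, h2⟩
  rw [hout]
  exact h.listsResult hft hn hvs

/-! ### Maintenance -/

theorem DelayAtMost.mono {A : Type u} {D : Type v} {c c' : ℕ} {tr : List (Option (Record A D))}
    (h : DelayAtMost c tr) (hc : c ≤ c') : DelayAtMost c' tr := fun l₁ l₂ l₃ e hq =>
  (h l₁ l₂ l₃ e hq).trans hc

theorem records_map (db : Database Q Dom D) (L : List ((i : Fin Q.n) × Tuple Q Dom (Q.sch i))) :
    (records db L).map (fun e => record e.1 e.2.1 e.2.2) =
      L.map fun e => entry Q e.1 e.2 (db e.1 e.2) := by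
  rw [records, List.map_map]
  rfl

theorem typed_records (db : Database Q Dom D) (L : List ((i : Fin Q.n) × Tuple Q Dom (Q.sch i))) :
    ∀ e ∈ records db L, Typed e.1 e.2.1 := by
  intro e he
  obtain ⟨e, -, rfl⟩ := List.mem_map.1 he
  exact typed_tupleWord e.1 e.2

variable (ω)

/-- Maintenance with path updates. -/
def pathEngine : Engine Q where
  preprocess := ω.preprocessPath
  update := ω.maintainPath
  enumerate := ω.enumerate
  table := table

/-- Maintenance with a log of all keys. -/
def logEngine : Engine Q where
  preprocess := ω.preprocessLog
  update := ω.maintainLog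
  enumerate := ω.enumerate
  table := table

theorem pathEngine_maintains (hft : ω.FreeTop) (hpc : ω.PathClosed)
    (g : (x : Fin Q.m) → Dom x → D) :
    ω.pathEngine.MaintainsOver ω (ω.preprocessPathCost + ω.maintainPath.cost + ω.pace)
      (fun _ => 1) g := by
  refine ⟨fun db σ => ω.Stored (liftValue Q g) (relWord db) σ.pdict σ.dict,
    fun db L hn hL => ?_, fun db σ h => h.materialized hft, fun db σ h i t p => ?_,
    fun db σ h => ?_⟩
  · obtain ⟨tr, σ, hx, hlen, h⟩ := preprocessPath_exec (liftValue Q g) hpc (records db L)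
      (typed_records db L)
    rw [records_map] at hx
    rw [loaded_records db L hn hL] at h
    refine ⟨tr, σ, hx, hlen.trans ?_, h⟩
    rw [records, List.length_map, length_eq_size db L hn hL]
    exact Nat.mul_le_mul_right _ (by omega)
  · obtain ⟨tr, σ', hx, hlen, h'⟩ := maintainPath_exec (liftValue Q g) hpc
      { σ with input := [entry Q i t p] } h (i := i) (v := tupleWord (Q.sch i) t) (p := p) rfl
    refine ⟨tr, σ', hx, ?_, ?_⟩
    · rw [mul_one]; omega
    · simp only [relWord_update]; exact h'
  · obtain ⟨tr, σ', hx, h1, h2, h3, h4⟩ := h.enumerate hft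
    exact ⟨tr, σ', hx, h1, DelayAtMost.mono h2 (by omega), by
      simp only [h3, h4]; exact h⟩

/-- The time per log entry of `maintainLog`. -/
def logUpdateCost : ℕ := (Prog.seq (setup (Q := Q)) readNext).cost + ω.updateLogCost

theorem logEngine_maintains (hft : ω.FreeTop) (han : ω.Anchored)
    (g : (x : Fin Q.m) → Dom x → D) :
    ω.logEngine.MaintainsOver ω (2 * ω.preprocessLogCost + 2 * ω.logUpdateCost + ω.pace)
      (fun N => N + 1) g := by
  refine ⟨fun db σ => ∃ l, ω.StoredLog (liftValue Q g) (relWord db) l σ.pdict σ.dict,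
    fun db L hn hL => ?_, fun db σ ⟨l, h⟩ => h.stored.materialized hft,
    fun db σ ⟨l, h⟩ i t p => ?_, fun db σ ⟨l, h⟩ => ?_⟩
  · obtain ⟨tr, σ, l, hx, hlen, h⟩ := preprocessLog_exec (liftValue Q g) hft han (records db L)
      (typed_records db L)
    rw [records_map] at hx
    rw [loaded_records db L hn hL] at h
    refine ⟨tr, σ, hx, hlen.trans ?_, l, h⟩
    have := log_length_le db h.cycle.nodup h.logs
    rw [records, List.length_map, length_eq_size db L hn hL]
    nlinarith
  · obtain ⟨tr, σ', hx, hlen, l', h'⟩ := maintainLog_exec (liftValue Q g) hft han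
      { σ with input := [entry Q i t p] } h (i := i) (v := tupleWord (Q.sch i) t)
      (typed_tupleWord i t) (p := p) rfl
    refine ⟨tr, σ', hx, ?_, l', by rwa [relWord_update]⟩
    have := log_length_le db h.cycle.nodup h.logs
    change _ ≤ ω.logUpdateCost * _ at hlen
    nlinarith
  · obtain ⟨tr, σ', hx, h1, h2, h3, h4⟩ := h.stored.enumerate hft
    exact ⟨tr, σ', hx, h1, DelayAtMost.mono h2 (by omega), l, by rwa [h3, h4]⟩

end VarOrder

end FIVM

end

theorem mainTheorem1 (Q : FIVM.Query) :
    (Q.FreeConnexAcyclic → FIVM.Maintainable.{u, v} Q (fun N => N + 1)) ∧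
    (Q.QHierarchical → FIVM.Maintainable.{u, v} Q (fun _ => 1)) := by
  constructor
  · intro h
    obtain ⟨ω, hft, han⟩ := h.exists_varOrder
    exact ⟨ω, ω.logEngine, _, hft, fun Dom D _ g => ω.logEngine_maintains hft han g⟩
  · intro h
    obtain ⟨ω, hft, hpc⟩ := h.exists_varOrder
    exact ⟨ω, ω.pathEngine, _, hft, fun Dom D _ g => ω.pathEngine_maintains hft hpc g⟩
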